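/- **Setting.** Let $(\Omega,\mathcal F,\mathbb P)$ be a probability space. Random variables are real-valued and identified when they are $\mathbb P$-a.s. equal. Let $U:(0,\infty)\to\mathbb R$ be strictly increasing, strictly concave and continuously differentiable, with $U(0)=\lim_{x\downarrow 0}U(x)$, and let $V(y)=\sup_{x>0}\{U(x)-xy\}$ for $y\ge 0$. Assume that $U$ is two-times differentiable on $(0,\infty)$ and that there are constants $c_1>0$ and $c_2<\infty$ such that $$c_1<A(x):=-\frac{xU''(x)}{U'(x)}<c_2,\qquad x>0,$$ and put $B(y)=-yV''(y)/V'(y)$ for $y>0$. Let $\mathcal C,\mathcal D$ be sets of nonnegative random variables such that $1\in\mathcal C$, $\mathcal C$ is bounded in $\mathbf L^0$, i.e. $\lim_{n\to\infty}\sup_{g\in\mathcal C}\mathbb P[|g|\ge n]=0$, and, for nonnegative random variables $g,h$, $$g\in\mathcal C\iff \mathbb E[gh]\le 1\ \ \forall h\in\mathcal D,\qquad h\in\mathcal D\iff \mathbb E[gh]\le 1\ \ \forall g\in\mathcal C .$$ Put $\mathcal C(x)=x\mathcal C$, $\mathcal D(y)=y\mathcal D$ and $$u(x)=\sup_{g\in\mathcal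 C(x)}\mathbb E[U(g)],\qquad v(y)=\inf_{h\in\mathcal D(y)}\mathbb E[V(h)],\qquad x,y>0,$$ where $\mathbb E[f]=\mathbb E[f^+]-\mathbb E[f^-]$, understood as $-\infty$ if $\mathbb E[f^-]=\infty$. Assume $u(x)<\infty$ for all $x>0$. Then $u$ and $v$ are finite and differentiable on $(0,\infty)$, $u'>0$, and for all $x,y>0$ the two problems have a.s. unique solutions, denoted $g(x)$ and $h(y)$. Fix $x>0$, let $y=u'(x)$, and let $\mathbb R(x)$ be the probability measure with $\frac{d\mathbb R(x)}{d\mathbb P}=\frac{g(x)h(y)}{xy}$. Let $\mathbf L^2_0(\mathbb R(x))$ be the space of $\mathbb R(x)$-square integrable random variables with $\mathbb R(x)$-mean zero, and let $\mathcal A^2(x)$, $\mathcal B^2(y)$ be the closures in $\mathbf L_0^2(\mathbb R(x))$ of $$\mathcal A^\infty(x)=\{\alpha\in\mathbf L^\infty: g(x)(1\pm c\alpha)\in\mathcal C(x)\text{ for some }c>0\},\quad \mathcal B^\infty(y)=\{\beta\in\mathbf L^\infty: h(y)(1\pm c\beta)\in\mathcal D(y)\text{ for some }c>0\}.$$ Assume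 that $\mathcal A^2(x)$ and $\mathcal B^2(y)$ are complementary in $\mathbf L^2_0(\mathbb R(x))$, i.e. each of them is the orthogonal complement of the other in $\mathbf L^2_0(\mathbb R(x))$. Put $$a(x)=\inf_{\alpha\in\mathcal A^2(x)}\mathbb E_{\mathbb R(x)}[A(g(x))(1+\alpha)^2],\qquad b(y)=\inf_{\beta\in\mathcal B^2(y)}\mathbb E_{\mathbb R(x)}[B(h(y))(1+\beta)^2].$$ These problems have unique solutions $\alpha(x)$ and $\beta(y)$; define $g'(x)=\frac{g(x)}{x}(1+\alpha(x))$ and $h'(y)=\frac{h(y)}{y}(1+\beta(y))$. **Theorem.** Under these assumptions: 1. $u$ and $v$ are two-times differentiable at $x$ and $y$, respectively, and $$c_1<-\frac{xu''(x)}{u'(x)}=a(x)<c_2,\qquad \frac1{c_2}<-\frac{yv''(y)}{v'(y)}=b(y)<\frac1{c_1}.$$ 2. As $\varepsilon\to0$, $$\frac{g(x+\varepsilon)-g(x)}{\varepsilon}\to g'(x),\qquad \frac{h(y+\varepsilon)-h(y)}{\varepsilon}\to h'(y)\qquad\text{in }\mathbb P\text{-probability}.$$ 3. $u''(x)=\mathbb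 E[U''(g(x))(g'(x))^2]$ and $v''(y)=\mathbb E[V''(h(y))(h'(y))^2]$; moreover $U''(g(x))g'(x)=u''(x)h'(y)$ a.s. -/

import Mathlib

open MeasureTheory Filter Topology Set
open scoped ENNReal

noncomputable section

namespace OptInvest

/-! ### Utility functions -/

/-- A utility function on `(0, ∞)`: strictly increasing, strictly concave and continuously
differentiable.  Only the values of `U` on `(0, ∞)` matter.  The Inada conditions are not listed:
they follow from two-sided bounds on the relative risk aversion. -/
structure IsUtility (U : ℝ → ℝ) : Prop where
  strictMono : StrictMonoOn U (Ioi 0)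
  strictConcave : StrictConcaveOn ℝ (Ioi 0) U
  differentiable : ∀ z, 0 < z → DifferentiableAt ℝ U z
  continuous_deriv : ContinuousOn (deriv U) (Ioi 0)

/-- `-z F''(z) / F'(z)`.  For `F = U` this is the relative risk aversion `A`, for `F = V` (the
conjugate of `U`) it is the relative risk tolerance `B`. -/
def relCoeff (F : ℝ → ℝ) (z : ℝ) : ℝ := -(z * deriv (deriv F) z / deriv F z)

/-- `U` is two-times differentiable on `(0, ∞)` and its relative risk aversion lies strictly
between the constants `c₁ > 0` and `c₂ < ∞`. -/
structure RiskAversionBounds (U : ℝ → ℝ) (c₁ c₂ : ℝ) : Prop where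
  c₁_pos : 0 < c₁
  twice_differentiable : ∀ z, 0 < z → DifferentiableAt ℝ (deriv U) z
  lower : ∀ z, 0 < z → c₁ < relCoeff U z
  upper : ∀ z, 0 < z → relCoeff U z < c₂

/-- `U` extended to the line: `U(0)` is the limit of `U` at `0+` (the infimum of its values, as
`U` is increasing) and may be `-∞`, and `U = -∞` on `(-∞, 0)`. -/
def extU (U : ℝ → ℝ) (z : ℝ) : EReal :=
  if 0 < z then (U z : EReal)
  else if z = 0 then ⨅ t : ℝ, ⨅ _ : 0 < t, (U t : EReal)
  else ⊥

/-- The convex conjugate `V(s) = sup_{z > 0} (U(z) - z s)`; at `s = 0` it is the supremum of `U`,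
possibly `+∞`. -/
def extV (U : ℝ → ℝ) (s : ℝ) : EReal :=
  ⨆ z : ℝ, ⨆ _ : 0 < z, ((U z - z * s : ℝ) : EReal)

/-- The conjugate `V` as a real function (used on `(0, ∞)`, for derivatives). -/
def conjV (U : ℝ → ℝ) (s : ℝ) : ℝ := (extV U s).toReal

variable {Ω : Type*} [MeasurableSpace Ω]

/-! ### Expectations, and sets of random variables -/

/-- Expectation of an extended real random variable, `E[f⁺] - E[f⁻]`, with the convention that it
is `-∞` if `E[f⁻] = ∞`. -/
def extExp (P : Measure Ω) (f : Ω → EReal) : EReal :=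
  ((∫⁻ ω, (f ω).toENNReal ∂P : ℝ≥0∞) : EReal) - ((∫⁻ ω, (-f ω).toENNReal ∂P : ℝ≥0∞) : EReal)

/-- Boundedness in `L⁰`: `sup_{g ∈ C} P[|g| ≥ n] → 0`. -/
def BoundedInL0 (P : Measure Ω) (C : Set (Ω → ℝ)) : Prop :=
  Tendsto (fun n : ℕ => ⨆ g ∈ C, P {ω | (n : ℝ) ≤ |g ω|}) atTop (𝓝 0)

/-- The polar of a set of nonnegative random variables: all nonnegative random variables `g` with
`E[g h] ≤ 1` for every `h` in the set. -/
def polar (P : Measure Ω) (D : Set (Ω → ℝ)) : Set (Ω → ℝ) :=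
  {g | Measurable g ∧ (∀ᵐ ω ∂P, 0 ≤ g ω) ∧
    ∀ h ∈ D, ∫⁻ ω, ENNReal.ofReal (g ω * h ω) ∂P ≤ 1}

/-- The bipolar relations between `C` and `D`. -/
def BipolarPair (P : Measure Ω) (C D : Set (Ω → ℝ)) : Prop :=
  C = polar P D ∧ D = polar P C

/-- The set `x C = {x g : g ∈ C}`. -/
def scaled (x : ℝ) (C : Set (Ω → ℝ)) : Set (Ω → ℝ) :=
  {f | ∃ g ∈ C, f = fun ω => x * g ω}

/-! ### The two optimization problems -/

/-- The primal value `sup_{g ∈ x C} E[U(g)]`. -/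
def primalValue (P : Measure Ω) (C : Set (Ω → ℝ)) (U : ℝ → ℝ) (x : ℝ) : EReal :=
  ⨆ g ∈ scaled x C, extExp P (fun ω => extU U (g ω))

/-- The dual value `inf_{h ∈ y D} E[V(h)]`. -/
def dualValue (P : Measure Ω) (D : Set (Ω → ℝ)) (U : ℝ → ℝ) (y : ℝ) : EReal :=
  ⨅ h ∈ scaled y D, extExp P (fun ω => extV U (h ω))

/-- The value function `u` as a real function. -/
def uFun (P : Measure Ω) (C : Set (Ω → ℝ)) (U : ℝ → ℝ) (x : ℝ) : ℝ :=
  (primalValue P C U x).toReal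

/-- The value function `v` as a real function. -/
def vFun (P : Measure Ω) (D : Set (Ω → ℝ)) (U : ℝ → ℝ) (y : ℝ) : ℝ :=
  (dualValue P D U y).toReal

/-- `g` is a solution of the primal problem at `x`. -/
def IsPrimalSol (P : Measure Ω) (C : Set (Ω → ℝ)) (U : ℝ → ℝ) (x : ℝ) (g : Ω → ℝ) : Prop :=
  g ∈ scaled x C ∧ extExp P (fun ω => extU U (g ω)) = primalValue P C U x

/-- `h` is a solution of the dual problem at `y`. -/
def IsDualSol (P : Measure Ω) (D : Set (Ω → ℝ)) (U : ℝ → ℝ) (y : ℝ) (h : Ω → ℝ) : Prop :=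
  h ∈ scaled y D ∧ extExp P (fun ω => extV U (h ω)) = dualValue P D U y

/-! ### The measure `R(x)` and the spaces of bounded and square integrable directions -/

/-- The measure with density `g h / (x y)` with respect to `P`. -/
def measR (P : Measure Ω) (x y : ℝ) (g h : Ω → ℝ) : Measure Ω :=
  P.withDensity (fun ω => ENNReal.ofReal (g ω * h ω / (x * y)))

/-- The bounded random variables `α` such that `g (1 + c α)` and `g (1 - c α)` belong to `x C` for
some `c > 0`.  With `g = g(x)` this is `𝒜^∞(x)`; with `h(y)`, `y` and `D` in place of `g`, `x` and
`C` it is `ℬ^∞(y)`. -/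
def bddDirections (P : Measure Ω) (C : Set (Ω → ℝ)) (x : ℝ) (g : Ω → ℝ) : Set (Ω → ℝ) :=
  {α | Measurable α ∧ (∃ K : ℝ, ∀ᵐ ω ∂P, |α ω| ≤ K) ∧
    ∃ c : ℝ, 0 < c ∧ (fun ω => g ω * (1 + c * α ω)) ∈ scaled x C ∧
      (fun ω => g ω * (1 - c * α ω)) ∈ scaled x C}

/-- The space `L²₀(Q)` of square integrable random variables with mean zero. -/
def L20 (Q : Measure Ω) : Set (Ω → ℝ) :=
  {f | Measurable f ∧ MemLp f 2 Q ∧ ∫ ω, f ω ∂Q = 0}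

/-- The closure in `L²₀(Q)` of a set of random variables. -/
def closureL20 (Q : Measure Ω) (S : Set (Ω → ℝ)) : Set (Ω → ℝ) :=
  {f | f ∈ L20 Q ∧ ∀ ε : ℝ≥0∞, 0 < ε → ∃ α ∈ S, eLpNorm (fun ω => f ω - α ω) 2 Q < ε}

/-- The space `𝒜²(x)`, for `y = u'(x)`, `g = g(x)` and `h = h(y)`. -/
def A2 (P : Measure Ω) (C : Set (Ω → ℝ)) (x y : ℝ) (g h : Ω → ℝ) : Set (Ω → ℝ) :=
  closureL20 (measR P x y g h) (bddDirections P C x g)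

/-- The space `ℬ²(y)`, for `y = u'(x)`, `g = g(x)` and `h = h(y)`. -/
def B2 (P : Measure Ω) (D : Set (Ω → ℝ)) (x y : ℝ) (g h : Ω → ℝ) : Set (Ω → ℝ) :=
  closureL20 (measR P x y g h) (bddDirections P D y h)

/-- `S` and `T` are complementary subspaces of `L²₀(Q)`: each of them is the orthogonal complement
of the other one. -/
def Complementary (Q : Measure Ω) (S T : Set (Ω → ℝ)) : Prop :=
  (∀ α : Ω → ℝ, α ∈ S ↔ α ∈ L20 Q ∧ ∀ β ∈ T, ∫ ω, α ω * β ω ∂Q = 0) ∧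
  (∀ β : Ω → ℝ, β ∈ T ↔ β ∈ L20 Q ∧ ∀ α ∈ S, ∫ ω, α ω * β ω ∂Q = 0)

/-! ### The auxiliary quadratic problems -/

/-- The value `inf_{α ∈ S} E_Q[ζ (1 + α)²]`. -/
def quadValue (Q : Measure Ω) (ζ : Ω → ℝ) (S : Set (Ω → ℝ)) : ℝ :=
  sInf ((fun α : Ω → ℝ => ∫ ω, ζ ω * (1 + α ω) ^ 2 ∂Q) '' S)

/-- `α` is a solution of the problem `inf_{α ∈ S} E_Q[ζ (1 + α)²]`. -/
def IsQuadSol (Q : Measure Ω) (ζ : Ω → ℝ) (S : Set (Ω → ℝ)) (α : Ω → ℝ) : Prop :=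
  α ∈ S ∧ ∫ ω, ζ ω * (1 + α ω) ^ 2 ∂Q = quadValue Q ζ S

/-- The number `a(x)`: the weight is `A(g(x))` and the infimum is over `𝒜²(x)`. -/
def aVal (P : Measure Ω) (C : Set (Ω → ℝ)) (U : ℝ → ℝ) (x y : ℝ) (g h : Ω → ℝ) : ℝ :=
  quadValue (measR P x y g h) (fun ω => relCoeff U (g ω)) (A2 P C x y g h)

/-- The number `b(y)`: the weight is `B(h(y))` and the infimum is over `ℬ²(y)`. -/
def bVal (P : Measure Ω) (D : Set (Ω → ℝ)) (U : ℝ → ℝ) (x y : ℝ) (g h : Ω → ℝ) : ℝ :=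
  quadValue (measR P x y g h) (fun ω => relCoeff (conjV U) (h ω)) (B2 P D x y g h)

/-- `α` is a solution `α(x)` of the problem defining `a(x)`. -/
def IsAlpha (P : Measure Ω) (C : Set (Ω → ℝ)) (U : ℝ → ℝ) (x y : ℝ) (g h α : Ω → ℝ) : Prop :=
  IsQuadSol (measR P x y g h) (fun ω => relCoeff U (g ω)) (A2 P C x y g h) α

/-- `β` is a solution `β(y)` of the problem defining `b(y)`. -/
def IsBeta (P : Measure Ω) (D : Set (Ω → ℝ)) (U : ℝ → ℝ) (x y : ℝ) (g h β : Ω → ℝ) : Prop :=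
  IsQuadSol (measR P x y g h) (fun ω => relCoeff (conjV U) (h ω)) (B2 P D x y g h) β

/-- The random variable `(g / x) (1 + α)`: this is `g'(x)` for `g = g(x)`, `α = α(x)`, and `h'(y)`
for `h(y)`, `y`, `β(y)` in place of `g`, `x`, `α`. -/
def derivRV (x : ℝ) (g α : Ω → ℝ) (ω : Ω) : ℝ := g ω / x * (1 + α ω)

end OptInvest

end

open OptInvest

/-! Maximizing `E[U]` over `x C` and minimizing `E[V]` over `y D` are problems of the same kind:
minimize `E[F(f)]` over a dilated polar set, with `F = -U` or `F = V`. In both cases the slope `φ =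
-F'` has elasticity between two positive constants (`c₁, c₂` for `-U` and `1/c₂, 1/c₁` for `V`), so
a single theory of `PowerLike` functions serves both sides, with the roles of `C` and `D` exchanged.

First order. A minimizing sequence is Cauchy in measure, by strict convexity and boundedness in
`L⁰`. Passing to the limit in the expectation needs no uniform integrability: losses that persisted
in the limit could be accumulated by summing members of the sequence, giving gains linear in the
capital, whereas `F` grows sublinearly (`frequently_loss_lt`). The minimizer `g` satisfies `E[f
φ(g)] ≤ t y` for all `f ∈ t K`, with equality at `f = g` (`exists_isOpt`). By the bipolar relations
this says that `U'(g)` lies in `y D`, so it is the dual optimizer. Every `y > 0` arises in this way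
because derivatives have the intermediate value property.

Second order. Inserting `g (1 + ε (1 + α) / x)` as a competitor bounds the value at `x + ε` from
above by a quadratic in `ε` with coefficient `y / (2 x) * E_R[ζ(g) (1 + α)²]`, up to `o(ε²)`
(`IsValueFn.upper_expansion`); the same holds for the dual problem. Complementarity of the two
spaces of directions makes the quadratic problems dual to each other, with `b = 1 / a`
(`quad_duality`). Hence conjugation turns the upper bound for one value function into a lower bound
for the other with the matching constant (`lower_expansion_of_conjugate`), and the expansion is
exact. For a convex function such an expansion at one point already makes the derivative
differentiable there (`hasDerivAt_of_expansion`).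

Optimizers. The competitor above is now optimal up to an arbitrarily small multiple of `ε²`. The
Bregman gap of `F` dominates a truncated squared distance (`exists_gap_bound`), so the true
optimizer at `x + ε` is within `o(ε)` of it in probability. The relation between the two derivatives
comes from the explicit dual solution `β = ζ (1 + α) / a - 1`. -/

/-! ### Convex functions whose slope has bounded elasticity -/

/-- `F` is a decreasing convex function on `(0, ∞)` with slope `-φ`, and the elasticity `ζ` of the
slope lies strictly between `c₁ > 0` and `c₂`. -/
structure PowerLike (F φ ζ : ℝ → ℝ) (c₁ c₂ : ℝ) : Prop where
  c₁_pos : 0 < c₁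
  pos : ∀ z, 0 < z → 0 < φ z
  hasDerivAt : ∀ z, 0 < z → HasDerivAt F (-φ z) z
  hasDerivAt_slope : ∀ z, 0 < z → HasDerivAt φ (-(ζ z * φ z / z)) z
  lower : ∀ z, 0 < z → c₁ < ζ z
  upper : ∀ z, 0 < z → ζ z < c₂

/-- Mean value theorem on the segment between the two points. An arbitrary interval `s` is allowed
because the lemma is also applied on `(0, M]` to `F` minus a quadratic. -/
theorem tangent_le_of_antitoneOn {H χ : ℝ → ℝ} {s : Set ℝ} (hs : s.OrdConnected)
    (hd : ∀ z ∈ s, HasDerivAt H (-χ z) z) (hχ : AntitoneOn χ s) {b f : ℝ} (hb : b ∈ s)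
    (hf : f ∈ s) : H b - χ b * (f - b) ≤ H f := by
  rcases lt_trichotomy b f with h | h | h
  · have hsub : Icc b f ⊆ s := hs.out hb hf
    obtain ⟨c, hc, he⟩ := exists_hasDerivAt_eq_slope H (fun z => -χ z) h
      (fun z hz => (hd z (hsub hz)).continuousAt.continuousWithinAt)
      (fun z hz => hd z (hsub (Ioo_subset_Icc_self hz)))
    have h1 : χ c ≤ χ b := hχ hb (hsub (Ioo_subset_Icc_self hc)) hc.1.le
    rw [eq_div_iff (by linarith)] at he
    nlinarith
  · simp [h]
  · have hsub : Icc f b ⊆ s := hs.out hf hb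
    obtain ⟨c, hc, he⟩ := exists_hasDerivAt_eq_slope H (fun z => -χ z) h
      (fun z hz => (hd z (hsub hz)).continuousAt.continuousWithinAt)
      (fun z hz => hd z (hsub (Ioo_subset_Icc_self hz)))
    have h1 : χ b ≤ χ c := hχ (hsub (Ioo_subset_Icc_self hc)) hb hc.2.le
    rw [eq_div_iff (by linarith)] at he
    nlinarith

/-- Taylor's formula with Peano remainder. The slope need only be differentiable at the single point
`z`, which matters because `U''` is not assumed continuous. -/
theorem peano_second_order {H χ : ℝ → ℝ} {z m : ℝ} (hd : ∀ᶠ t in 𝓝 z, HasDerivAt H (-χ t) t)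
    (hχ : HasDerivAt χ (-m) z) :
    Tendsto (fun t => (H (z + t) - H z + χ z * t) / t ^ 2) (𝓝[≠] 0) (𝓝 (m / 2)) := by
  rw [Metric.tendsto_nhds]
  intro η hη
  have h1 := (hasDerivAt_iff_isLittleO_nhds_zero.mp hχ).def (half_pos hη)
  have h2 : ∀ᶠ t in 𝓝 (0:ℝ), HasDerivAt H (-χ (z + t)) (z + t) := by
    have : Tendsto (fun t => z + t) (𝓝 0) (𝓝 z) := by
      have : Continuous fun t : ℝ => z + t := by fun_prop
      simpa using this.tendsto 0
    exact this.eventually hd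
  obtain ⟨δ, hδ, hB⟩ := Metric.eventually_nhds_iff_ball.mp (h1.and h2)
  have : ∀ᶠ t in 𝓝[≠] (0:ℝ), t ∈ Metric.ball (0:ℝ) δ ∧ t ≠ 0 :=
    (eventually_nhdsWithin_of_eventually_nhds (Metric.ball_mem_nhds _ hδ)).and
      eventually_mem_nhdsWithin
  filter_upwards [this] with t ⟨ht, ht0⟩
  -- The remainder `G` has derivative `o(s)` at `s`, so the mean value inequality on the segment
  -- from `0` to `t` gives `G t = o(t²)`.
  set G : ℝ → ℝ := fun t => H (z + t) - H z + χ z * t - m / 2 * t ^ 2 with hG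
  have hGd : ∀ s ∈ uIcc 0 t, HasDerivWithinAt G (-χ (z + s) + χ z - m * s) (uIcc 0 t) s := by
    intro s hs
    have hs' : s ∈ Metric.ball (0:ℝ) δ := by
      simp only [Metric.mem_ball, dist_zero_right, Real.norm_eq_abs] at ht ⊢
      have := abs_sub_left_of_mem_uIcc hs
      simp only [sub_zero] at this
      linarith
    have e1 : HasDerivAt (fun s => H (z + s)) (-χ (z + s)) s := by
      simpa using (hB s hs').2.comp_const_add z s
    have e2 : HasDerivAt (fun s => χ z * s) (χ z) s := by
      simpa using (hasDerivAt_id s).const_mul (χ z)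
    have e3 : HasDerivAt (fun s => m / 2 * s ^ 2) (m * s) s := by
      have := (hasDerivAt_pow 2 s).const_mul (m / 2)
      refine this.congr_deriv ?_
      simp; ring
    exact (((e1.sub_const (H z)).add e2).sub e3).hasDerivWithinAt
  have hb : ∀ s ∈ uIcc 0 t, ‖-χ (z + s) + χ z - m * s‖ ≤ η / 2 * |t| := by
    intro s hs
    have hst := abs_sub_left_of_mem_uIcc hs
    simp only [sub_zero] at hst
    have hs' : s ∈ Metric.ball (0:ℝ) δ := by
      simp only [Metric.mem_ball, dist_zero_right, Real.norm_eq_abs] at ht ⊢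
      linarith
    have := (hB s hs').1
    simp only [smul_eq_mul, Real.norm_eq_abs] at this
    rw [Real.norm_eq_abs, show -χ (z + s) + χ z - m * s = -(χ (z + s) - χ z - s * -m) by ring,
      abs_neg]
    exact this.trans (by gcongr)
  have key := (convex_uIcc 0 t).norm_image_sub_le_of_norm_hasDerivWithin_le hGd hb
    left_mem_uIcc right_mem_uIcc
  have hG0 : G 0 = 0 := by simp [hG]
  rw [hG0, sub_zero, sub_zero, Real.norm_eq_abs, Real.norm_eq_abs] at key
  have ht2 : 0 < t ^ 2 := by positivity
  rw [Real.dist_eq, show (H (z + t) - H z + χ z * t) / t ^ 2 - m / 2 = G t / t ^ 2 by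
    simp only [hG]; field_simp, abs_div, abs_of_pos ht2, div_lt_iff₀ ht2]
  calc |G t| ≤ η / 2 * |t| * |t| := key
    _ = η / 2 * t ^ 2 := by rw [mul_assoc, abs_mul_abs_self]; ring
    _ < η * t ^ 2 := by nlinarith

namespace PowerLike

variable {F φ ζ : ℝ → ℝ} {c₁ c₂ : ℝ}

theorem c₂_pos (h : PowerLike F φ ζ c₁ c₂) : 0 < c₂ :=
  h.c₁_pos.trans ((h.lower 1 one_pos).trans (h.upper 1 one_pos))

theorem elasticity_pos (h : PowerLike F φ ζ c₁ c₂) {z : ℝ} (hz : 0 < z) : 0 < ζ z :=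
  h.c₁_pos.trans (h.lower z hz)

theorem continuousOn (h : PowerLike F φ ζ c₁ c₂) : ContinuousOn F (Ioi 0) := fun z hz =>
  (h.hasDerivAt z hz).continuousAt.continuousWithinAt

theorem continuousOn_slope (h : PowerLike F φ ζ c₁ c₂) : ContinuousOn φ (Ioi 0) := fun z hz =>
  (h.hasDerivAt_slope z hz).continuousAt.continuousWithinAt

theorem slope_strictAntiOn (h : PowerLike F φ ζ c₁ c₂) : StrictAntiOn φ (Ioi 0) := by
  refine strictAntiOn_of_deriv_neg (convex_Ioi 0) h.continuousOn_slope fun z hz => ?_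
  rw [interior_Ioi] at hz
  rw [(h.hasDerivAt_slope z hz).deriv]
  have h1 := h.elasticity_pos hz
  have h2 := h.pos z hz
  have hz' : 0 < z := hz
  simp only [Left.neg_neg_iff]
  positivity

theorem antitoneOn (h : PowerLike F φ ζ c₁ c₂) : AntitoneOn F (Ioi 0) := by
  refine antitoneOn_of_deriv_nonpos (convex_Ioi 0) h.continuousOn
    (fun z hz => ?_) fun z hz => ?_ <;> rw [interior_Ioi] at hz
  · exact (h.hasDerivAt z hz).differentiableAt.differentiableWithinAt
  · rw [(h.hasDerivAt z hz).deriv]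
    linarith [h.pos z hz]

theorem tangent_le (h : PowerLike F φ ζ c₁ c₂) {z z' : ℝ} (hz : 0 < z) (hz' : 0 < z') :
    F z - φ z * (z' - z) ≤ F z' :=
  tangent_le_of_antitoneOn ordConnected_Ioi (fun t ht => h.hasDerivAt t ht)
    h.slope_strictAntiOn.antitoneOn hz hz'

/-- The logarithmic derivative of `φ` is `-ζ/z`, hence below `-c₁/z`. Together with the companion
bound for `c₂`, this compares `φ` with power functions and replaces the Inada conditions. -/
theorem slope_mul_rpow_antitone (h : PowerLike F φ ζ c₁ c₂) :
    AntitoneOn (fun z => φ z * z ^ c₁) (Ioi 0) := by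
  have hd : ∀ z : ℝ, 0 < z → HasDerivAt (fun z => φ z * z ^ c₁)
      (-(ζ z * φ z / z) * z ^ c₁ + φ z * (c₁ * z ^ (c₁ - 1))) z := fun z hz =>
    (h.hasDerivAt_slope z hz).mul (Real.hasDerivAt_rpow_const (Or.inl hz.ne'))
  refine antitoneOn_of_deriv_nonpos (convex_Ioi 0)
    (fun z hz => (hd z hz).continuousAt.continuousWithinAt)
    (fun z hz => ?_) fun z hz => ?_ <;> rw [interior_Ioi] at hz
  · exact (hd z hz).differentiableAt.differentiableWithinAt
  · rw [(hd z hz).deriv]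
    have hz' : (0:ℝ) < z := hz
    rw [Real.rpow_sub_one hz'.ne']
    have h1 := h.pos z hz
    have h2 := h.lower z hz
    have h3 : 0 < z ^ c₁ := Real.rpow_pos_of_pos hz' _
    have : -(ζ z * φ z / z) * z ^ c₁ + φ z * (c₁ * (z ^ c₁ / z))
        = -((ζ z - c₁) * (φ z * z ^ c₁ / z)) := by ring
    rw [this, Left.neg_nonpos_iff]
    have : 0 < ζ z - c₁ := by linarith
    positivity

theorem slope_mul_rpow_monotone (h : PowerLike F φ ζ c₁ c₂) :
    MonotoneOn (fun z => φ z * z ^ c₂) (Ioi 0) := by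
  have hd : ∀ z : ℝ, 0 < z → HasDerivAt (fun z => φ z * z ^ c₂)
      (-(ζ z * φ z / z) * z ^ c₂ + φ z * (c₂ * z ^ (c₂ - 1))) z := fun z hz =>
    (h.hasDerivAt_slope z hz).mul (Real.hasDerivAt_rpow_const (Or.inl hz.ne'))
  refine monotoneOn_of_deriv_nonneg (convex_Ioi 0)
    (fun z hz => (hd z hz).continuousAt.continuousWithinAt)
    (fun z hz => ?_) fun z hz => ?_ <;> rw [interior_Ioi] at hz
  · exact (hd z hz).differentiableAt.differentiableWithinAt
  · rw [(hd z hz).deriv]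
    have hz' : (0:ℝ) < z := hz
    rw [Real.rpow_sub_one hz'.ne']
    have h1 := h.pos z hz
    have h2 := h.upper z hz
    have h3 : 0 < z ^ c₂ := Real.rpow_pos_of_pos hz' _
    have : -(ζ z * φ z / z) * z ^ c₂ + φ z * (c₂ * (z ^ c₂ / z))
        = (c₂ - ζ z) * (φ z * z ^ c₂ / z) := by ring
    rw [this]
    have : 0 < c₂ - ζ z := by linarith
    positivity

theorem slope_mul_le (h : PowerLike F φ ζ c₁ c₂) {l z : ℝ} (hl : 1 ≤ l) (hz : 0 < z) :
    φ (l * z) * l ^ c₁ ≤ φ z := by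
  have hl0 : 0 < l := by linarith
  have := h.slope_mul_rpow_antitone (mem_Ioi.2 hz) (mem_Ioi.2 (mul_pos hl0 hz))
    (by nlinarith : z ≤ l * z)
  simp only [Real.mul_rpow hl0.le hz.le] at this
  have h3 : 0 < z ^ c₁ := Real.rpow_pos_of_pos hz _
  rw [← mul_assoc] at this
  exact le_of_mul_le_mul_right this h3

theorem slope_le_mul (h : PowerLike F φ ζ c₁ c₂) {l z : ℝ} (hl : 1 ≤ l) (hz : 0 < z) :
    φ z ≤ φ (l * z) * l ^ c₂ := by
  have hl0 : 0 < l := by linarith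
  have := h.slope_mul_rpow_monotone (mem_Ioi.2 hz) (mem_Ioi.2 (mul_pos hl0 hz))
    (by nlinarith : z ≤ l * z)
  simp only [Real.mul_rpow hl0.le hz.le] at this
  have h3 : 0 < z ^ c₂ := Real.rpow_pos_of_pos hz _
  rw [← mul_assoc] at this
  exact le_of_mul_le_mul_right this h3

theorem tendsto_slope_atTop (h : PowerLike F φ ζ c₁ c₂) : Tendsto φ atTop (𝓝 0) := by
  have h1 : Tendsto (fun z : ℝ => φ 1 * z ^ (-c₁)) atTop (𝓝 0) := by
    simpa using (tendsto_rpow_neg_atTop h.c₁_pos).const_mul (φ 1)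
  refine squeeze_zero' ?_ ?_ h1
  · filter_upwards [eventually_gt_atTop 0] with z hz using (h.pos z hz).le
  · filter_upwards [eventually_ge_atTop 1] with z hz
    have := h.slope_mul_le hz one_pos
    have hz0 : 0 < z := by linarith
    rw [mul_one] at this
    rw [Real.rpow_neg hz0.le, ← div_eq_mul_inv, le_div_iff₀ (Real.rpow_pos_of_pos hz0 _)]
    exact this

theorem tendsto_slope_zero (h : PowerLike F φ ζ c₁ c₂) : Tendsto φ (𝓝[>] 0) atTop := by
  have h1 : Tendsto (fun z : ℝ => φ 1 * z⁻¹ ^ c₁) (𝓝[>] 0) atTop :=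
    ((tendsto_rpow_atTop h.c₁_pos).comp tendsto_inv_nhdsGT_zero).const_mul_atTop (h.pos 1 one_pos)
  refine tendsto_atTop_mono' _ ?_ h1
  have : ∀ᶠ z in 𝓝[>] (0:ℝ), z ∈ Ioo (0:ℝ) 1 := Ioo_mem_nhdsGT one_pos
  filter_upwards [this] with z hz
  have h2 := h.slope_mul_le ((one_le_inv₀ hz.1).2 hz.2.le) hz.1
  rwa [inv_mul_cancel₀ hz.1.ne'] at h2

/-- Bregman gap on `(0, M]`. -/
theorem gap_ge (h : PowerLike F φ ζ c₁ c₂) {M b f : ℝ} (hb : 0 < b) (hbM : b ≤ M) (hf : 0 < f)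
    (hfM : f ≤ M) : c₁ * φ M / M / 2 * (f - b) ^ 2 ≤ F f - F b + φ b * (f - b) := by
  have hM : 0 < M := hb.trans_le hbM
  -- `m` is a lower bound for the second derivative `ζ φ / z` on `(0, M]`, so `F` minus `m / 2 * z ^
  -- 2` is still convex there.
  set m := c₁ * φ M / M with hm
  have hanti : AntitoneOn (fun z => φ z + m * z) (Ioc 0 M) := by
    have hd : ∀ z ∈ Ioc 0 M, HasDerivAt (fun z => φ z + m * z) (-(ζ z * φ z / z) + m) z := by
      intro z hz
      exact ((h.hasDerivAt_slope z hz.1).add ((hasDerivAt_id z).const_mul m)).congr_deriv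
        (by simp)
    refine antitoneOn_of_deriv_nonpos (convex_Ioc 0 M)
      (fun z hz => (hd z hz).continuousAt.continuousWithinAt)
      (fun z hz => ?_) fun z hz => ?_ <;> have hz := interior_subset hz
    · exact (hd z hz).differentiableAt.differentiableWithinAt
    · rw [(hd z hz).deriv, hm]
      have h1 : φ M ≤ φ z := h.slope_strictAntiOn.antitoneOn hz.1 hM hz.2
      have h2 := h.pos M hM
      have h3 := h.lower z hz.1
      have h4 := h.c₁_pos
      have : c₁ * φ M / M ≤ ζ z * φ z / z := by
        gcongr
        · exact mul_nonneg (h.elasticity_pos hz.1).le (h.pos z hz.1).le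
        · exact hz.1
        · exact (h.elasticity_pos hz.1).le
        · exact hz.2
      linarith
  have key := tangent_le_of_antitoneOn (H := fun z => F z - m / 2 * z ^ 2) ordConnected_Ioc
    (fun z hz => ?_) hanti (b := b) (f := f) ⟨hb, hbM⟩ ⟨hf, hfM⟩
  · nlinarith
  · have := (h.hasDerivAt z hz.1).sub ((hasDerivAt_pow 2 z).const_mul (m / 2))
    refine this.congr_deriv ?_
    simp; ring

/-- Two Bregman gaps at the midpoint are added, so that their linear terms cancel. This quantitative
strict convexity makes minimizing sequences Cauchy. -/
theorem midpoint_gap (h : PowerLike F φ ζ c₁ c₂) {M a b : ℝ} (ha : 0 < a) (haM : a ≤ M)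
    (hb : 0 < b) (hbM : b ≤ M) :
    c₁ * φ M / M / 4 * (a - b) ^ 2 ≤ F a + F b - 2 * F ((a + b) / 2) := by
  have h1 := h.gap_ge (M := M) (b := (a + b) / 2) (by linarith) (by linarith) ha haM
  have h2 := h.gap_ge (M := M) (b := (a + b) / 2) (by linarith) (by linarith) hb hbM
  nlinarith

theorem midpoint_gap_nonneg (h : PowerLike F φ ζ c₁ c₂) {a b : ℝ} (ha : 0 < a) (hb : 0 < b) :
    0 ≤ F a + F b - 2 * F ((a + b) / 2) := by
  have h1 := h.tangent_le (z := (a + b) / 2) (by linarith) ha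
  have h2 := h.tangent_le (z := (a + b) / 2) (by linarith) hb
  nlinarith

/-- The tangent at a point closer to `f` is a better approximation at `f`, by convexity. It allows
the base point of a Bregman gap to be clamped to a bounded range. -/
theorem gap_antitone (h : PowerLike F φ ζ c₁ c₂) {b b' f : ℝ} (hb : 0 < b) (hb' : 0 < b')
    (hbb : (b ≤ b' ∧ b' ≤ f) ∨ (f ≤ b' ∧ b' ≤ b)) :
    F f - F b' + φ b' * (f - b') ≤ F f - F b + φ b * (f - b) := by
  have h1 := h.tangent_le hb hb'
  rcases hbb with ⟨h2, h3⟩ | ⟨h2, h3⟩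
  · have h4 : φ b' ≤ φ b := h.slope_strictAntiOn.antitoneOn hb hb' h2
    nlinarith
  · have h4 : φ b ≤ φ b' := h.slope_strictAntiOn.antitoneOn hb' hb h3
    nlinarith

/-- The gap is quadratic in `b - f` while `b` is comparable with `z`; beyond that range only
truncation can give a bound uniform in `b`. The scaling by `z * φ z` makes the constant independent
of `z`, so integrating gives control in the weight `g φ(g)`. -/
theorem exists_gap_bound (h : PowerLike F φ ζ c₁ c₂) : ∃ κ > 0, ∀ z f b : ℝ, 0 < z → z / 2 ≤ f →
    f ≤ 2 * z → 0 < b →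
    κ * (z * φ z) * min (|b - f| / z) 1 ^ 2 ≤ F f - F b + φ b * (f - b) := by
  have hp : (0:ℝ) < 4 ^ c₂ := Real.rpow_pos_of_pos (by norm_num) _
  refine ⟨c₁ / (4 ^ c₂ * 128), by have := h.c₁_pos; positivity, fun z f b hz hf hf' hb => ?_⟩
  have hf0 : 0 < f := by linarith
  -- The clamp of `b` to `[f / 2, 2 f]`, contained in `(0, 4 z]`. Either nothing changes, or the
  -- clamp sits at an endpoint at distance at least `z / 4` from `f`.
  set b' := max (f / 2) (min b (2 * f)) with hb'
  have hb'l : f / 2 ≤ b' := le_max_left _ _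
  have hb'u : b' ≤ 2 * f := max_le (by linarith) (min_le_right _ _)
  have hb'0 : 0 < b' := by linarith
  have h1 : (b ≤ b' ∧ b' ≤ f) ∨ (f ≤ b' ∧ b' ≤ b) := by
    rcases le_total b f with hbf | hbf
    · left
      rw [hb', min_eq_left (by linarith)]
      exact ⟨le_max_right _ _, max_le (by linarith) hbf⟩
    · right
      have : f ≤ min b (2 * f) := le_min hbf (by linarith)
      rw [hb', max_eq_right (by linarith)]
      exact ⟨this, min_le_left _ _⟩
  refine le_trans ?_ (h.gap_antitone hb hb'0 h1)
  refine le_trans ?_ (h.gap_ge (M := 4 * z) hb'0 (by linarith) hf0 (by linarith))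
  have h2 : φ z ≤ φ (4 * z) * 4 ^ c₂ := h.slope_le_mul (by norm_num) hz
  have h3 : z / 4 * min (|b - f| / z) 1 ≤ |f - b'| := by
    have e : z / 4 * min (|b - f| / z) 1 = min (|b - f| / 4) (z / 4) := by
      rw [mul_min_of_nonneg _ _ (by positivity)]
      congr 1
      · field_simp
      · ring
    rw [e]
    by_cases hc : b' = b
    · rw [hc, abs_sub_comm]
      exact (min_le_left _ _).trans (by linarith [abs_nonneg (f - b)])
    · refine (min_le_right _ _).trans ?_
      have : b' = f / 2 ∨ b' = 2 * f := by
        rcases max_choice (f / 2) (min b (2 * f)) with h5 | h5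
        · left; exact h5
        · right
          rcases min_choice b (2 * f) with h6 | h6
          · exact absurd (by rw [hb', h5, h6]) hc
          · rw [hb', h5, h6]
      rcases this with h5 | h5 <;> rw [h5]
      · rw [abs_of_nonneg (by linarith)]; linarith
      · rw [abs_of_nonpos (by linarith)]; linarith
  have h4 : (z / 4 * min (|b - f| / z) 1) ^ 2 ≤ (f - b') ^ 2 := by
    rw [← sq_abs (f - b')]
    exact pow_le_pow_left₀ (by positivity) h3 2
  have h5 := h.pos _ (by positivity : 0 < 4 * z)
  have hc := h.c₁_pos
  calc c₁ / (4 ^ c₂ * 128) * (z * φ z) * min (|b - f| / z) 1 ^ 2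
      ≤ c₁ / (4 ^ c₂ * 128) * (z * (φ (4 * z) * 4 ^ c₂)) * min (|b - f| / z) 1 ^ 2 := by gcongr
    _ = c₁ * φ (4 * z) / (4 * z) / 2 * (z / 4 * min (|b - f| / z) 1) ^ 2 := by
        field_simp; ring
    _ ≤ _ := by gcongr

/-- For `|s| ≤ 1/2` the segment stays in `[z / 2, ∞)`, where `φ` is Lipschitz with constant
comparable to `φ z / z`. The bound provides the integrable majorant for every second-order expansion
under the expectation. -/
theorem second_order_bound (h : PowerLike F φ ζ c₁ c₂) {z s : ℝ} (hz : 0 < z) (hs : |s| ≤ 1 / 2) :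
    |F (z * (1 + s)) - F z + φ z * (z * s)| ≤ c₂ * 2 ^ c₂ * 2 * (z * φ z) * s ^ 2 := by
  obtain ⟨hs1, hs2⟩ := abs_le.1 hs
  have hz1 : z / 2 ≤ z * (1 + s) := by nlinarith
  have hz' : 0 < z * (1 + s) := by linarith
  have h1 := h.tangent_le hz hz'
  have h2 := h.tangent_le hz' hz
  have h3 : ‖φ (z * (1 + s)) - φ z‖ ≤ c₂ * (φ z * 2 ^ c₂) / (z / 2) * ‖z * (1 + s) - z‖ := by
    refine (convex_Ici (z / 2)).norm_image_sub_le_of_norm_hasDerivWithin_le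
      (f' := fun t => -(ζ t * φ t / t)) (fun t ht => ?_) (fun t ht => ?_) ?_ ?_
    · exact (h.hasDerivAt_slope t (lt_of_lt_of_le (by positivity) (mem_Ici.1 ht))).hasDerivWithinAt
    · have ht' : z / 2 ≤ t := ht
      have ht0 : 0 < t := by linarith
      have e1 := h.elasticity_pos ht0
      have e2 := h.pos t ht0
      have e3 : φ t ≤ φ (z / 2) := h.slope_strictAntiOn.antitoneOn
        (mem_Ioi.2 (half_pos hz)) ht0 ht'
      have e4 := h.slope_le_mul (one_le_two) (half_pos hz)
      rw [mul_div_cancel₀ _ (two_ne_zero)] at e4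
      have e5 := h.pos z hz
      have e6 := h.c₂_pos
      rw [norm_neg, Real.norm_eq_abs, abs_of_pos (by positivity)]
      gcongr
      · exact (h.upper t ht0).le
      · linarith
    · simp only [mem_Ici]; linarith
    · exact hz1
  rw [Real.norm_eq_abs, Real.norm_eq_abs] at h3
  have e7 := h.pos z hz
  rw [abs_of_nonneg (by linarith [h1])]
  have h4 : F (z * (1 + s)) - F z + φ z * (z * s) ≤ (φ z - φ (z * (1 + s))) * (z * s) := by
    linarith [h2]
  have h5 : (φ z - φ (z * (1 + s))) * (z * s) ≤ |φ (z * (1 + s)) - φ z| * |z * s| := by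
    rw [← abs_mul, ← abs_neg]
    refine le_trans (le_of_eq ?_) (le_abs_self _); ring
  have h6 : |φ (z * (1 + s)) - φ z| * |z * s|
      ≤ c₂ * (φ z * 2 ^ c₂) / (z / 2) * |z * s| * |z * s| := by
    refine mul_le_mul_of_nonneg_right (h3.trans (le_of_eq ?_)) (abs_nonneg _)
    congr 2; ring
  have h7 : c₂ * (φ z * 2 ^ c₂) / (z / 2) * |z * s| * |z * s|
      = c₂ * 2 ^ c₂ * 2 * (z * φ z) * s ^ 2 := by
    rw [mul_assoc, abs_mul_abs_self]; field_simp
  linarith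

theorem tendsto_second_order (h : PowerLike F φ ζ c₁ c₂) {z : ℝ} (hz : 0 < z) (γ : ℝ) :
    Tendsto (fun ε => (F (z * (1 + ε * γ)) - F z + φ z * (z * (ε * γ))) / ε ^ 2) (𝓝[≠] 0)
      (𝓝 (ζ z * (z * φ z) * γ ^ 2 / 2)) := by
  by_cases hγ : γ = 0
  · simp [hγ]
  have h1 := peano_second_order (z := z)
    ((eventually_gt_nhds hz).mono fun t ht => h.hasDerivAt t ht) (h.hasDerivAt_slope z hz)
  have hzγ : z * γ ≠ 0 := mul_ne_zero hz.ne' hγ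
  have h2 : Tendsto (fun ε : ℝ => (z * γ) * ε) (𝓝[≠] 0) (𝓝[≠] 0) := by
    refine tendsto_nhdsWithin_of_tendsto_nhds_of_eventually_within _ ?_ ?_
    · have : Tendsto (fun ε : ℝ => (z * γ) * ε) (𝓝 0) (𝓝 ((z * γ) * 0)) :=
        (continuous_const.mul continuous_id).tendsto 0
      rw [mul_zero] at this
      exact this.mono_left nhdsWithin_le_nhds
    · filter_upwards [eventually_mem_nhdsWithin] with ε hε
      exact mul_ne_zero hzγ hε
  have h3 := ((h1.comp h2).const_mul ((z * γ) ^ 2))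
  have e : (z * γ) ^ 2 * (ζ z * φ z / z / 2) = ζ z * (z * φ z) * γ ^ 2 / 2 := by
    field_simp
  rw [e] at h3
  refine h3.congr' ?_
  filter_upwards [eventually_mem_nhdsWithin] with ε hε
  have hε' : ε ≠ 0 := hε
  simp only [Function.comp]
  rw [show z + z * γ * ε = z * (1 + ε * γ) by ring, mul_pow (z * γ) ε]
  field_simp

/-- It makes `g φ(g)` integrable as soon as `F(g)` is. For `z ≥ 1` the tangent at `z` is evaluated
at `z / 2`; for `z ≤ 1` the tangent at `2 z` is evaluated at `z` and the slope is doubled back. -/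
theorem mul_slope_le (h : PowerLike F φ ζ c₁ c₂) : ∃ K > 0, ∀ z, 0 < z →
    z * φ z ≤ K * (1 + |F z|) := by
  have hp : (1:ℝ) ≤ 2 ^ c₂ := Real.one_le_rpow one_le_two h.c₂_pos.le
  refine ⟨2 * 2 ^ c₂ * (1 + |F (1 / 2)| + |F 2|), by positivity, fun z hz => ?_⟩
  rcases le_total 1 z with h1 | h1
  · have e1 := h.tangent_le hz (half_pos hz)
    have e2 : F (z / 2) ≤ F (1 / 2) := h.antitoneOn (by norm_num) (mem_Ioi.2 (half_pos hz))
      (by linarith)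
    have e3 : z * φ z ≤ 2 * (|F (1 / 2)| + |F z|) := by
      have := le_abs_self (F (1 / 2))
      have := neg_abs_le (F z)
      linarith
    refine e3.trans ?_
    have a1 := abs_nonneg (F (1 / 2))
    have a2 := abs_nonneg (F z)
    have a3 := abs_nonneg (F 2)
    have : |F (1 / 2)| + |F z| ≤ (1 + |F (1 / 2)| + |F 2|) * (1 + |F z|) := by nlinarith
    calc 2 * (|F (1 / 2)| + |F z|) ≤ 2 * ((1 + |F (1 / 2)| + |F 2|) * (1 + |F z|)) := by linarith
      _ ≤ 2 * (2 ^ c₂ * ((1 + |F (1 / 2)| + |F 2|) * (1 + |F z|))) := by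
          refine mul_le_mul_of_nonneg_left ?_ (by norm_num)
          exact le_mul_of_one_le_left (by positivity) hp
      _ = _ := by ring
  · have e1 := h.tangent_le (z := 2 * z) (by linarith) hz
    have e2 : F 2 ≤ F (2 * z) := h.antitoneOn (by simpa using hz) (by norm_num)
      (by linarith)
    have e3 := h.slope_le_mul one_le_two hz
    have e4 : z * φ (2 * z) ≤ |F 2| + |F z| := by
      have := neg_abs_le (F 2)
      have := le_abs_self (F z)
      linarith
    have a1 := abs_nonneg (F (1 / 2))
    have a2 := abs_nonneg (F z)
    have a3 := abs_nonneg (F 2)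
    have e5 : |F 2| + |F z| ≤ (1 + |F (1 / 2)| + |F 2|) * (1 + |F z|) := by nlinarith
    calc z * φ z ≤ z * (φ (2 * z) * 2 ^ c₂) := by gcongr
      _ = 2 ^ c₂ * (z * φ (2 * z)) := by ring
      _ ≤ 2 ^ c₂ * (2 * ((1 + |F (1 / 2)| + |F 2|) * (1 + |F z|))) := by
          refine mul_le_mul_of_nonneg_left ?_ (by linarith)
          have : 0 ≤ (1 + |F (1 / 2)| + |F 2|) * (1 + |F z|) := by positivity
          linarith
      _ = _ := by ring

/-- Multiplying the argument by `s` divides the slope by at least `s ^ c₁`. Beyond the point `s z`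
the gain per unit of `l` is therefore at most the prescribed fraction `η` of `z φ(z)`. This plays
the role of a condition on the asymptotic elasticity. -/
theorem sublinear_growth (h : PowerLike F φ ζ c₁ c₂) {η : ℝ} (hη : 0 < η) : ∃ s : ℝ, 0 < s ∧
    ∀ z l : ℝ, 0 < z → 0 < l → F z - F (l * z) ≤ z * φ z * (s + η * l) := by
  have h1 : ∀ᶠ s : ℝ in atTop, s ^ (-c₁) < η :=
    (tendsto_rpow_neg_atTop h.c₁_pos).eventually (gt_mem_nhds hη)
  obtain ⟨s, hs, hs1⟩ := (h1.and (eventually_ge_atTop 1)).exists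
  have hs0 : 0 < s := by linarith
  refine ⟨s, hs0, fun z l hz hl => ?_⟩
  have hφ := h.pos z hz
  have hsz : 0 < s * z := mul_pos hs0 hz
  have hlz : 0 < l * z := mul_pos hl hz
  have e1 := h.tangent_le hz hsz
  have e2 := h.tangent_le hsz hlz
  have e3 : φ (s * z) ≤ φ z * η := by
    have := h.slope_mul_le hs1 hz
    rw [Real.rpow_neg hs0.le] at hs
    have hsp : 0 < s ^ c₁ := Real.rpow_pos_of_pos hs0 _
    calc φ (s * z) ≤ φ z * (s ^ c₁)⁻¹ := by
          rw [← div_eq_mul_inv, le_div_iff₀ hsp]; exact this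
      _ ≤ φ z * η := by gcongr
  rcases le_total s l with hsl | hsl
  · have : φ (s * z) * (l * z - s * z) ≤ φ z * η * (l * z) := by
      have h0 : 0 ≤ l * z - s * z := by nlinarith
      refine mul_le_mul e3 (by linarith) h0 (by positivity)
    have h4 : 0 < φ z * z := by positivity
    nlinarith
  · have e4 : F (s * z) ≤ F (l * z) := h.antitoneOn hlz hsz (by nlinarith)
    have h4 : 0 < φ z * z := by positivity
    have h5 : 0 < φ z * z * (η * l) := by positivity
    nlinarith

theorem half_bound (h : PowerLike F φ ζ c₁ c₂) {z : ℝ} (hz : 0 < z) :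
    F (z / 2) ≤ F z + 2 ^ c₂ * (z * φ z) := by
  have e1 := h.tangent_le (half_pos hz) hz
  have e4 := h.slope_le_mul (one_le_two) (half_pos hz)
  rw [mul_div_cancel₀ _ (two_ne_zero)] at e4
  have := h.pos _ (half_pos hz)
  nlinarith

end PowerLike

/-! ### The utility function and the inverse of its marginal -/

/-- If `U'` vanished at `z`, the quotient defining the risk aversion would be `0` by the convention
for division, against the lower bound `c₁ > 0`. -/
theorem utility_deriv_pos {U : ℝ → ℝ} {c₁ c₂ : ℝ} (hU : IsUtility U)
    (hA : RiskAversionBounds U c₁ c₂) {z : ℝ} (hz : 0 < z) : 0 < deriv U z := by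
  have h0 : 0 ≤ deriv U z := by
    have : deriv U z = derivWithin U (Ioi 0) z :=
      (derivWithin_of_mem_nhds (Ioi_mem_nhds hz)).symm
    rw [this]
    exact hU.strictMono.monotoneOn.derivWithin_nonneg
  refine lt_of_le_of_ne h0 fun h => ?_
  have h1 := hA.lower z hz
  have h2 := hA.c₁_pos
  simp only [relCoeff, ← h, div_zero, neg_zero] at h1
  linarith

theorem powerLike_neg_utility {U : ℝ → ℝ} {c₁ c₂ : ℝ} (hU : IsUtility U)
    (hA : RiskAversionBounds U c₁ c₂) :
    PowerLike (fun z => -U z) (deriv U) (relCoeff U) c₁ c₂ where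
  c₁_pos := hA.c₁_pos
  pos _ hz := utility_deriv_pos hU hA hz
  hasDerivAt z hz := (hU.differentiable z hz).hasDerivAt.neg
  hasDerivAt_slope z hz := by
    refine (hA.twice_differentiable z hz).hasDerivAt.congr_deriv ?_
    have := (utility_deriv_pos hU hA hz).ne'
    have := hz.ne'
    simp only [relCoeff]
    field_simp
  lower := hA.lower
  upper := hA.upper

namespace PowerLike

variable {F φ ζ : ℝ → ℝ} {c₁ c₂ : ℝ}

theorem exists_slope_eq (h : PowerLike F φ ζ c₁ c₂) {s : ℝ} (hs : 0 < s) :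
    ∃ z, 0 < z ∧ φ z = s := by
  obtain ⟨a, ha1, ha0⟩ := ((h.tendsto_slope_zero.eventually_ge_atTop s).and
    eventually_mem_nhdsWithin).exists
  obtain ⟨b, hb1, hb0⟩ := ((h.tendsto_slope_atTop.eventually (gt_mem_nhds hs)).and
    (eventually_gt_atTop 0)).exists
  have hsub : uIcc a b ⊆ Ioi 0 := fun t ht => lt_of_lt_of_le (lt_min ha0 hb0) ht.1
  obtain ⟨z, hz, hzs⟩ := intermediate_value_uIcc (h.continuousOn_slope.mono hsub)
    (show s ∈ uIcc (φ a) (φ b) from mem_uIcc.2 (Or.inr ⟨hb1.le, ha1⟩))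
  exact ⟨z, hsub hz, hzs⟩

/-- The inverse function of the slope. -/
theorem exists_inverse (h : PowerLike F φ ζ c₁ c₂) : ∃ I : ℝ → ℝ,
    (∀ s, 0 < s → 0 < I s ∧ φ (I s) = s) ∧ (∀ z, 0 < z → I (φ z) = z) := by
  choose! I hI using fun s => h.exists_slope_eq (s := s)
  refine ⟨I, hI, fun z hz => ?_⟩
  have := hI (φ z) (h.pos z hz)
  exact h.slope_strictAntiOn.injOn this.1 hz this.2

/-- The inverse is strictly decreasing with image `(0, ∞)`, hence continuous, and the inverse
function rule applies. Its elasticity is the reciprocal of that of `φ`. -/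
theorem hasDerivAt_inverse (h : PowerLike F φ ζ c₁ c₂) {I : ℝ → ℝ}
    (hI : ∀ s, 0 < s → 0 < I s ∧ φ (I s) = s) (hI' : ∀ z, 0 < z → I (φ z) = z) {s : ℝ}
    (hs : 0 < s) : HasDerivAt I (-(1 / ζ (I s) * I s / s)) s := by
  have hanti : StrictAntiOn I (Ioi 0) := fun a ha b hb hab => by
    by_contra hc
    have := h.slope_strictAntiOn.antitoneOn (hI a ha).1 (hI b hb).1 (not_lt.1 hc)
    rw [(hI a ha).2, (hI b hb).2] at this
    linarith
  have hcont : ContinuousAt I s := by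
    have hm : StrictMonoOn (fun t => -I t) (Ioi 0) := fun a ha b hb hab => by
      simpa using hanti ha hb hab
    have := hm.continuousAt_of_image_mem_nhds (Ioi_mem_nhds hs) (by
      have : (fun t => -I t) '' Ioi 0 = Iio 0 := by
        ext t
        simp only [mem_image, mem_Ioi, mem_Iio]
        constructor
        · rintro ⟨a, ha, rfl⟩
          linarith [(hI a ha).1]
        · intro ht
          exact ⟨φ (-t), h.pos _ (by linarith), by rw [hI' _ (by linarith)]; ring⟩
      rw [this]
      exact Iio_mem_nhds (by linarith [(hI s hs).1]))
    refine this.neg.congr (Eventually.of_forall fun t => ?_)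
    simp
  have hz := (hI s hs).1
  have hd := h.hasDerivAt_slope (I s) hz
  rw [(hI s hs).2] at hd
  have hζ := h.elasticity_pos hz
  have := HasDerivAt.of_local_left_inverse hcont hd
    (neg_ne_zero.2 (by positivity)) ((eventually_gt_nhds hs).mono fun t ht => (hI t ht).2)
  refine this.congr_deriv ?_
  field_simp

end PowerLike

/-! ### The conjugate function and the extended utility -/

section Conjugate

variable {U : ℝ → ℝ} {c₁ c₂ : ℝ} {I : ℝ → ℝ}

theorem extV_ge (U : ℝ → ℝ) {z : ℝ} (hz : 0 < z) (s : ℝ) :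
    ((U z - z * s : ℝ) : EReal) ≤ extV U s :=
  le_iSup₂ (f := fun (z : ℝ) (_ : 0 < z) => ((U z - z * s : ℝ) : EReal)) z hz

theorem extV_slope (hU : IsUtility U) (hA : RiskAversionBounds U c₁ c₂) {z : ℝ} (hz : 0 < z) :
    extV U (deriv U z) = ((U z - z * deriv U z : ℝ) : EReal) := by
  refine le_antisymm (iSup₂_le fun t ht => ?_) (extV_ge U hz _)
  have := (powerLike_neg_utility hU hA).tangent_le hz ht
  rw [EReal.coe_le_coe_iff]
  linarith

theorem conjV_slope (hU : IsUtility U) (hA : RiskAversionBounds U c₁ c₂) {z : ℝ} (hz : 0 < z) :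
    conjV U (deriv U z) = U z - z * deriv U z := by
  rw [conjV, extV_slope hU hA hz, EReal.toReal_coe]

theorem extV_eq_conjV (hU : IsUtility U) (hA : RiskAversionBounds U c₁ c₂) {s : ℝ} (hs : 0 < s) :
    extV U s = (conjV U s : EReal) := by
  obtain ⟨z, hz, rfl⟩ := (powerLike_neg_utility hU hA).exists_slope_eq hs
  rw [conjV_slope hU hA hz, extV_slope hU hA hz]

/-- Equality would make `z` a local maximum of `U(t) - t s`, forcing `s = U'(z)`. The strictness
gives uniqueness of the dual optimizer. -/
theorem extV_gt (hU : IsUtility U) {z : ℝ} (hz : 0 < z)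
    {s : ℝ} (hs : s ≠ deriv U z) : ((U z - z * s : ℝ) : EReal) < extV U s := by
  have hd : HasDerivAt (fun t => U t - t * s) (deriv U z - s) z := by
    exact ((hU.differentiable z hz).hasDerivAt.sub
      ((hasDerivAt_id z).mul_const s)).congr_deriv (by simp)
  by_contra hc
  rw [not_lt] at hc
  have hmax : IsLocalMax (fun t => U t - t * s) z := by
    filter_upwards [eventually_gt_nhds hz] with t ht
    exact EReal.coe_le_coe_iff.1 ((extV_ge U ht s).trans hc)
  have := hmax.hasDerivAt_eq_zero hd
  exact hs (by linarith)

/-- By the envelope formula `V' = -I`, and the elasticity of `I` is `1 / A`. The dual problem is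
thus of the same type as the primal one. -/
theorem powerLike_conjV (hU : IsUtility U) (hA : RiskAversionBounds U c₁ c₂)
    (hI : ∀ s, 0 < s → 0 < I s ∧ deriv U (I s) = s) (hI' : ∀ z, 0 < z → I (deriv U z) = z) :
    PowerLike (conjV U) I (fun s => 1 / relCoeff U (I s)) (1 / c₂) (1 / c₁) := by
  have h := powerLike_neg_utility hU hA
  refine ⟨one_div_pos.2 h.c₂_pos, fun s hs => (hI s hs).1, fun s hs => ?_,
    fun s hs => h.hasDerivAt_inverse hI hI' hs, fun s hs => ?_, fun s hs => ?_⟩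
  · have e : conjV U =ᶠ[𝓝 s] fun s => U (I s) - I s * s := by
      filter_upwards [eventually_gt_nhds hs] with t ht
      have := conjV_slope hU hA (hI t ht).1
      rwa [(hI t ht).2] at this
    refine HasDerivAt.congr_of_eventuallyEq ?_ e
    have h1 := h.hasDerivAt_inverse hI hI' hs
    have h2 := (hU.differentiable _ (hI s hs).1).hasDerivAt.comp s h1
    rw [(hI s hs).2] at h2
    refine (h2.sub (h1.mul (hasDerivAt_id s))).congr_deriv ?_
    simp; ring
  · exact one_div_lt_one_div_of_lt (h.elasticity_pos (hI s hs).1) (h.upper _ (hI s hs).1)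
  · exact one_div_lt_one_div_of_lt h.c₁_pos (h.lower _ (hI s hs).1)

theorem PowerLike.deriv_deriv {F φ ζ : ℝ → ℝ} {c₁ c₂ : ℝ} (h : PowerLike F φ ζ c₁ c₂) {z : ℝ}
    (hz : 0 < z) : deriv (deriv F) z = ζ z * φ z / z := by
  have e : deriv F =ᶠ[𝓝 z] fun z => -φ z := by
    filter_upwards [eventually_gt_nhds hz] with t ht using (h.hasDerivAt t ht).deriv
  rw [e.deriv_eq]
  exact (h.hasDerivAt_slope z hz).neg.deriv.trans (neg_neg _)

theorem PowerLike.relCoeff_eq {F φ ζ : ℝ → ℝ} {c₁ c₂ : ℝ} (h : PowerLike F φ ζ c₁ c₂) {z : ℝ}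
    (hz : 0 < z) : relCoeff F z = ζ z := by
  rw [relCoeff, h.deriv_deriv hz, (h.hasDerivAt z hz).deriv]
  have := (h.pos z hz).ne'
  field_simp

/-! ### The extended utility -/

theorem extU_of_pos (U : ℝ → ℝ) {z : ℝ} (hz : 0 < z) : extU U z = (U z : EReal) := by
  simp [extU, hz]

theorem extU_mono (hU : IsUtility U) : Monotone (extU U) := by
  intro a b hab
  rcases lt_trichotomy a 0 with ha | ha | ha
  · simp [extU, ha.not_gt, ha.ne]
  · subst ha
    rcases hab.eq_or_lt with hb | hb
    · rw [← hb]
    · rw [extU_of_pos U hb]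
      simp only [extU, lt_irrefl, if_false, if_true]
      exact iInf₂_le b hb
  · rw [extU_of_pos U ha, extU_of_pos U (ha.trans_le hab), EReal.coe_le_coe_iff]
    exact hU.strictMono.monotoneOn ha (ha.trans_le hab) hab

theorem extV_antitoneOn (U : ℝ → ℝ) : Antitone (extV U) := by
  intro a b hab
  refine iSup₂_mono fun z hz => ?_
  rw [EReal.coe_le_coe_iff]
  nlinarith

/-- Supergradient inequality for all real `z`, including `0`, where the extended utility is a limit.
The strict version yields uniqueness of the primal optimizer. -/
theorem extU_le_tangent (hU : IsUtility U) (hA : RiskAversionBounds U c₁ c₂) {a z : ℝ}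
    (ha : 0 < a) : extU U z ≤ ((U a + deriv U a * (z - a) : ℝ) : EReal) ∧
      (z ≠ a → extU U z < ((U a + deriv U a * (z - a) : ℝ) : EReal)) := by
  have h := powerLike_neg_utility hU hA
  have hgap : ∀ t, 0 < t → t ≠ a → U t < U a + deriv U a * (t - a) := by
    intro t ht hta
    have h1 := h.gap_ge (M := max t a) (b := a) ha (le_max_right _ _) ht (le_max_left _ _)
    have h2 := h.pos (max t a) (lt_max_of_lt_left ht)
    have h3 := h.c₁_pos
    have h4 : 0 < max t a := lt_max_of_lt_left ht
    have h5 : 0 < (t - a) ^ 2 := by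
      have : t - a ≠ 0 := sub_ne_zero.2 hta
      positivity
    have : 0 < c₁ * deriv U (max t a) / max t a / 2 * (t - a) ^ 2 := by positivity
    linarith
  have hlt : z ≠ a → extU U z < ((U a + deriv U a * (z - a) : ℝ) : EReal) := by
    intro hza
    rcases lt_trichotomy z 0 with hz | hz | hz
    · simp only [extU, hz.not_gt, hz.ne, if_false]
      exact EReal.bot_lt_coe _
    · subst hz
      have g := hgap (a / 2) (by linarith) (by linarith)
      -- Strictness could be lost in the infimum defining `extU U 0`. The gap `d` at `a / 2`
      -- persists down to `0`, and `t` is so small that moving from `0` to `t` costs at most `d / 2`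
      -- of it.
      set d := U a + deriv U a * (a / 2 - a) - U (a / 2) with hd
      have hd0 : 0 < d := by linarith
      have hp := h.pos a ha
      set t := min (a / 2) (d / (2 * deriv U a)) with ht
      have ht0 : 0 < t := lt_min (by linarith) (by positivity)
      have hta : t ≤ a / 2 := min_le_left _ _
      have htd : deriv U a * t ≤ d / 2 := by
        have : t ≤ d / (2 * deriv U a) := min_le_right _ _
        rw [le_div_iff₀ (by positivity)] at this
        linarith
      have h1 := h.gap_antitone (f := t) (b := a) (b' := a / 2) ha (by linarith)
        (Or.inr ⟨hta, by linarith⟩)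
      have h2 := h.tangent_le (z := a / 2) (z' := t) (by linarith) ht0
      have h3 : deriv U a ≤ deriv U (a / 2) := h.slope_strictAntiOn.antitoneOn
        (mem_Ioi.2 (half_pos ha)) ha (by linarith)
      have h4 : U t ≤ U (a / 2) + deriv U a * (t - a / 2) := by nlinarith
      calc extU U 0 ≤ (U t : EReal) := by
            rw [← extU_of_pos U ht0]; exact extU_mono hU ht0.le
        _ < _ := by
            rw [EReal.coe_lt_coe_iff]
            linarith
    · rw [extU_of_pos U hz, EReal.coe_lt_coe_iff]
      exact hgap z hz hza
  refine ⟨?_, hlt⟩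
  by_cases hza : z = a
  · subst hza
    rw [extU_of_pos U ha]
    simp
  · exact (hlt hza).le

end Conjugate

/-! ### Dilations of polar sets -/

section Polar

variable {Ω : Type*} [MeasurableSpace Ω] {P : Measure Ω} {D : Set (Ω → ℝ)} {s t : ℝ}
  {f f' : Ω → ℝ}

theorem mem_scaled_polar (ht : 0 < t) : f ∈ scaled t (polar P D) ↔
    Measurable f ∧ (∀ᵐ ω ∂P, 0 ≤ f ω) ∧
      ∀ h ∈ D, ∫⁻ ω, ENNReal.ofReal (f ω * h ω) ∂P ≤ ENNReal.ofReal t := by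
  have key : ∀ (c : ℝ) (g h : Ω → ℝ), 0 ≤ c → ∫⁻ ω, ENNReal.ofReal (c * g ω * h ω) ∂P
      = ENNReal.ofReal c * ∫⁻ ω, ENNReal.ofReal (g ω * h ω) ∂P := by
    intro c g h hc
    rw [← lintegral_const_mul' _ _ ENNReal.ofReal_ne_top]
    refine lintegral_congr fun ω => ?_
    rw [mul_assoc, ENNReal.ofReal_mul hc]
  constructor
  · rintro ⟨g, ⟨hm, h0, hh⟩, rfl⟩
    refine ⟨hm.const_mul t, h0.mono fun ω h => mul_nonneg ht.le h, fun h hD => ?_⟩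
    rw [key t g h ht.le]
    exact mul_le_of_le_one_right' (hh h hD)
  · rintro ⟨hm, h0, hh⟩
    refine ⟨fun ω => t⁻¹ * f ω, ⟨hm.const_mul _, h0.mono fun ω h => by positivity,
      fun h hD => ?_⟩, ?_⟩
    · rw [key _ f h (inv_pos.2 ht).le, ENNReal.ofReal_inv_of_pos ht, mul_comm,
        ← div_eq_mul_inv]
      exact ENNReal.div_le_of_le_mul (by simpa using hh h hD)
    · ext ω
      field_simp

theorem scaled_polar_add (hD : ∀ h ∈ D, Measurable h) (hs : 0 < s) (ht : 0 < t)
    (hf : f ∈ scaled s (polar P D)) (hf' : f' ∈ scaled t (polar P D)) :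
    (fun ω => f ω + f' ω) ∈ scaled (s + t) (polar P D) := by
  rw [mem_scaled_polar hs] at hf
  rw [mem_scaled_polar ht] at hf'
  rw [mem_scaled_polar (add_pos hs ht)]
  refine ⟨hf.1.add hf'.1, ?_, fun h hh => ?_⟩
  · filter_upwards [hf.2.1, hf'.2.1] with ω h1 h2 using add_nonneg h1 h2
  · calc ∫⁻ ω, ENNReal.ofReal ((f ω + f' ω) * h ω) ∂P
        ≤ ∫⁻ ω, (ENNReal.ofReal (f ω * h ω) + ENNReal.ofReal (f' ω * h ω)) ∂P := by
          refine lintegral_mono fun ω => ?_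
          simp only [add_mul]
          exact ENNReal.ofReal_add_le
      _ = ∫⁻ ω, ENNReal.ofReal (f ω * h ω) ∂P + ∫⁻ ω, ENNReal.ofReal (f' ω * h ω) ∂P :=
          lintegral_add_left (hf.1.mul (hD h hh)).ennreal_ofReal _
      _ ≤ ENNReal.ofReal s + ENNReal.ofReal t := add_le_add (hf.2.2 h hh) (hf'.2.2 h hh)
      _ = ENNReal.ofReal (s + t) := (ENNReal.ofReal_add hs.le ht.le).symm

theorem scaled_smul {K : Set (Ω → ℝ)} (c : ℝ) (hf : f ∈ scaled t K) :
    (fun ω => c * f ω) ∈ scaled (c * t) K := by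
  obtain ⟨g, hg, rfl⟩ := hf
  exact ⟨g, hg, funext fun ω => by ring⟩

theorem scaled_polar_convex (hD : ∀ h ∈ D, Measurable h) (ht : 0 < t)
    (hf : f ∈ scaled t (polar P D)) (hf' : f' ∈ scaled t (polar P D)) {δ : ℝ} (h0 : 0 < δ)
    (h1 : δ < 1) : (fun ω => (1 - δ) * f ω + δ * f' ω) ∈ scaled t (polar P D) := by
  have := scaled_polar_add hD (mul_pos (by linarith : 0 < 1 - δ) ht) (mul_pos h0 ht)
    (scaled_smul (1 - δ) hf) (scaled_smul δ hf')
  rwa [show (1 - δ) * t + δ * t = t by ring] at this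

theorem const_mem_scaled {K : Set (Ω → ℝ)} (h1 : (fun _ => (1:ℝ)) ∈ K) (t : ℝ) :
    (fun _ => t) ∈ scaled t K := ⟨_, h1, by simp⟩

/-- Fatou's lemma in each of the inequalities that define the polar. -/
theorem scaled_polar_closed (hD : ∀ h ∈ D, Measurable h) (ht : 0 < t) {fn : ℕ → Ω → ℝ}
    (hfn : ∀ n, fn n ∈ scaled t (polar P D)) (hm : Measurable f)
    (hlim : ∀ᵐ ω ∂P, Tendsto (fun n => fn n ω) atTop (𝓝 (f ω))) :
    f ∈ scaled t (polar P D) := by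
  simp only [mem_scaled_polar ht] at hfn ⊢
  refine ⟨hm, ?_, fun h hh => ?_⟩
  · filter_upwards [hlim, ae_all_iff.2 fun n => (hfn n).2.1] with ω h1 h2
    exact ge_of_tendsto' h1 h2
  · calc ∫⁻ ω, ENNReal.ofReal (f ω * h ω) ∂P
        = ∫⁻ ω, liminf (fun n => ENNReal.ofReal (fn n ω * h ω)) atTop ∂P := by
          refine lintegral_congr_ae ?_
          filter_upwards [hlim] with ω h1
          exact ((ENNReal.tendsto_ofReal (h1.mul_const (h ω))).liminf_eq).symm
      _ ≤ liminf (fun n => ∫⁻ ω, ENNReal.ofReal (fn n ω * h ω) ∂P) atTop :=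
          lintegral_liminf_le fun n => ((hfn n).1.mul (hD h hh)).ennreal_ofReal
      _ ≤ ENNReal.ofReal t := by
          refine liminf_le_of_frequently_le' (Eventually.frequently ?_)
          exact Eventually.of_forall fun n => (hfn n).2.2 h hh

/-- Uniform tail bound for a set bounded in `L⁰`. -/
theorem exists_tail_le_of_boundedInL0 {K : Set (Ω → ℝ)} (hK : BoundedInL0 P K) (ht : 0 < t)
    {η : ℝ≥0∞} (hη : 0 < η) : ∃ M : ℝ, 0 < M ∧ ∀ f ∈ scaled t K, P {ω | M ≤ |f ω|} ≤ η := by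
  obtain ⟨n, hn, hn1⟩ := ((hK.eventually (gt_mem_nhds hη)).and (eventually_ge_atTop 1)).exists
  refine ⟨t * n, by positivity, ?_⟩
  rintro f ⟨g, hg, rfl⟩
  have h1 : P {ω | (n : ℝ) ≤ |g ω|} ≤ η := by
    refine le_trans ?_ hn.le
    exact le_iSup₂ (f := fun g (_ : g ∈ K) => P {ω | (n : ℝ) ≤ |g ω|}) g hg
  refine le_trans (measure_mono fun ω hω => ?_) h1
  simp only [mem_ofPred_eq, abs_mul, abs_of_pos ht] at hω ⊢
  exact le_of_mul_le_mul_left hω ht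

end Polar

/-! ### Sequences that are Cauchy in measure -/

section ConvergenceInMeasure

variable {Ω : Type*} [MeasurableSpace Ω] {P : Measure Ω}

/-- A sequence that is Cauchy in measure has a subsequence that converges almost everywhere. -/
theorem exists_subseq_tendsto_ae {fn : ℕ → Ω → ℝ} (hm : ∀ n, Measurable (fn n))
    (hc : ∀ κ : ℝ, 0 < κ → ∀ η : ℝ≥0∞, 0 < η → ∃ N, ∀ n ≥ N, ∀ k ≥ N,
      P {ω | κ ≤ |fn n ω - fn k ω|} ≤ η) :
    ∃ ns : ℕ → ℕ, StrictMono ns ∧ ∃ f : Ω → ℝ, Measurable f ∧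
      ∀ᵐ ω ∂P, Tendsto (fun n => fn (ns n) ω) atTop (𝓝 (f ω)) := by
  choose N hN using fun n : ℕ => hc ((1 / 2) ^ n) (by positivity) ((1 / 2) ^ n)
    (ENNReal.pow_pos (by simp) n)
  -- Consecutive terms of this subsequence differ by at least `(1/2)^n` only on sets of summable
  -- measure, so Borel–Cantelli applies.
  let ns : ℕ → ℕ := fun n => Nat.rec (N 0) (fun k r => max (r + 1) (N (k + 1))) n
  have hns_succ : ∀ n, ns (n + 1) = max (ns n + 1) (N (n + 1)) := fun n => rfl
  have hns : StrictMono ns := strictMono_nat_of_lt_succ fun n => by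
    rw [hns_succ]
    exact lt_of_lt_of_le (Nat.lt_succ_self _) (le_max_left _ _)
  have hNs : ∀ n, N n ≤ ns n := by
    intro n
    cases n with
    | zero => exact le_rfl
    | succ k => rw [hns_succ]; exact le_max_right _ _
  have hsum : ∑' n, P {ω | (1 / 2 : ℝ) ^ n ≤ |fn (ns n) ω - fn (ns (n + 1)) ω|} ≠ ∞ := by
    refine ne_top_of_le_ne_top ?_ (ENNReal.tsum_le_tsum fun n =>
      hN n (ns n) (hNs n) (ns (n + 1)) ((hNs n).trans (hns (Nat.lt_succ_self n)).le))
    rw [ENNReal.tsum_geometric]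
    simp
  have hbc := ae_eventually_notMem hsum
  have hlim : ∀ᵐ ω ∂P, ∃ l, Tendsto (fun n => fn (ns n) ω) atTop (𝓝 l) := by
    filter_upwards [hbc] with ω hω
    obtain ⟨M, hM⟩ := eventually_atTop.1 hω
    have hcs : CauchySeq (fun n => fn (ns (n + M)) ω) := by
      refine cauchySeq_of_le_geometric (1 / 2) ((1 / 2) ^ M) (by norm_num) fun n => ?_
      have := hM (n + M) (by omega)
      simp only [mem_ofPred_eq, not_le] at this
      rw [Real.dist_eq, ← pow_add, add_comm M n, show n + 1 + M = n + M + 1 by ring]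
      exact this.le
    obtain ⟨l, hl⟩ := cauchySeq_tendsto_of_complete hcs
    exact ⟨l, (tendsto_add_atTop_iff_nat M).1 hl⟩
  obtain ⟨f, hf, hft⟩ := measurable_limit_of_tendsto_metrizable_ae
    (fun n => (hm (ns n)).aemeasurable) hlim
  exact ⟨ns, hns, f, hf, hft⟩

theorem aestronglyMeasurable_comp_of_continuousOn {F : ℝ → ℝ} (hF : ContinuousOn F (Ioi 0))
    {g : Ω → ℝ} (hg : Measurable g) (hpos : ∀ᵐ ω ∂P, 0 < g ω) :
    AEStronglyMeasurable (fun ω => F (g ω)) P := by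
  classical
  have h1 : Measurable ((Ioi (0:ℝ)).piecewise F (fun _ => 0)) :=
    hF.measurable_piecewise continuousOn_const measurableSet_Ioi
  refine ⟨_, (h1.comp hg).stronglyMeasurable, ?_⟩
  filter_upwards [hpos] with ω hω
  simp [Set.piecewise, hω]

end ConvergenceInMeasure

/-! ### The abstract minimization problem over a dilated polar set -/

theorem PowerLike.convex_le {F φ ζ : ℝ → ℝ} {c₁ c₂ : ℝ} (h : PowerLike F φ ζ c₁ c₂) {a b δ : ℝ}
    (ha : 0 < a) (hb : 0 < b) (h0 : 0 < δ) (h1 : δ < 1) :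
    F ((1 - δ) * a + δ * b) ≤ (1 - δ) * F a + δ * F b := by
  have h1' : 0 < 1 - δ := by linarith
  have hc : 0 < (1 - δ) * a + δ * b := by positivity
  have e1 := h.tangent_le hc ha
  have e2 := h.tangent_le hc hb
  have e3 := mul_le_mul_of_nonneg_left e1 h1'.le
  have e4 := mul_le_mul_of_nonneg_left e2 h0.le
  nlinarith

/-- The competitors in the problem of minimizing `E[F(f)]` over `f ∈ t K`. -/
structure Admissible {Ω : Type*} [MeasurableSpace Ω] (P : Measure Ω) (F : ℝ → ℝ)
    (K : Set (Ω → ℝ)) (t : ℝ) (f : Ω → ℝ) : Prop where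
  mem : f ∈ scaled t K
  pos : ∀ᵐ ω ∂P, 0 < f ω
  integrable : Integrable (fun ω => F (f ω)) P

/-- The problem of minimizing `E[F(f)]` over `f ∈ t K` is bounded below for every `t > 0`. -/
def BoundedProblem {Ω : Type*} [MeasurableSpace Ω] (P : Measure Ω) (F : ℝ → ℝ)
    (K : Set (Ω → ℝ)) : Prop :=
  ∀ t : ℝ, 0 < t → ∃ M : ℝ, ∀ f ∈ scaled t K, (∀ᵐ ω ∂P, 0 < f ω) → ∀ r : Ω → ℝ,
    Integrable r P → (∀ᵐ ω ∂P, F (f ω) ≤ r ω) →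
    Integrable (fun ω => F (f ω)) P ∧ -M ≤ ∫ ω, F (f ω) ∂P

/-- First-order characterization of the minimizer `g` of `E[F(f)]` over `f ∈ t K`, with Lagrange
multiplier `y`. -/
structure IsOpt {Ω : Type*} [MeasurableSpace Ω] (P : Measure Ω) (F φ : ℝ → ℝ)
    (K : Set (Ω → ℝ)) (t y : ℝ) (g : Ω → ℝ) : Prop where
  mem : g ∈ scaled t K
  pos : ∀ᵐ ω ∂P, 0 < g ω
  integrable : Integrable (fun ω => F (g ω)) P
  integrable_mul : Integrable (fun ω => g ω * φ (g ω)) P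
  integral_mul : ∫ ω, g ω * φ (g ω) ∂P = t * y
  le : ∀ f ∈ scaled t K, Integrable (fun ω => f ω * φ (g ω)) P ∧
    ∫ ω, f ω * φ (g ω) ∂P ≤ t * y

/-! ### Compactness of minimizing sequences -/

section Existence

variable {Ω : Type*} [MeasurableSpace Ω] {P : Measure Ω} {D : Set (Ω → ℝ)}
  {F φ ζ : ℝ → ℝ} {c₁ c₂ s t : ℝ} {f f' g : Ω → ℝ}

theorem measurable_of_mem_scaled (hf : f ∈ scaled t (polar P D)) : Measurable f := by
  obtain ⟨g, hg, rfl⟩ := hf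
  exact hg.1.const_mul t

theorem nonneg_of_mem_scaled (ht : 0 < t) (hf : f ∈ scaled t (polar P D)) :
    ∀ᵐ ω ∂P, 0 ≤ f ω := ((mem_scaled_polar ht).1 hf).2.1

theorem BoundedProblem.admissible {K : Set (Ω → ℝ)} (hB : BoundedProblem P F K) (ht : 0 < t)
    (hf : f ∈ scaled t K) (hpos : ∀ᵐ ω ∂P, 0 < f ω) {r : Ω → ℝ} (hr : Integrable r P)
    (hle : ∀ᵐ ω ∂P, F (f ω) ≤ r ω) : Admissible P F K t f :=
  ⟨hf, hpos, ((hB t ht).choose_spec f hf hpos r hr hle).1⟩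

theorem BoundedProblem.exists_lower {K : Set (Ω → ℝ)} (hB : BoundedProblem P F K) (ht : 0 < t) :
    ∃ M, ∀ f, Admissible P F K t f → -M ≤ ∫ ω, F (f ω) ∂P := by
  obtain ⟨M, hM⟩ := hB t ht
  exact ⟨M, fun f hf => (hM f hf.mem hf.pos _ hf.integrable (Eventually.of_forall fun _ =>
    le_rfl)).2⟩

theorem Admissible.convex (hF : PowerLike F φ ζ c₁ c₂) (hB : BoundedProblem P F (polar P D))
    (hD : ∀ h ∈ D, Measurable h) (ht : 0 < t) (hf : Admissible P F (polar P D) t f)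
    (hf' : Admissible P F (polar P D) t f') {δ : ℝ} (h0 : 0 < δ) (h1 : δ < 1) :
    Admissible P F (polar P D) t (fun ω => (1 - δ) * f ω + δ * f' ω) := by
  have h1' : 0 < 1 - δ := by linarith
  refine hB.admissible ht (scaled_polar_convex hD ht hf.mem hf'.mem h0 h1) ?_
    ((hf.integrable.const_mul (1 - δ)).add (hf'.integrable.const_mul δ)) ?_
  · filter_upwards [hf.pos, hf'.pos] with ω a b
    positivity
  · filter_upwards [hf.pos, hf'.pos] with ω a b
    exact hF.convex_le a b h0 h1

theorem admissible_const [IsFiniteMeasure P] {K : Set (Ω → ℝ)} (h1 : (fun _ => (1:ℝ)) ∈ K)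
    (ht : 0 < t) : Admissible P F K t (fun _ => t) :=
  ⟨const_mem_scaled h1 t, Eventually.of_forall fun _ => ht, integrable_const _⟩

theorem admissible_add_const [IsFiniteMeasure P] (hF : PowerLike F φ ζ c₁ c₂)
    (hB : BoundedProblem P F (polar P D)) (hD : ∀ h ∈ D, Measurable h)
    (h1 : (fun _ => (1:ℝ)) ∈ polar P D) (hs : 0 < s) (ht : 0 < t)
    (hf : f ∈ scaled t (polar P D)) :
    Admissible P F (polar P D) (t + s) (fun ω => f ω + s) := by
  refine hB.admissible (add_pos ht hs) (scaled_polar_add hD ht hs hf (const_mem_scaled h1 s)) ?_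
    (integrable_const (F s)) ?_
  · filter_upwards [nonneg_of_mem_scaled ht hf] with ω h
    linarith
  · filter_upwards [nonneg_of_mem_scaled ht hf] with ω h
    exact hF.antitoneOn hs (mem_Ioi.2 (by linarith)) (by linarith)

/-- The midpoint of two nearly optimal competitors is a competitor, so the expected midpoint gap is
at most the sum of the two errors. Where both are below `M` and differ by `κ`, this gap is at least
`c`; Markov's inequality and the uniform tail bound finish. -/
theorem cauchy_of_minimizing [IsProbabilityMeasure P] (hF : PowerLike F φ ζ c₁ c₂)
    (hB : BoundedProblem P F (polar P D)) (hD : ∀ h ∈ D, Measurable h)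
    (hbdd : BoundedInL0 P (polar P D)) (ht : 0 < t) {m : ℝ}
    (hm : ∀ f, Admissible P F (polar P D) t f → m ≤ ∫ ω, F (f ω) ∂P) {fn : ℕ → Ω → ℝ}
    (hfn : ∀ n, Admissible P F (polar P D) t (fn n)) {ε : ℕ → ℝ} (hε : Tendsto ε atTop (𝓝 0))
    (hle : ∀ n, ∫ ω, F (fn n ω) ∂P ≤ m + ε n) (κ : ℝ) (hκ : 0 < κ) (η : ℝ≥0∞) (hη : 0 < η) :
    ∃ N, ∀ n ≥ N, ∀ k ≥ N, P {ω | κ ≤ |fn n ω - fn k ω|} ≤ η := by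
  by_cases hηt : η = ∞
  · exact ⟨0, fun n _ k _ => hηt ▸ le_top⟩
  have hη3 : 0 < η / 3 := ENNReal.div_pos hη.ne' (by simp)
  obtain ⟨M, hM, hMf⟩ := exists_tail_le_of_boundedInL0 hbdd ht hη3
  set c := c₁ * φ M / M / 4 * κ ^ 2 with hc
  have hc0 : 0 < c := by
    have := hF.c₁_pos
    have := hF.pos M hM
    positivity
  have hη3r : 0 < (η / 3).toReal :=
    ENNReal.toReal_pos hη3.ne' (ENNReal.div_ne_top hηt (by simp))
  obtain ⟨N, hN⟩ := eventually_atTop.1 (hε.eventually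
    (gt_mem_nhds (by positivity : 0 < c * (η / 3).toReal / 2)))
  refine ⟨N, fun n hn k hk => ?_⟩
  set G : Ω → ℝ := fun ω => F (fn n ω) + F (fn k ω) - 2 * F ((fn n ω + fn k ω) / 2) with hG
  have hmid : Admissible P F (polar P D) t (fun ω => (fn n ω + fn k ω) / 2) := by
    have := (hfn n).convex hF hB hD ht (hfn k) (δ := 1 / 2) (by norm_num) (by norm_num)
    convert this using 2 with ω
    ring
  have hi : Integrable (fun ω => F (fn n ω) + F (fn k ω)) P :=
    (hfn n).integrable.add (hfn k).integrable
  have hGi : Integrable G P := hi.sub (hmid.integrable.const_mul 2)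
  have hGint : ∫ ω, G ω ∂P ≤ ε n + ε k := by
    have e : ∫ ω, G ω ∂P = ∫ ω, F (fn n ω) ∂P + ∫ ω, F (fn k ω) ∂P
        - 2 * ∫ ω, F ((fn n ω + fn k ω) / 2) ∂P := by
      rw [← integral_const_mul, ← integral_add (hfn n).integrable (hfn k).integrable,
        ← integral_sub hi (hmid.integrable.const_mul 2)]
    have := hm _ hmid
    have := hle n
    have := hle k
    linarith
  have hG0 : 0 ≤ᵐ[P] G := by
    filter_upwards [(hfn n).pos, (hfn k).pos] with ω a b
    exact hF.midpoint_gap_nonneg a b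
  have hmk := mul_meas_ge_le_integral_of_nonneg hG0 hGi c
  have hP : P {ω | c ≤ G ω} ≤ η / 3 := by
    have h2 : P.real {ω | c ≤ G ω} ≤ (η / 3).toReal := by
      have h3 := hN n hn
      have h4 := hN k hk
      have : c * P.real {ω | c ≤ G ω} ≤ c * (η / 3).toReal := by linarith
      exact le_of_mul_le_mul_left this hc0
    rw [Measure.real] at h2
    exact (ENNReal.toReal_le_toReal (measure_ne_top _ _)
      (ENNReal.div_ne_top hηt (by simp))).1 h2
  have hsub : ({ω | κ ≤ |fn n ω - fn k ω|} : Set Ω) ≤ᵐ[P]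
      (({ω | M ≤ |fn n ω|} ∪ {ω | M ≤ |fn k ω|}) ∪ {ω | c ≤ G ω} : Set Ω) := by
    filter_upwards [(hfn n).pos, (hfn k).pos] with ω a b (h : κ ≤ |fn n ω - fn k ω|)
    by_cases h1 : M ≤ |fn n ω|
    · exact Or.inl (Or.inl h1)
    by_cases h2 : M ≤ |fn k ω|
    · exact Or.inl (Or.inr h2)
    right
    rw [not_le, abs_of_pos a] at h1
    rw [not_le, abs_of_pos b] at h2
    refine le_trans ?_ (hF.midpoint_gap a h1.le b h2.le)
    have : κ ^ 2 ≤ (fn n ω - fn k ω) ^ 2 := by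
      rw [← sq_abs (fn n ω - fn k ω)]
      exact pow_le_pow_left₀ hκ.le h 2
    have := hF.c₁_pos
    have := hF.pos M hM
    rw [hc]
    gcongr
  calc P {ω | κ ≤ |fn n ω - fn k ω|} ≤ _ := measure_mono_ae hsub
    _ ≤ P {ω | M ≤ |fn n ω|} + P {ω | M ≤ |fn k ω|} + P {ω | c ≤ G ω} :=
        (measure_union_le _ _).trans (add_le_add_left (measure_union_le _ _) _)
    _ ≤ η / 3 + η / 3 + η / 3 := add_le_add (add_le_add (hMf _ (hfn n).mem) (hMf _ (hfn k).mem)) hP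
    _ = η := ENNReal.add_thirds η

theorem aemeasurable_liminf_nat {u : ℕ → Ω → ℝ≥0∞} (hu : ∀ n, AEMeasurable (u n) P) :
    AEMeasurable (fun ω => liminf (fun n => u n ω) atTop) P := by
  refine ⟨_, Measurable.liminf fun n => (hu n).measurable_mk, ?_⟩
  filter_upwards [ae_all_iff.2 fun n => (hu n).ae_eq_mk] with ω h
  exact congrArg (fun v => liminf v atTop) (funext h)

/-- The slope of `F` is infinite at `0`, so where the limit vanished, moving towards the constant
`t` would bring unbounded marginal gains. Near optimality bounds these gains in mean. The same `δ n`
is the step of the perturbation and the error of the minimizing sequence, so their quotient is at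
most `1`. -/
theorem limit_pos_of_minimizing [IsProbabilityMeasure P] (hF : PowerLike F φ ζ c₁ c₂)
    (hB : BoundedProblem P F (polar P D)) (hD : ∀ h ∈ D, Measurable h)
    (h1 : (fun _ => (1:ℝ)) ∈ polar P D) (ht : 0 < t) {m : ℝ}
    (hm : ∀ f, Admissible P F (polar P D) t f → m ≤ ∫ ω, F (f ω) ∂P) {fn : ℕ → Ω → ℝ}
    (hfn : ∀ n, Admissible P F (polar P D) t (fn n)) {δ : ℕ → ℝ} (hδ0 : ∀ n, 0 < δ n)
    (hδ1 : ∀ n, δ n < 1) (hδ : Tendsto δ atTop (𝓝 0))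
    (hle : ∀ n, ∫ ω, F (fn n ω) ∂P ≤ m + δ n)
    (hlim : ∀ᵐ ω ∂P, Tendsto (fun n => fn n ω) atTop (𝓝 (g ω))) : ∀ᵐ ω ∂P, 0 < g ω := by
  obtain ⟨M, hM⟩ := hB.exists_lower (add_pos ht ht)
  set fd : ℕ → Ω → ℝ := fun n ω => (1 - δ n) * fn n ω + δ n * t with hfd
  have hfdA : ∀ n, Admissible P F (polar P D) t (fd n) := fun n =>
    (hfn n).convex hF hB hD ht (admissible_const h1 ht) (hδ0 n) (hδ1 n)
  have hm2 : ∀ n, Admissible P F (polar P D) (t + t) (fun ω => fn n ω + t) := fun n =>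
    admissible_add_const hF hB hD h1 ht ht (hfn n).mem
  have hmeas : ∀ n, AEMeasurable (fun ω => ENNReal.ofReal (φ (fd n ω) * (t - fn n ω))) P :=
    fun n => ((aestronglyMeasurable_comp_of_continuousOn hF.continuousOn_slope
      (measurable_of_mem_scaled (hfdA n).mem) (hfdA n).pos).aemeasurable.mul
      ((measurable_of_mem_scaled (hfn n).mem).const_sub t).aemeasurable).ennreal_ofReal
  have hbound : ∀ n, ∫⁻ ω, ENNReal.ofReal (φ (fd n ω) * (t - fn n ω)) ∂P
      ≤ ENNReal.ofReal (1 + F t + M) := by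
    intro n
    -- The second summand compensates the first where `fn n` exceeds `t`, so that `r` is nonnegative
    -- and its expectation bounds a Lebesgue integral.
    set r : Ω → ℝ := fun ω => (δ n)⁻¹ * (F (fn n ω) - F (fd n ω)) + (F t - F (fn n ω + t)) with hr
    have i1 : Integrable (fun ω => (δ n)⁻¹ * (F (fn n ω) - F (fd n ω))) P :=
      ((hfn n).integrable.sub (hfdA n).integrable).const_mul _
    have i2 : Integrable (fun ω => F t - F (fn n ω + t)) P :=
      (integrable_const _).sub (hm2 n).integrable
    have hri : Integrable r P := i1.add i2
    have hpt : ∀ᵐ ω ∂P, φ (fd n ω) * (t - fn n ω) ≤ r ω ∧ 0 ≤ r ω := by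
      filter_upwards [(hfn n).pos, (hfdA n).pos] with ω a b
      have e1 := hF.tangent_le b a
      have e2 := hF.convex_le a ht (hδ0 n) (hδ1 n)
      have e3 : F (fn n ω + t) ≤ F t :=
        hF.antitoneOn ht (mem_Ioi.2 (by linarith)) (by linarith)
      have e4 : F (fn n ω + t) ≤ F (fn n ω) :=
        hF.antitoneOn a (mem_Ioi.2 (by linarith)) (by linarith)
      have hfdω : fd n ω = (1 - δ n) * fn n ω + δ n * t := rfl
      rw [← hfdω] at e2
      have hd := hδ0 n
      have e5 : δ n * (φ (fd n ω) * (t - fn n ω)) ≤ F (fn n ω) - F (fd n ω) := by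
        have : fn n ω - fd n ω = δ n * (fn n ω - t) := by rw [hfdω]; ring
        rw [this] at e1
        linarith
      have e6 : φ (fd n ω) * (t - fn n ω) ≤ (δ n)⁻¹ * (F (fn n ω) - F (fd n ω)) := by
        rw [inv_mul_eq_div, le_div_iff₀ hd]
        linarith
      have hφ := hF.pos _ b
      refine ⟨by simp only [hr]; linarith, ?_⟩
      rcases le_total (fn n ω) t with hc | hc
      · have : 0 ≤ φ (fd n ω) * (t - fn n ω) := mul_nonneg hφ.le (by linarith)
        simp only [hr]; linarith
      · have e7 : -(F t - F (fn n ω)) ≤ (δ n)⁻¹ * (F (fn n ω) - F (fd n ω)) := by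
          rw [inv_mul_eq_div, le_div_iff₀ hd]
          linarith
        simp only [hr]; linarith
    calc ∫⁻ ω, ENNReal.ofReal (φ (fd n ω) * (t - fn n ω)) ∂P
        ≤ ∫⁻ ω, ENNReal.ofReal (r ω) ∂P := lintegral_mono_ae (by
          filter_upwards [hpt] with ω h using ENNReal.ofReal_le_ofReal h.1)
      _ = ENNReal.ofReal (∫ ω, r ω ∂P) := (ofReal_integral_eq_lintegral_ofReal hri
          (hpt.mono fun ω h => h.2)).symm
      _ ≤ ENNReal.ofReal (1 + F t + M) := by
          refine ENNReal.ofReal_le_ofReal ?_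
          have : ∫ ω, r ω ∂P = (δ n)⁻¹ * (∫ ω, F (fn n ω) ∂P - ∫ ω, F (fd n ω) ∂P)
              + (F t - ∫ ω, F (fn n ω + t) ∂P) := by
            rw [hr, integral_add i1 i2, integral_const_mul,
              integral_sub (hfn n).integrable (hfdA n).integrable,
              integral_sub (integrable_const _) (hm2 n).integrable]
            simp
          rw [this]
          have e1 := hM _ (hm2 n)
          have e2 := hm _ (hfdA n)
          have e3 : (δ n)⁻¹ * (∫ ω, F (fn n ω) ∂P - ∫ ω, F (fd n ω) ∂P) ≤ 1 := by
            rw [inv_mul_eq_div, div_le_one (hδ0 n)]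
            linarith [hle n]
          linarith
  have hfatou : ∫⁻ ω, liminf (fun n => ENNReal.ofReal (φ (fd n ω) * (t - fn n ω))) atTop ∂P
      ≠ ∞ := by
    refine ne_top_of_le_ne_top (b := ENNReal.ofReal (1 + F t + M)) ENNReal.ofReal_ne_top ?_
    refine (lintegral_liminf_le' hmeas).trans ?_
    refine liminf_le_of_frequently_le' (Eventually.frequently ?_)
    exact Eventually.of_forall hbound
  have hlt := ae_lt_top' (aemeasurable_liminf_nat hmeas) hfatou
  filter_upwards [hlt, hlim, ae_all_iff.2 fun n => (hfn n).pos] with ω h2 h3 h4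
  have hg0 : 0 ≤ g ω := ge_of_tendsto' h3 fun n => (h4 n).le
  refine lt_of_le_of_ne hg0 fun hg => ?_
  rw [← hg] at h3
  have hfd0 : Tendsto (fun n => fd n ω) atTop (𝓝[>] 0) := by
    refine tendsto_nhdsWithin_of_tendsto_nhds_of_eventually_within _ ?_ ?_
    · have := ((tendsto_const_nhds (x := (1:ℝ))).sub hδ).mul h3
      have := this.add (hδ.mul_const t)
      simpa using this
    · refine Eventually.of_forall fun n => ?_
      have e1 := hδ0 n
      have e2 := hδ1 n
      have e3 := h4 n
      have e4 : 0 < 1 - δ n := by linarith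
      simp only [hfd, mem_Ioi]
      positivity
  have htop : Tendsto (fun n => φ (fd n ω) * (t - fn n ω)) atTop atTop := by
    refine (hF.tendsto_slope_zero.comp hfd0).atTop_mul_pos (C := t) ht ?_
    simpa using h3.const_sub t
  have := (ENNReal.tendsto_ofReal_atTop.comp htop).liminf_eq
  simp only [Function.comp_def] at this
  rw [this] at h2
  exact lt_irrefl _ h2

end Existence

/-! ### Existence of minimizers and first-order conditions -/

section Existence

variable {Ω : Type*} [MeasurableSpace Ω] {P : Measure Ω} {D : Set (Ω → ℝ)}
  {F φ ζ : ℝ → ℝ} {c₁ c₂ s t : ℝ} {f f' g : Ω → ℝ}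

theorem integrable_of_tendsto_of_integral_le {Y : ℕ → Ω → ℝ} {B : ℝ}
    (hY : ∀ n, Integrable (Y n) P)
    (hlim : ∀ᵐ ω ∂P, Tendsto (fun n => Y n ω) atTop (𝓝 (f ω))) (hB : ∀ n, ∫ ω, |Y n ω| ∂P ≤ B) :
    Integrable f P := by
  refine ⟨aestronglyMeasurable_of_tendsto_ae _ (fun n => (hY n).aestronglyMeasurable) hlim, ?_⟩
  have h1 : ∀ n, ∫⁻ ω, ‖Y n ω‖ₑ ∂P ≤ ENNReal.ofReal B := fun n => by
    rw [← ofReal_integral_norm_eq_lintegral_enorm (hY n)]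
    exact ENNReal.ofReal_le_ofReal (hB n)
  calc ∫⁻ ω, ‖f ω‖ₑ ∂P = ∫⁻ ω, liminf (fun n => ‖Y n ω‖ₑ) atTop ∂P :=
        lintegral_congr_ae (by filter_upwards [hlim] with ω h using h.enorm.liminf_eq.symm)
    _ ≤ liminf (fun n => ∫⁻ ω, ‖Y n ω‖ₑ ∂P) atTop :=
        lintegral_liminf_le' fun n => (hY n).aestronglyMeasurable.enorm
    _ ≤ ENNReal.ofReal B := liminf_le_of_frequently_le'
        (Eventually.frequently (Eventually.of_forall h1))
    _ < ∞ := ENNReal.ofReal_lt_top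

/-- After the shift by `t`, `F` is bounded above by `F t`, while its mean is bounded below by the
problem at capital `2 t`. The resulting `L¹` bound is uniform over the whole set. -/
theorem integral_abs_add_const_le [IsProbabilityMeasure P] (hF : PowerLike F φ ζ c₁ c₂)
    (hB : BoundedProblem P F (polar P D)) (hD : ∀ h ∈ D, Measurable h)
    (h1 : (fun _ => (1:ℝ)) ∈ polar P D) (ht : 0 < t) :
    ∃ Q : ℝ, ∀ f ∈ scaled t (polar P D), ∫ ω, |F (f ω + t)| ∂P ≤ Q := by
  obtain ⟨M, hM⟩ := hB.exists_lower (add_pos ht ht)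
  refine ⟨2 * |F t| + M, fun f hf => ?_⟩
  have hA := admissible_add_const hF hB hD h1 ht ht hf
  calc ∫ ω, |F (f ω + t)| ∂P ≤ ∫ ω, (2 * |F t| - F (f ω + t)) ∂P := by
        refine integral_mono_ae hA.integrable.abs
          ((integrable_const _).sub hA.integrable) ?_
        filter_upwards [nonneg_of_mem_scaled ht hf] with ω h
        have h2 : F (f ω + t) ≤ F t :=
          hF.antitoneOn ht (mem_Ioi.2 (by linarith)) (by linarith)
        have := le_abs_self (F t)
        have := abs_nonneg (F t)
        exact abs_le.2 ⟨by linarith, by linarith⟩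
    _ = 2 * |F t| - ∫ ω, F (f ω + t) ∂P := by
        rw [integral_sub (integrable_const _) hA.integrable]
        simp
    _ ≤ 2 * |F t| + M := by linarith [hM _ hA]

/-- `F(fₙ)` is minorized by `F(fₙ + t)`, which is bounded in `L¹`; with the upper bound on the means
this bounds `F(fₙ)` in `L¹`, and Fatou's lemma applies. -/
theorem integrable_limit [IsProbabilityMeasure P] (hF : PowerLike F φ ζ c₁ c₂)
    (hB : BoundedProblem P F (polar P D)) (hD : ∀ h ∈ D, Measurable h)
    (h1 : (fun _ => (1:ℝ)) ∈ polar P D) (ht : 0 < t) {B : ℝ} {fn : ℕ → Ω → ℝ}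
    (hfn : ∀ n, Admissible P F (polar P D) t (fn n)) (hle : ∀ n, ∫ ω, F (fn n ω) ∂P ≤ B)
    (hlim : ∀ᵐ ω ∂P, Tendsto (fun n => F (fn n ω)) atTop (𝓝 (F (g ω)))) :
    Integrable (fun ω => F (g ω)) P := by
  obtain ⟨Q, hQ⟩ := integral_abs_add_const_le hF hB hD h1 ht
  refine integrable_of_tendsto_of_integral_le (fun n => (hfn n).integrable) hlim
    (B := B + Q + Q) fun n => ?_
  have hA := admissible_add_const hF hB hD h1 ht ht (hfn n).mem
  have i1 : Integrable (fun ω => F (fn n ω) + |F (fn n ω + t)|) P :=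
    (hfn n).integrable.add hA.integrable.abs
  calc ∫ ω, |F (fn n ω)| ∂P ≤ ∫ ω, (F (fn n ω) + |F (fn n ω + t)| + |F (fn n ω + t)|) ∂P := by
        refine integral_mono_ae (hfn n).integrable.abs (i1.add hA.integrable.abs) ?_
        filter_upwards [(hfn n).pos] with ω h
        have h2 : F (fn n ω + t) ≤ F (fn n ω) :=
          hF.antitoneOn h (mem_Ioi.2 (by linarith)) (by linarith)
        have := neg_abs_le (F (fn n ω + t))
        have := abs_nonneg (F (fn n ω + t))
        exact abs_le.2 ⟨by linarith, by linarith⟩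
    _ = ∫ ω, F (fn n ω) ∂P + ∫ ω, |F (fn n ω + t)| ∂P + ∫ ω, |F (fn n ω + t)| ∂P := by
        rw [integral_add i1 hA.integrable.abs, integral_add (hfn n).integrable hA.integrable.abs]
    _ ≤ B + Q + Q := by linarith [hle n, hQ _ (hfn n).mem]

/-- If the losses `(F(g) - F(fₙ))⁺` do not become small in mean although they converge to zero
almost everywhere, then sums of the `fₙ` accumulate them. -/
theorem exists_accumulating_sum [IsProbabilityMeasure P] (hF : PowerLike F φ ζ c₁ c₂)
    (hB : BoundedProblem P F (polar P D)) (hD : ∀ h ∈ D, Measurable h) (ht : 0 < t)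
    {fn : ℕ → Ω → ℝ} (hfn : ∀ n, Admissible P F (polar P D) t (fn n))
    (hg : Integrable (fun ω => F (g ω)) P)
    (hlim : ∀ᵐ ω ∂P, Tendsto (fun n => F (fn n ω)) atTop (𝓝 (F (g ω)))) {α : ℝ} (hα : 0 < α)
    (hlow : ∀ᶠ n in atTop, α ≤ ∫ ω, max (F (g ω) - F (fn n ω)) 0 ∂P) (N : ℕ) :
    ∃ f, Admissible P F (polar P D) ((N + 1 : ℝ) * t) f ∧
      (N + 1 : ℝ) * (α / 2) ≤ ∫ ω, max (F (g ω) - F (f ω)) 0 ∂P := by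
  have hint : ∀ (s : ℝ) (f : Ω → ℝ), Admissible P F (polar P D) s f →
      Integrable (fun ω => max (F (g ω) - F (f ω)) 0) P := fun s f hf =>
    (hg.sub hf.integrable).pos_part
  induction N with
  | zero =>
    obtain ⟨n, hn⟩ := hlow.exists
    refine ⟨fn n, by simpa using hfn n, ?_⟩
    simp only [Nat.cast_zero, zero_add, one_mul]
    linarith
  | succ N ih =>
    obtain ⟨f, hf, hfl⟩ := ih
    set H : Ω → ℝ := fun ω => max (F (g ω) - F (f ω)) 0 with hH
    have hHi : Integrable H P := hint _ _ hf
    -- For a fixed accumulated loss `H`, the new losses tend to zero pointwise, so their overlap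
    -- with `H` vanishes in mean. Adding a late enough `fn n` then contributes at least `α / 2`,
    -- since the loss of a sum dominates the maximum of the two losses.
    have hmin : Tendsto (fun n => ∫ ω, min (H ω) (max (F (g ω) - F (fn n ω)) 0) ∂P) atTop
        (𝓝 (∫ _, (0:ℝ) ∂P)) := by
      refine tendsto_integral_of_dominated_convergence H
        (fun n => (hHi.inf (hint _ _ (hfn n))).aestronglyMeasurable) hHi ?_ ?_
      · refine fun n => Eventually.of_forall fun ω => ?_
        have e1 : 0 ≤ H ω := le_max_right _ _
        rw [Real.norm_eq_abs, abs_of_nonneg (le_min e1 (le_max_right _ _))]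
        exact min_le_left _ _
      · filter_upwards [hlim] with ω h
        have e1 : 0 ≤ H ω := le_max_right _ _
        have e2 : Tendsto (fun n => max (F (g ω) - F (fn n ω)) 0) atTop (𝓝 0) := by
          have := (h.const_sub (F (g ω))).max (tendsto_const_nhds (x := (0:ℝ)))
          simpa using this
        have := (tendsto_const_nhds (x := H ω)).min e2
        rwa [min_eq_right e1] at this
    rw [integral_zero] at hmin
    obtain ⟨n, hn1, hn2⟩ := ((hmin.eventually (gt_mem_nhds (half_pos hα))).and hlow).exists
    have hpos : ∀ᵐ ω ∂P, 0 < f ω + fn n ω := by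
      filter_upwards [hf.pos, (hfn n).pos] with ω a b using add_pos a b
    have hNt : (0:ℝ) < (N + 1 : ℝ) * t := by positivity
    have hmem := scaled_polar_add hD hNt ht hf.mem (hfn n).mem
    rw [show (N + 1 : ℝ) * t + t = ((N + 1 : ℕ) + 1 : ℝ) * t by push_cast; ring] at hmem
    have hA : Admissible P F (polar P D) (((N + 1 : ℕ) + 1 : ℝ) * t) (fun ω => f ω + fn n ω) := by
      refine hB.admissible (by positivity) hmem hpos hf.integrable ?_
      filter_upwards [hf.pos, (hfn n).pos] with ω a b
      exact hF.antitoneOn a (mem_Ioi.2 (by linarith)) (by linarith)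
    refine ⟨_, hA, ?_⟩
    have i1 : Integrable (fun ω => H ω + max (F (g ω) - F (fn n ω)) 0) P :=
      hHi.add (hint _ _ (hfn n))
    have i2 : Integrable (fun ω => min (H ω) (max (F (g ω) - F (fn n ω)) 0)) P :=
      hHi.inf (hint _ _ (hfn n))
    calc ((N + 1 : ℕ) + 1 : ℝ) * (α / 2)
        ≤ ∫ ω, H ω ∂P + ∫ ω, max (F (g ω) - F (fn n ω)) 0 ∂P
          - ∫ ω, min (H ω) (max (F (g ω) - F (fn n ω)) 0) ∂P := by
          push_cast
          linarith
      _ = ∫ ω, (H ω + max (F (g ω) - F (fn n ω)) 0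
          - min (H ω) (max (F (g ω) - F (fn n ω)) 0)) ∂P := by
          rw [integral_sub i1 i2, integral_add hHi (hint _ _ (hfn n))]
      _ ≤ ∫ ω, max (F (g ω) - F (f ω + fn n ω)) 0 ∂P := by
          refine integral_mono_ae (i1.sub i2) (hint _ _ hA) ?_
          filter_upwards [hf.pos, (hfn n).pos] with ω a b
          have e1 : F (f ω + fn n ω) ≤ F (f ω) :=
            hF.antitoneOn a (mem_Ioi.2 (by linarith)) (by linarith)
          have e2 : F (f ω + fn n ω) ≤ F (fn n ω) :=
            hF.antitoneOn b (mem_Ioi.2 (by linarith)) (by linarith)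
          have e3 := min_add_max (H ω) (max (F (g ω) - F (fn n ω)) 0)
          have e4 : max (H ω) (max (F (g ω) - F (fn n ω)) 0)
              ≤ max (F (g ω) - F (f ω + fn n ω)) 0 := by
            simp only [hH]
            refine max_le (max_le_max ?_ le_rfl) (max_le_max ?_ le_rfl) <;> linarith
          linarith

/-- This replaces uniform integrability. Otherwise `N + 1` units of capital `t` would produce a gain
of at least `(N + 1) α / 2`, whereas sublinear growth caps it by a constant plus `(N + 1) α / 4`. -/
theorem frequently_loss_lt [IsProbabilityMeasure P] (hF : PowerLike F φ ζ c₁ c₂)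
    (hB : BoundedProblem P F (polar P D)) (hD : ∀ h ∈ D, Measurable h)
    (h1 : (fun _ => (1:ℝ)) ∈ polar P D) (ht : 0 < t)
    {fn : ℕ → Ω → ℝ} (hfn : ∀ n, Admissible P F (polar P D) t (fn n))
    (hg : Integrable (fun ω => F (g ω)) P)
    (hlim : ∀ᵐ ω ∂P, Tendsto (fun n => F (fn n ω)) atTop (𝓝 (F (g ω)))) {α : ℝ} (hα : 0 < α) :
    ∃ᶠ n in atTop, ∫ ω, max (F (g ω) - F (fn n ω)) 0 ∂P < α := by
  by_contra hc
  simp only [not_frequently, not_lt] at hc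
  have hacc := exists_accumulating_sum hF hB hD ht hfn hg hlim hα hc
  obtain ⟨Q, hQ⟩ := integral_abs_add_const_le hF hB hD h1 ht
  obtain ⟨K, hK, hKz⟩ := hF.mul_slope_le
  have hQ0 : 0 ≤ Q := le_trans (integral_nonneg fun ω => abs_nonneg _) (hQ _ (hfn 0).mem)
  -- Chosen so that the linear part of the growth bound has slope `α / 4`, half the slope of the
  -- accumulated gain.
  set η : ℝ := α / (4 * (K * (1 + Q))) with hη
  have hη0 : 0 < η := by positivity
  obtain ⟨s, hs, hgrow⟩ := hF.sublinear_growth hη0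
  set A : ℝ := ∫ ω, |F (g ω)| ∂P with hA
  obtain ⟨N, hN⟩ := exists_nat_gt ((A + Q + K * (1 + Q) * s) / (α / 4))
  rw [div_lt_iff₀ (by positivity)] at hN
  obtain ⟨f, hf, hfl⟩ := hacc N
  have hl : (0:ℝ) < N + 1 := by positivity
  -- The average `f / (N + 1)` costs capital `t`; the shift by `t` gives access to the uniform `L¹`
  -- bound `Q`.
  set z : Ω → ℝ := fun ω => (N + 1 : ℝ)⁻¹ * f ω + t with hz
  have hzmem : (fun ω => (N + 1 : ℝ)⁻¹ * f ω) ∈ scaled t (polar P D) := by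
    have := scaled_smul ((N + 1 : ℝ)⁻¹) hf.mem
    rwa [inv_mul_cancel_left₀ hl.ne'] at this
  have hzA := admissible_add_const hF hB hD h1 ht ht hzmem
  have hzi : Integrable (fun ω => |F (z ω)|) P := hzA.integrable.abs
  have i1 : Integrable (fun ω => |F (g ω)| + |F (z ω)|) P := hg.abs.add hzi
  have i2 : Integrable (fun ω => K * (s + η * (N + 1)) * (1 + |F (z ω)|)) P :=
    ((integrable_const _).add hzi).const_mul _
  have i3 : Integrable (fun ω => |F (g ω)| + |F (z ω)|
      + K * (s + η * (N + 1)) * (1 + |F (z ω)|)) P := i1.add i2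
  have hkey : ∫ ω, max (F (g ω) - F (f ω)) 0 ∂P
      ≤ A + Q + K * (s + η * (N + 1)) * (1 + Q) := by
    calc ∫ ω, max (F (g ω) - F (f ω)) 0 ∂P
        ≤ ∫ ω, (|F (g ω)| + |F (z ω)| + K * (s + η * (N + 1)) * (1 + |F (z ω)|)) ∂P := by
          refine integral_mono_ae (hg.sub hf.integrable).pos_part i3 ?_
          filter_upwards [hf.pos] with ω h
          have hz0 : 0 < z ω := by simp only [hz]; positivity
          have e1 := hgrow (z ω) (N + 1) hz0 hl
          have e2 := hKz (z ω) hz0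
          have e3 : F ((N + 1) * z ω) ≤ F (f ω) := by
            have : f ω ≤ (N + 1) * z ω := by
              simp only [hz, mul_add, mul_inv_cancel_left₀ hl.ne']
              have : 0 < (N + 1 : ℝ) * t := by positivity
              linarith
            exact hF.antitoneOn h (mem_Ioi.2 (by positivity)) this
          have e4 : z ω * φ (z ω) * (s + η * (N + 1))
              ≤ K * (1 + |F (z ω)|) * (s + η * (N + 1)) :=
            mul_le_mul_of_nonneg_right e2 (by positivity)
          have := le_abs_self (F (g ω))
          have := neg_abs_le (F (z ω))
          refine max_le ?_ (by positivity)
          nlinarith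
      _ = A + ∫ ω, |F (z ω)| ∂P + K * (s + η * (N + 1)) * (1 + ∫ ω, |F (z ω)| ∂P) := by
          rw [integral_add i1 i2, integral_add hg.abs hzi, integral_const_mul,
            integral_add (integrable_const _) hzi]
          simp [hA]
      _ ≤ A + Q + K * (s + η * (N + 1)) * (1 + Q) := by
          have := hQ _ hzmem
          gcongr
  have e5 : K * (1 + Q) * η = α / 4 := by
    rw [hη]; field_simp
  have e6 : K * (s + η * (N + 1)) * (1 + Q) = K * (1 + Q) * s + (α / 4) * (N + 1) := by
    rw [← e5]; ring
  rw [e6] at hkey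
  have : (0:ℝ) ≤ N := Nat.cast_nonneg N
  nlinarith

theorem exists_minimizer [IsProbabilityMeasure P] (hF : PowerLike F φ ζ c₁ c₂)
    (hB : BoundedProblem P F (polar P D)) (hD : ∀ h ∈ D, Measurable h)
    (hbdd : BoundedInL0 P (polar P D)) (h1 : (fun _ => (1:ℝ)) ∈ polar P D) (ht : 0 < t) :
    ∃ g, Admissible P F (polar P D) t g ∧
      ∀ f, Admissible P F (polar P D) t f → ∫ ω, F (g ω) ∂P ≤ ∫ ω, F (f ω) ∂P := by
  set S : Set ℝ := (fun f : Ω → ℝ => ∫ ω, F (f ω) ∂P) '' {f | Admissible P F (polar P D) t f}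
    with hS
  have hSne : S.Nonempty := ⟨_, _, admissible_const h1 ht, rfl⟩
  obtain ⟨M, hM⟩ := hB.exists_lower ht
  have hSb : BddBelow S := ⟨-M, by rintro _ ⟨f, hf, rfl⟩; exact hM f hf⟩
  set m := sInf S with hm
  have hmle : ∀ f, Admissible P F (polar P D) t f → m ≤ ∫ ω, F (f ω) ∂P := fun f hf =>
    csInf_le hSb ⟨f, hf, rfl⟩
  -- The denominator starts at `2` so that `δ n` is strictly below `1` also for `n = 0`.
  set δ : ℕ → ℝ := fun n => 1 / ((n : ℝ) + 2) with hδ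
  have hδ0 : ∀ n, 0 < δ n := fun n => by positivity
  have hδ1 : ∀ n, δ n < 1 := fun n => by
    have : (0:ℝ) ≤ n := Nat.cast_nonneg n
    simp only [hδ]
    rw [div_lt_one (by positivity)]
    linarith
  have hδt : Tendsto δ atTop (𝓝 0) := by
    have := (tendsto_add_atTop_iff_nat 1).2 (tendsto_one_div_add_atTop_nhds_zero_nat (𝕜 := ℝ))
    refine this.congr fun n => ?_
    simp only [hδ]
    push_cast
    ring
  have hex : ∀ n, ∃ f, Admissible P F (polar P D) t f ∧ ∫ ω, F (f ω) ∂P ≤ m + δ n := by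
    intro n
    obtain ⟨_, ⟨f, hf, rfl⟩, hlt⟩ := exists_lt_of_csInf_lt hSne
      (show sInf S < m + δ n by linarith [hδ0 n])
    exact ⟨f, hf, hlt.le⟩
  choose fn hfn hfnle using hex
  obtain ⟨ns, hns, g, hgm, hlim⟩ := exists_subseq_tendsto_ae
    (fun n => measurable_of_mem_scaled (hfn n).mem)
    (cauchy_of_minimizing hF hB hD hbdd ht hmle hfn hδt hfnle)
  have hδt' : Tendsto (fun n => δ (ns n)) atTop (𝓝 0) := hδt.comp hns.tendsto_atTop
  have hgpos : ∀ᵐ ω ∂P, 0 < g ω :=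
    limit_pos_of_minimizing hF hB hD h1 ht hmle (fun n => hfn (ns n)) (fun n => hδ0 (ns n))
      (fun n => hδ1 (ns n)) hδt' (fun n => hfnle (ns n)) hlim
  have hFlim : ∀ᵐ ω ∂P, Tendsto (fun n => F (fn (ns n) ω)) atTop (𝓝 (F (g ω))) := by
    filter_upwards [hlim, hgpos] with ω h h0
    exact ((hF.hasDerivAt _ h0).continuousAt.tendsto).comp h
  have hgi : Integrable (fun ω => F (g ω)) P :=
    integrable_limit hF hB hD h1 ht (B := m + 1) (fun n => hfn (ns n))
      (fun n => (hfnle (ns n)).trans (by linarith [hδ1 (ns n)])) hFlim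
  have hgA : Admissible P F (polar P D) t g :=
    ⟨scaled_polar_closed hD ht (fun n => (hfn (ns n)).mem) hgm hlim, hgpos, hgi⟩
  refine ⟨g, hgA, fun f hf => le_trans ?_ (hmle f hf)⟩
  refine le_of_forall_pos_le_add fun α hα => ?_
  have hfr := frequently_loss_lt hF hB hD h1 ht (fun n => hfn (ns n)) hgi hFlim (half_pos hα)
  obtain ⟨n, hn1, hn2⟩ := (hfr.and_eventually
    (hδt'.eventually (gt_mem_nhds (half_pos hα)))).exists
  have hi := (hfn (ns n)).integrable
  have hp : Integrable (fun ω => max (F (g ω) - F (fn (ns n) ω)) 0) P := (hgi.sub hi).pos_part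
  calc ∫ ω, F (g ω) ∂P
      ≤ ∫ ω, (F (fn (ns n) ω) + max (F (g ω) - F (fn (ns n) ω)) 0) ∂P := by
        refine integral_mono hgi (hi.add hp) fun ω => ?_
        have := le_max_left (F (g ω) - F (fn (ns n) ω)) 0
        simp only
        linarith
    _ = ∫ ω, F (fn (ns n) ω) ∂P + ∫ ω, max (F (g ω) - F (fn (ns n) ω)) 0 ∂P :=
        integral_add hi hp
    _ ≤ m + α := by linarith [hfnle (ns n)]

/-- Vary the minimizer towards `f`: by convexity `E[φ(fd) f] ≤ E[φ(fd) g]` along the segment. As the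
step tends to zero, Fatou's lemma handles the left side and dominated convergence the right. -/
theorem exists_isOpt [IsProbabilityMeasure P] (hF : PowerLike F φ ζ c₁ c₂)
    (hB : BoundedProblem P F (polar P D)) (hD : ∀ h ∈ D, Measurable h)
    (hbdd : BoundedInL0 P (polar P D)) (h1 : (fun _ => (1:ℝ)) ∈ polar P D) (ht : 0 < t) :
    ∃ g y, 0 < y ∧ IsOpt P F φ (polar P D) t y g := by
  obtain ⟨g, hg, hmin⟩ := exists_minimizer hF hB hD hbdd h1 ht
  have hgm := measurable_of_mem_scaled hg.mem
  have hφm : ∀ f : Ω → ℝ, Measurable f → (∀ᵐ ω ∂P, 0 < f ω) →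
      AEStronglyMeasurable (fun ω => φ (f ω)) P := fun f hf hf0 =>
    aestronglyMeasurable_comp_of_continuousOn hF.continuousOn_slope hf hf0
  have hgφ : Integrable (fun ω => g ω * φ (g ω)) P := by
    obtain ⟨K, hK, hKz⟩ := hF.mul_slope_le
    refine (((integrable_const (1:ℝ)).add hg.integrable.abs).const_mul K).mono'
      (hgm.aestronglyMeasurable.mul (hφm g hgm hg.pos)) ?_
    filter_upwards [hg.pos] with ω h
    have := hF.pos _ h
    rw [Real.norm_eq_abs, abs_of_pos (by positivity)]
    exact hKz _ h
  set y := (∫ ω, g ω * φ (g ω) ∂P) / t with hy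
  have hint0 : 0 < ∫ ω, g ω * φ (g ω) ∂P := by
    rw [integral_pos_iff_support_of_nonneg_ae ?_ hgφ]
    · have : (Function.support fun ω => g ω * φ (g ω)) =ᵐ[P] (univ : Set Ω) := by
        filter_upwards [hg.pos] with ω h
        have := hF.pos _ h
        exact propext ⟨fun _ => trivial, fun _ => (by positivity : g ω * φ (g ω) ≠ 0)⟩
      rw [measure_congr this, measure_univ]
      exact one_pos
    · filter_upwards [hg.pos] with ω h
      have := hF.pos _ h
      simp only [Pi.zero_apply]
      positivity
  have hty : ∫ ω, g ω * φ (g ω) ∂P = t * y := by rw [hy]; field_simp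
  refine ⟨g, y, div_pos hint0 ht, hg.mem, hg.pos, hg.integrable, hgφ, hty, fun f hf => ?_⟩
  have hfm := measurable_of_mem_scaled hf
  have hf0 := nonneg_of_mem_scaled ht hf
  set δ : ℕ → ℝ := fun n => 1 / ((n : ℝ) + 2) with hδ
  have hδ0 : ∀ n, 0 < δ n := fun n => by positivity
  have hδ1 : ∀ n, δ n ≤ 1 / 2 := fun n => by
    have : (0:ℝ) ≤ n := Nat.cast_nonneg n
    simp only [hδ]
    gcongr
    linarith
  have hδt : Tendsto δ atTop (𝓝 0) := by
    have := (tendsto_add_atTop_iff_nat 1).2 (tendsto_one_div_add_atTop_nhds_zero_nat (𝕜 := ℝ))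
    refine this.congr fun n => ?_
    simp only [hδ]
    push_cast
    ring
  set fd : ℕ → Ω → ℝ := fun n ω => (1 - δ n) * g ω + δ n * f ω with hfd
  -- Steps of at most `1/2` keep the perturbation above `g / 2`, where `F` and `φ` are controlled by
  -- their values at `g`.
  have hfdge : ∀ n, ∀ᵐ ω ∂P, g ω / 2 ≤ fd n ω := fun n => by
    filter_upwards [hf0, hg.pos] with ω a b
    have := hδ0 n
    have := hδ1 n
    simp only [hfd]
    have : 0 ≤ δ n * f ω := by positivity
    nlinarith
  have hfdpos : ∀ n, ∀ᵐ ω ∂P, 0 < fd n ω := fun n => by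
    filter_upwards [hfdge n, hg.pos] with ω a b
    linarith
  have hfdA : ∀ n, Admissible P F (polar P D) t (fd n) := fun n => by
    refine hB.admissible ht (scaled_polar_convex hD ht hg.mem hf (hδ0 n)
      (lt_of_le_of_lt (hδ1 n) (by norm_num))) (hfdpos n)
      (hg.integrable.add (hgφ.const_mul (2 ^ c₂))) ?_
    filter_upwards [hfdge n, hg.pos] with ω a b
    exact (hF.antitoneOn (mem_Ioi.2 (half_pos b)) (mem_Ioi.2 (by linarith)) a).trans
      (hF.half_bound b)
  have hdom : ∀ n, ∀ᵐ ω ∂P, φ (fd n ω) * g ω ≤ 2 ^ c₂ * (g ω * φ (g ω)) := fun n => by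
    filter_upwards [hfdge n, hg.pos] with ω a b
    have e1 : φ (fd n ω) ≤ φ (g ω / 2) := hF.slope_strictAntiOn.antitoneOn
      (mem_Ioi.2 (half_pos b)) (mem_Ioi.2 (by linarith)) a
    have e2 := hF.slope_le_mul one_le_two (half_pos b)
    rw [mul_div_cancel₀ _ (two_ne_zero)] at e2
    nlinarith
  have hφfd : ∀ n, AEStronglyMeasurable (fun ω => φ (fd n ω)) P := fun n =>
    hφm _ (measurable_of_mem_scaled (hfdA n).mem) (hfdpos n)
  have hnorm : ∀ n, ∀ᵐ ω ∂P, ‖φ (fd n ω) * g ω‖ ≤ 2 ^ c₂ * (g ω * φ (g ω)) := fun n => by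
    filter_upwards [hdom n, hfdpos n, hg.pos] with ω a b c
    have := hF.pos _ b
    rwa [Real.norm_eq_abs, abs_of_pos (by positivity)]
  have hφgi : ∀ n, Integrable (fun ω => φ (fd n ω) * g ω) P := fun n =>
    (hgφ.const_mul (2 ^ c₂)).mono' ((hφfd n).mul hgm.aestronglyMeasurable) (hnorm n)
  have hineq : ∀ n, ∫⁻ ω, ENNReal.ofReal (φ (fd n ω) * f ω) ∂P
      ≤ ENNReal.ofReal (∫ ω, φ (fd n ω) * g ω ∂P) := by
    intro n
    have hd := hδ0 n
    set r : Ω → ℝ := fun ω => (δ n)⁻¹ * (F (g ω) - F (fd n ω)) + φ (fd n ω) * g ω with hr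
    have i1 : Integrable (fun ω => (δ n)⁻¹ * (F (g ω) - F (fd n ω))) P :=
      (hg.integrable.sub (hfdA n).integrable).const_mul _
    have hri : Integrable r P := i1.add (hφgi n)
    have hpt : ∀ᵐ ω ∂P, φ (fd n ω) * f ω ≤ r ω ∧ 0 ≤ r ω := by
      filter_upwards [hf0, hg.pos, hfdpos n] with ω a b c
      have e1 := hF.tangent_le c b
      have e2 : g ω - fd n ω = δ n * (g ω - f ω) := by simp only [hfd]; ring
      rw [e2] at e1
      have e3 : φ (fd n ω) * (f ω - g ω) ≤ (δ n)⁻¹ * (F (g ω) - F (fd n ω)) := by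
        rw [inv_mul_eq_div, le_div_iff₀ hd]
        linarith
      have e4 : φ (fd n ω) * f ω ≤ r ω := by simp only [hr]; linarith
      exact ⟨e4, le_trans (mul_nonneg (hF.pos _ c).le a) e4⟩
    calc ∫⁻ ω, ENNReal.ofReal (φ (fd n ω) * f ω) ∂P
        ≤ ∫⁻ ω, ENNReal.ofReal (r ω) ∂P := lintegral_mono_ae (by
          filter_upwards [hpt] with ω h using ENNReal.ofReal_le_ofReal h.1)
      _ = ENNReal.ofReal (∫ ω, r ω ∂P) := (ofReal_integral_eq_lintegral_ofReal hri
          (hpt.mono fun ω h => h.2)).symm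
      _ ≤ _ := by
          refine ENNReal.ofReal_le_ofReal ?_
          rw [hr, integral_add i1 (hφgi n), integral_const_mul,
            integral_sub hg.integrable (hfdA n).integrable]
          have := hmin _ (hfdA n)
          have : (δ n)⁻¹ * (∫ ω, F (g ω) ∂P - ∫ ω, F (fd n ω) ∂P) ≤ 0 :=
            mul_nonpos_of_nonneg_of_nonpos (inv_pos.2 hd).le (by linarith)
          linarith
  have hfdlim : ∀ᵐ ω ∂P, Tendsto (fun n => φ (fd n ω)) atTop (𝓝 (φ (g ω))) := by
    filter_upwards [hg.pos] with ω h
    have : Tendsto (fun n => fd n ω) atTop (𝓝 (g ω)) := by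
      have := (((tendsto_const_nhds (x := (1:ℝ))).sub hδt).mul_const (g ω)).add
        (hδt.mul_const (f ω))
      simpa using this
    exact (hF.hasDerivAt_slope _ h).continuousAt.tendsto.comp this
  have hlimg : Tendsto (fun n => ∫ ω, φ (fd n ω) * g ω ∂P) atTop (𝓝 (∫ ω, φ (g ω) * g ω ∂P)) := by
    refine tendsto_integral_of_dominated_convergence _ (fun n => (hφgi n).aestronglyMeasurable)
      (hgφ.const_mul (2 ^ c₂)) hnorm ?_
    filter_upwards [hfdlim] with ω h using h.mul_const _
  have hfin : ∫⁻ ω, ENNReal.ofReal (φ (g ω) * f ω) ∂P ≤ ENNReal.ofReal (t * y) := by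
    calc ∫⁻ ω, ENNReal.ofReal (φ (g ω) * f ω) ∂P
        = ∫⁻ ω, liminf (fun n => ENNReal.ofReal (φ (fd n ω) * f ω)) atTop ∂P := by
          refine lintegral_congr_ae ?_
          filter_upwards [hfdlim] with ω h
          exact (ENNReal.tendsto_ofReal (h.mul_const (f ω))).liminf_eq.symm
      _ ≤ liminf (fun n => ∫⁻ ω, ENNReal.ofReal (φ (fd n ω) * f ω) ∂P) atTop :=
          lintegral_liminf_le' fun n =>
            ((hφfd n).aemeasurable.mul hfm.aemeasurable).ennreal_ofReal
      _ ≤ liminf (fun n => ENNReal.ofReal (∫ ω, φ (fd n ω) * g ω ∂P)) atTop :=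
          liminf_le_liminf (Eventually.of_forall hineq)
      _ = ENNReal.ofReal (∫ ω, φ (g ω) * g ω ∂P) := (ENNReal.tendsto_ofReal hlimg).liminf_eq
      _ = ENNReal.ofReal (t * y) := by
          rw [← hty]
          congr 2
          ext ω
          ring
  have hfφ0 : 0 ≤ᵐ[P] fun ω => f ω * φ (g ω) := by
    filter_upwards [hf0, hg.pos] with ω a b
    exact mul_nonneg a (hF.pos _ b).le
  have hmeas : AEStronglyMeasurable (fun ω => f ω * φ (g ω)) P :=
    hfm.aestronglyMeasurable.mul (hφm g hgm hg.pos)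
  simp only [mul_comm (φ _)] at hfin
  have hfi : Integrable (fun ω => f ω * φ (g ω)) P :=
    (lintegral_ofReal_ne_top_iff_integrable hmeas hfφ0).1
      (ne_top_of_le_ne_top ENNReal.ofReal_ne_top hfin)
  refine ⟨hfi, ?_⟩
  rw [← ofReal_integral_eq_lintegral_ofReal hfi hfφ0] at hfin
  exact (ENNReal.ofReal_le_ofReal_iff (by rw [← hty]; exact hint0.le)).1 hfin

end Existence

/-! ### Expectations of extended real random variables -/

section ExtExp

variable {Ω : Type*} [MeasurableSpace Ω] {P : Measure Ω} {f f' : Ω → EReal} {r : Ω → ℝ}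

theorem extExp_congr (h : f =ᵐ[P] f') : extExp P f = extExp P f' := by
  unfold extExp
  congr 2
  · exact lintegral_congr_ae (h.mono fun ω e => by simp only [e])
  · exact lintegral_congr_ae (h.mono fun ω e => by simp only [e])

theorem extExp_mono (h : ∀ᵐ ω ∂P, f ω ≤ f' ω) : extExp P f ≤ extExp P f' := by
  refine EReal.sub_le_sub ?_ ?_
  · exact EReal.coe_ennreal_le_coe_ennreal_iff.2 (lintegral_mono_ae
      (h.mono fun ω e => EReal.toENNReal_le_toENNReal e))
  · exact EReal.coe_ennreal_le_coe_ennreal_iff.2 (lintegral_mono_ae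
      (h.mono fun ω e => EReal.toENNReal_le_toENNReal (EReal.neg_le_neg_iff.2 e)))

theorem extExp_coe_eq (r : Ω → ℝ) : extExp P (fun ω => (r ω : EReal))
    = ((∫⁻ ω, ENNReal.ofReal (r ω) ∂P : ℝ≥0∞) : EReal)
      - ((∫⁻ ω, ENNReal.ofReal (-r ω) ∂P : ℝ≥0∞) : EReal) := rfl

theorem lintegral_ofReal_ne_top (hr : Integrable r P) :
    ∫⁻ ω, ENNReal.ofReal (r ω) ∂P ≠ ∞ :=
  ne_top_of_le_ne_top hr.2.ne (lintegral_mono fun ω => by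
    rw [← ofReal_norm]; exact ENNReal.ofReal_le_ofReal (le_abs_self _))

theorem extExp_coe (hr : Integrable r P) :
    extExp P (fun ω => (r ω : EReal)) = ((∫ ω, r ω ∂P : ℝ) : EReal) := by
  rw [extExp_coe_eq, integral_eq_lintegral_pos_part_sub_lintegral_neg_part hr, EReal.coe_sub,
    EReal.coe_ennreal_toReal (lintegral_ofReal_ne_top hr),
    EReal.coe_ennreal_toReal
      (show ∫⁻ ω, ENNReal.ofReal (-r ω) ∂P ≠ ∞ from lintegral_ofReal_ne_top hr.neg)]

theorem extExp_le_integral (hr : Integrable r P) (h : ∀ᵐ ω ∂P, f ω ≤ (r ω : EReal)) :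
    extExp P f ≤ ((∫ ω, r ω ∂P : ℝ) : EReal) := by
  rw [← extExp_coe hr]; exact extExp_mono h

theorem integral_le_extExp (hr : Integrable r P) (h : ∀ᵐ ω ∂P, (r ω : EReal) ≤ f ω) :
    ((∫ ω, r ω ∂P : ℝ) : EReal) ≤ extExp P f := by
  rw [← extExp_coe hr]; exact extExp_mono h

theorem integrable_of_extExp_lt_top (hm : AEStronglyMeasurable r P) {s : Ω → ℝ}
    (hs : Integrable s P) (hle : ∀ᵐ ω ∂P, s ω ≤ r ω)
    (h : extExp P (fun ω => (r ω : EReal)) < ⊤) : Integrable r P := by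
  have hneg : ∫⁻ ω, ENNReal.ofReal (-r ω) ∂P ≠ ∞ := by
    refine ne_top_of_le_ne_top (lintegral_ofReal_ne_top hs.neg) (lintegral_mono_ae ?_)
    filter_upwards [hle] with ω h
    exact ENNReal.ofReal_le_ofReal (neg_le_neg h)
  have hpos : ∫⁻ ω, ENNReal.ofReal (r ω) ∂P ≠ ∞ := by
    intro hc
    rw [extExp_coe_eq, hc, ← ENNReal.ofReal_toReal hneg] at h
    rw [EReal.coe_ennreal_ofReal] at h
    simp only [EReal.coe_ennreal_top, EReal.top_sub_coe, lt_self_iff_false] at h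
  refine ⟨hm, ?_⟩
  calc ∫⁻ ω, ‖r ω‖ₑ ∂P
      ≤ ∫⁻ ω, (ENNReal.ofReal (r ω) + ENNReal.ofReal (-r ω)) ∂P := by
        refine lintegral_mono fun ω => ?_
        rw [← ofReal_norm, Real.norm_eq_abs]
        rcases le_total 0 (r ω) with h0 | h0
        · rw [abs_of_nonneg h0]; exact le_self_add
        · rw [abs_of_nonpos h0]; exact le_add_self
    _ = ∫⁻ ω, ENNReal.ofReal (r ω) ∂P + ∫⁻ ω, ENNReal.ofReal (-r ω) ∂P :=
        lintegral_add_left' hm.aemeasurable.ennreal_ofReal _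
    _ < ∞ := ENNReal.add_lt_top.2 ⟨hpos.lt_top, hneg.lt_top⟩

theorem EReal.eq_of_toENNReal_eq {a b : EReal} (h1 : a.toENNReal = b.toENNReal)
    (h2 : (-a).toENNReal = (-b).toENNReal) : a = b := by
  rcases le_total 0 a with ha | ha
  · rcases le_total 0 b with hb | hb
    · exact (EReal.toENNReal_eq_toENNReal ha hb).1 h1
    · rw [EReal.toENNReal_of_nonpos hb, EReal.toENNReal_eq_zero_iff] at h1
      rw [EReal.toENNReal_of_nonpos (EReal.neg_le_zero.2 ha), eq_comm,
        EReal.toENNReal_eq_zero_iff, EReal.neg_le_zero] at h2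
      rw [le_antisymm h1 ha, le_antisymm hb h2]
  · rcases le_total 0 b with hb | hb
    · rw [EReal.toENNReal_of_nonpos ha, eq_comm, EReal.toENNReal_eq_zero_iff] at h1
      rw [EReal.toENNReal_of_nonpos (x := -b) (EReal.neg_le_zero.2 hb),
        EReal.toENNReal_eq_zero_iff, EReal.neg_le_zero] at h2
      rw [le_antisymm ha h2, le_antisymm h1 hb]
    · have := (EReal.toENNReal_eq_toENNReal (EReal.neg_nonneg.2 ha) (EReal.neg_nonneg.2 hb)).1 h2
      exact neg_injective this

/-- The two inequalities push the differences in the same direction, so equal differences force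
equality of both terms. Applied to positive and negative parts it settles the equality case of
monotonicity. -/
theorem EReal.eq_of_ennreal_sub_eq {a b a' b' : ℝ≥0∞} (ha' : a' ≠ ∞) (hb' : b' ≠ ∞)
    (haa : a ≤ a') (hbb : b' ≤ b) (h : (a : EReal) - b = (a' : EReal) - b') :
    a = a' ∧ b = b' := by
  have ha := ne_top_of_le_ne_top ha' haa
  rw [← EReal.coe_ennreal_toReal ha, ← EReal.coe_ennreal_toReal ha',
    ← EReal.coe_ennreal_toReal hb', ← EReal.coe_sub a'.toReal] at h
  have hb : b ≠ ∞ := by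
    rintro rfl
    rw [EReal.coe_ennreal_top, EReal.sub_top] at h
    exact EReal.bot_ne_coe _ h
  rw [← EReal.coe_ennreal_toReal hb, ← EReal.coe_sub, EReal.coe_eq_coe_iff] at h
  have h1 := ENNReal.toReal_mono ha' haa
  have h2 := ENNReal.toReal_mono hb hbb
  exact ⟨(ENNReal.toReal_eq_toReal_iff' ha ha').1 (by linarith),
    (ENNReal.toReal_eq_toReal_iff' hb hb').1 (by linarith)⟩

theorem ae_eq_of_le_of_extExp_eq (hf : AEMeasurable f P) (hr : Integrable r P)
    (h : ∀ᵐ ω ∂P, f ω ≤ (r ω : EReal)) (he : extExp P f = ((∫ ω, r ω ∂P : ℝ) : EReal)) :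
    f =ᵐ[P] fun ω => (r ω : EReal) := by
  rw [← extExp_coe hr, extExp_coe_eq] at he
  have h1 : ∀ᵐ ω ∂P, (f ω).toENNReal ≤ ENNReal.ofReal (r ω) :=
    h.mono fun ω e => EReal.toENNReal_le_toENNReal e
  have h2 : ∀ᵐ ω ∂P, ENNReal.ofReal (-r ω) ≤ (-f ω).toENNReal :=
    h.mono fun ω e => EReal.toENNReal_le_toENNReal (EReal.neg_le_neg_iff.2 e)
  have f1 := lintegral_ofReal_ne_top hr
  have f2 : ∫⁻ ω, ENNReal.ofReal (-r ω) ∂P ≠ ∞ := lintegral_ofReal_ne_top hr.neg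
  obtain ⟨e1, e2⟩ := EReal.eq_of_ennreal_sub_eq f1 f2 (lintegral_mono_ae h1)
    (lintegral_mono_ae h2) he
  have g1 := ae_eq_of_ae_le_of_lintegral_le h1 (by rw [e1]; exact f1)
    hr.aemeasurable.ennreal_ofReal e1.ge
  have g2 := ae_eq_of_ae_le_of_lintegral_le h2 f2
    (measurable_neg.comp_aemeasurable hf).ereal_toENNReal e2.le
  filter_upwards [g1, g2] with ω a b
  exact EReal.eq_of_toENNReal_eq a b.symm

theorem ae_eq_of_ge_of_extExp_eq (hf : AEMeasurable f P) (hr : Integrable r P)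
    (h : ∀ᵐ ω ∂P, (r ω : EReal) ≤ f ω) (he : extExp P f = ((∫ ω, r ω ∂P : ℝ) : EReal)) :
    f =ᵐ[P] fun ω => (r ω : EReal) := by
  rw [← extExp_coe hr, extExp_coe_eq] at he
  have h1 : ∀ᵐ ω ∂P, ENNReal.ofReal (r ω) ≤ (f ω).toENNReal :=
    h.mono fun ω e => EReal.toENNReal_le_toENNReal e
  have h2 : ∀ᵐ ω ∂P, (-f ω).toENNReal ≤ ENNReal.ofReal (-r ω) :=
    h.mono fun ω e => EReal.toENNReal_le_toENNReal (EReal.neg_le_neg_iff.2 e)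
  have f1 := lintegral_ofReal_ne_top hr
  have f2 : ∫⁻ ω, ENNReal.ofReal (-r ω) ∂P ≠ ∞ := lintegral_ofReal_ne_top hr.neg
  have f3 := ne_top_of_le_ne_top f2 (lintegral_mono_ae h2)
  have f4 : ∫⁻ ω, (f ω).toENNReal ∂P ≠ ∞ := by
    intro hc
    rw [extExp, hc, ← EReal.coe_ennreal_toReal f3, ← EReal.coe_ennreal_toReal f1,
      ← EReal.coe_ennreal_toReal f2, EReal.coe_ennreal_top, EReal.top_sub_coe,
      ← EReal.coe_sub] at he
    exact EReal.coe_ne_top _ he.symm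
  obtain ⟨e1, e2⟩ := EReal.eq_of_ennreal_sub_eq f4 f3 (lintegral_mono_ae h1)
    (lintegral_mono_ae h2) he.symm
  have g1 := ae_eq_of_ae_le_of_lintegral_le h1 f1 hf.ereal_toENNReal e1.ge
  have g2 := ae_eq_of_ae_le_of_lintegral_le h2 f3 hr.aemeasurable.neg.ennreal_ofReal e2.le
  filter_upwards [g1, g2] with ω a b
  exact EReal.eq_of_toENNReal_eq a.symm b

end ExtExp

/-! ### Multipliers and the derivative of the value function -/

section Optimality

variable {Ω : Type*} [MeasurableSpace Ω] {P : Measure Ω} {K : Set (Ω → ℝ)}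
  {F φ ζ : ℝ → ℝ} {c₁ c₂ s t t' y : ℝ} {f g g' : Ω → ℝ}

theorem scaled_rescale (ht' : 0 < t') (hf : f ∈ scaled t' K) :
    (fun ω => t / t' * f ω) ∈ scaled t K := by
  have := scaled_smul (t / t') hf
  rwa [div_mul_cancel₀ _ ht'.ne'] at this

theorem IsOpt.scaled_le (h : IsOpt P F φ K t y g) (ht : 0 < t) (ht' : 0 < t')
    (hf : f ∈ scaled t' K) :
    Integrable (fun ω => f ω * φ (g ω)) P ∧ ∫ ω, f ω * φ (g ω) ∂P ≤ t' * y := by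
  obtain ⟨h1, h2⟩ := h.le _ (scaled_rescale (t := t) ht' hf)
  have hc : 0 < t / t' := div_pos ht ht'
  simp only [mul_assoc] at h1 h2
  rw [integral_const_mul] at h2
  refine ⟨?_, ?_⟩
  · exact (integrable_const_mul_iff (isUnit_iff_ne_zero.2 hc.ne') _).1 h1
  · rw [div_mul_eq_mul_div, div_le_iff₀ ht'] at h2
    have : t * (∫ ω, f ω * φ (g ω) ∂P) ≤ t * (t' * y) := by linarith
    exact le_of_mul_le_mul_left this ht

/-- Tangent inequality at `g` integrated against the multiplier inequality. It is both sufficiency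
of the first-order conditions (`t' = t`) and the subgradient inequality for the value function. -/
theorem IsOpt.integral_le (hF : PowerLike F φ ζ c₁ c₂) (h : IsOpt P F φ K t y g) (ht : 0 < t)
    (ht' : 0 < t') (hf : f ∈ scaled t' K) (hpos : ∀ᵐ ω ∂P, 0 < f ω)
    (hfi : Integrable (fun ω => F (f ω)) P) :
    ∫ ω, F (g ω) ∂P - y * (t' - t) ≤ ∫ ω, F (f ω) ∂P := by
  obtain ⟨h1, h2⟩ := h.scaled_le ht ht' hf
  have i1 : Integrable (fun ω => F (g ω) + g ω * φ (g ω)) P := h.integrable.add h.integrable_mul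
  have h3 : ∫ ω, (F (g ω) + g ω * φ (g ω) - f ω * φ (g ω)) ∂P ≤ ∫ ω, F (f ω) ∂P := by
    refine integral_mono_ae (i1.sub h1) hfi ?_
    filter_upwards [h.pos, hpos] with ω a b
    have := hF.tangent_le a b
    linarith
  rw [integral_sub i1 h1, integral_add h.integrable h.integrable_mul, h.integral_mul] at h3
  nlinarith

theorem IsOpt.congr (h : IsOpt P F φ K t y g) (hg' : g' ∈ scaled t K) (he : g =ᵐ[P] g') :
    IsOpt P F φ K t y g' where
  mem := hg'
  pos := by filter_upwards [h.pos, he] with ω a b; rwa [← b]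
  integrable := h.integrable.congr (he.mono fun ω e => by simp only [e])
  integrable_mul := h.integrable_mul.congr (he.mono fun ω e => by simp only [e])
  integral_mul := by
    rw [← h.integral_mul]
    exact integral_congr_ae (he.mono fun ω e => by simp only [e])
  le f hf := by
    obtain ⟨h1, h2⟩ := h.le f hf
    refine ⟨h1.congr (he.mono fun ω e => by simp only [e]), le_trans (le_of_eq ?_) h2⟩
    exact integral_congr_ae (he.mono fun ω e => by simp only [e])

theorem mul_one_add_mem_scaled (s : ℝ) (hg : g ∈ scaled t K) :
    (fun ω => g ω * (1 + s)) ∈ scaled (t * (1 + s)) K := by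
  have := scaled_smul (1 + s) hg
  rw [mul_comm (1 + s) t] at this
  simpa only [mul_comm (1 + s)] using this

theorem IsOpt.integrable_scale (hF : PowerLike F φ ζ c₁ c₂) (h : IsOpt P F φ K t y g)
    (hgm : Measurable g) {γ : Ω → ℝ} (hγm : Measurable γ) (hγ : ∀ᵐ ω ∂P, |γ ω| ≤ 1 / 2) :
    Integrable (fun ω => F (g ω * (1 + γ ω)) - F (g ω) + φ (g ω) * (g ω * γ ω)) P ∧
    Integrable (fun ω => F (g ω * (1 + γ ω))) P := by
  have hC := hF.c₂_pos
  have hpos : ∀ᵐ ω ∂P, 0 < g ω * (1 + γ ω) := by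
    filter_upwards [h.pos, hγ] with ω a b
    have := (abs_le.1 b).1
    exact mul_pos a (by linarith)
  have m1 := aestronglyMeasurable_comp_of_continuousOn hF.continuousOn
    (hgm.mul (hγm.const_add 1)) hpos
  have m2 := aestronglyMeasurable_comp_of_continuousOn hF.continuousOn_slope hgm h.pos
  have i2 : Integrable (fun ω => φ (g ω) * (g ω * γ ω)) P := by
    refine h.integrable_mul.norm.mono' (m2.mul (hgm.mul hγm).aestronglyMeasurable) ?_
    filter_upwards [hγ] with ω b
    rw [show φ (g ω) * (g ω * γ ω) = g ω * φ (g ω) * γ ω by ring, norm_mul]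
    exact mul_le_of_le_one_right (norm_nonneg _) (b.trans (by norm_num))
  have i1 : Integrable (fun ω => F (g ω * (1 + γ ω)) - F (g ω) + φ (g ω) * (g ω * γ ω)) P := by
    refine (h.integrable_mul.const_mul (c₂ * 2 ^ c₂ * 2)).mono'
      ((m1.sub h.integrable.aestronglyMeasurable).add i2.aestronglyMeasurable) ?_
    filter_upwards [h.pos, hγ] with ω a b
    refine (hF.second_order_bound a b).trans ?_
    have hφ := hF.pos _ a
    have : γ ω ^ 2 ≤ 1 := by
      rw [← sq_abs]
      exact pow_le_one₀ (abs_nonneg _) (b.trans (by norm_num))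
    exact mul_le_of_le_one_right (by positivity) this
  refine ⟨i1, ?_⟩
  refine ((i1.add h.integrable).sub i2).congr (Eventually.of_forall fun ω => ?_)
  simp only [Pi.add_apply, Pi.sub_apply]
  ring

/-- `w` is the value function of the problems of minimizing `E[F(f)]` over `f ∈ t K`. -/
def IsValueFn (P : Measure Ω) (F φ : ℝ → ℝ) (K : Set (Ω → ℝ)) (w : ℝ → ℝ) : Prop :=
  ∀ t : ℝ, 0 < t → ∃ y g, 0 < y ∧ Measurable g ∧ IsOpt P F φ K t y g ∧ w t = ∫ ω, F (g ω) ∂P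

variable {w : ℝ → ℝ}

theorem IsValueFn.le (hw : IsValueFn P F φ K w) (hF : PowerLike F φ ζ c₁ c₂) (ht : 0 < t)
    (hf : f ∈ scaled t K) (hpos : ∀ᵐ ω ∂P, 0 < f ω) (hfi : Integrable (fun ω => F (f ω)) P) :
    w t ≤ ∫ ω, F (f ω) ∂P := by
  obtain ⟨y, g, -, -, hg, e⟩ := hw t ht
  have := hg.integral_le hF ht ht hf hpos hfi
  rw [sub_self, mul_zero, sub_zero] at this
  rwa [e]

theorem IsValueFn.eq (hw : IsValueFn P F φ K w) (hF : PowerLike F φ ζ c₁ c₂) (ht : 0 < t)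
    (hg : IsOpt P F φ K t y g) : w t = ∫ ω, F (g ω) ∂P := by
  refine le_antisymm (hw.le hF ht hg.mem hg.pos hg.integrable) ?_
  obtain ⟨y', g', -, -, hg', e⟩ := hw t ht
  have := hg.integral_le hF ht ht hg'.mem hg'.pos hg'.integrable
  rw [sub_self, mul_zero, sub_zero] at this
  rwa [e]

theorem IsValueFn.tangent_le (hw : IsValueFn P F φ K w) (hF : PowerLike F φ ζ c₁ c₂) (ht : 0 < t)
    (ht' : 0 < t') (hg : IsOpt P F φ K t y g) : w t - y * (t' - t) ≤ w t' := by
  obtain ⟨y', g', -, -, hg', e⟩ := hw t' ht'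
  rw [e, hw.eq hF ht hg]
  exact hg.integral_le hF ht ht' hg'.mem hg'.pos hg'.integrable

/-- The tangent line lies below the value function, and the multiple `g (1 + ε / t)` shows that it
is exceeded by at most a constant times `ε²`. -/
theorem IsValueFn.hasDerivAt [IsFiniteMeasure P] (hw : IsValueFn P F φ K w)
    (hF : PowerLike F φ ζ c₁ c₂) (ht : 0 < t) (hgm : Measurable g) (hg : IsOpt P F φ K t y g) :
    HasDerivAt w (-y) t := by
  have hC := hF.c₂_pos
  set M := c₂ * 2 ^ c₂ * 2 * (t * y) / t ^ 2 with hM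
  have hup : ∀ ε : ℝ, |ε| ≤ t / 2 → w (t + ε) - w t + y * ε ≤ M * ε ^ 2 := by
    intro ε hε
    obtain ⟨hε1, hε2⟩ := abs_le.1 hε
    set s := ε / t with hs
    have hts : t * (1 + s) = t + ε := by rw [hs]; field_simp
    have hs2 : |s| ≤ 1 / 2 := by
      rw [hs, abs_div, abs_of_pos ht, div_le_iff₀ ht]; linarith
    have hmem := mul_one_add_mem_scaled s hg.mem
    rw [hts] at hmem
    obtain ⟨i1, i2⟩ := hg.integrable_scale hF hgm (γ := fun _ => s) measurable_const
      (Eventually.of_forall fun _ => hs2)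
    have hpos : ∀ᵐ ω ∂P, 0 < g ω * (1 + s) := by
      filter_upwards [hg.pos] with ω a
      exact mul_pos a (by linarith [(abs_le.1 hs2).1])
    have h1 := hw.le hF (by linarith : 0 < t + ε) hmem hpos i2
    have h2 : ∫ ω, (F (g ω * (1 + s)) - F (g ω) + φ (g ω) * (g ω * s)) ∂P
        ≤ ∫ ω, c₂ * 2 ^ c₂ * 2 * s ^ 2 * (g ω * φ (g ω)) ∂P := by
      refine integral_mono_ae i1 (hg.integrable_mul.const_mul _) ?_
      filter_upwards [hg.pos] with ω a
      have := (abs_le.1 (hF.second_order_bound a hs2)).2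
      linarith
    have i3 : Integrable (fun ω => φ (g ω) * (g ω * s)) P :=
      (hg.integrable_mul.mul_const s).congr (Eventually.of_forall fun ω => by
        simp only; ring)
    have i4 : Integrable (fun ω => F (g ω * (1 + s)) - F (g ω)) P := i2.sub hg.integrable
    have e1 : ∫ ω, φ (g ω) * (g ω * s) ∂P = t * y * s := by
      rw [← hg.integral_mul, ← integral_mul_const]
      exact integral_congr_ae (Eventually.of_forall fun ω => by simp only; ring)
    rw [integral_add i4 i3, integral_sub i2 hg.integrable, e1, integral_const_mul,
      hg.integral_mul, ← hw.eq hF ht hg] at h2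
    have e2 : t * y * s = y * ε := by rw [hs]; field_simp
    have e3 : c₂ * 2 ^ c₂ * 2 * s ^ 2 * (t * y) = M * ε ^ 2 := by
      rw [hM, hs]; field_simp
    linarith
  rw [hasDerivAt_iff_isLittleO_nhds_zero]
  have hO : (fun ε => w (t + ε) - w t - ε • -y) =O[𝓝 0] fun ε : ℝ => ε ^ 2 := by
    refine Asymptotics.IsBigO.of_bound M ?_
    filter_upwards [Metric.ball_mem_nhds (0:ℝ) (half_pos ht)] with ε hε
    rw [Metric.mem_ball, dist_zero_right, Real.norm_eq_abs] at hε
    have h1 := hup ε hε.le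
    have h2 := hw.tangent_le hF ht (by linarith [(abs_lt.1 hε).1] : 0 < t + ε) hg
    rw [Real.norm_eq_abs, Real.norm_eq_abs, smul_eq_mul, abs_of_nonneg, abs_of_nonneg]
    · linarith
    · positivity
    · linarith
  exact hO.trans_isLittleO (Asymptotics.isLittleO_pow_id one_lt_two)

end Optimality

/-- It makes `V(h / l)` integrable when `h` is the dual optimizer, for an arbitrarily large factor
`l`. -/
theorem PowerLike.scale_bound {F φ ζ : ℝ → ℝ} {c₁ c₂ : ℝ} (h : PowerLike F φ ζ c₁ c₂) {l z : ℝ}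
    (hl : 1 ≤ l) (hz : 0 < z) : F (l⁻¹ * z) ≤ F z + l ^ c₂ * (z * φ z) := by
  have hl0 : 0 < l := by linarith
  have hlz : 0 < l⁻¹ * z := by positivity
  have e1 := h.tangent_le hlz hz
  have e2 := h.slope_le_mul hl hlz
  rw [mul_inv_cancel_left₀ hl0.ne'] at e2
  have e3 := h.pos _ hlz
  have e4 : φ (l⁻¹ * z) * (z - l⁻¹ * z) ≤ φ (l⁻¹ * z) * z :=
    mul_le_mul_of_nonneg_left (by linarith) e3.le
  have e5 : φ (l⁻¹ * z) * z ≤ φ z * l ^ c₂ * z := mul_le_mul_of_nonneg_right e2 hz.le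
  linarith

/-! ### Duality between the two problems -/

section Duality

variable {Ω : Type*} [MeasurableSpace Ω] {P : Measure Ω} {C D : Set (Ω → ℝ)} {U : ℝ → ℝ}
  {c₁ c₂ s t y x : ℝ} {f g h : Ω → ℝ} {I : ℝ → ℝ}

theorem OptInvest.BipolarPair.measurable_left (hCD : BipolarPair P C D) : ∀ g ∈ C, Measurable g := by
  intro g hg
  rw [hCD.1] at hg
  exact hg.1

theorem OptInvest.BipolarPair.measurable_right (hCD : BipolarPair P C D) : ∀ h ∈ D, Measurable h := by
  intro h hh
  rw [hCD.2] at hh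
  exact hh.1

theorem OptInvest.BipolarPair.integral_mul_le (hCD : BipolarPair P C D) (ht : 0 < t) (hs : 0 < s)
    (hf : f ∈ scaled t C) (hh : h ∈ scaled s D) :
    Integrable (fun ω => f ω * h ω) P ∧ ∫ ω, f ω * h ω ∂P ≤ t * s := by
  obtain ⟨k, hk, rfl⟩ := hh
  rw [hCD.1, mem_scaled_polar ht] at hf
  have hkm := hCD.measurable_right k hk
  have hk0 : ∀ᵐ ω ∂P, 0 ≤ k ω := by
    rw [hCD.2] at hk
    exact hk.2.1
  have h1 := hf.2.2 k hk
  have h0 : 0 ≤ᵐ[P] fun ω => f ω * k ω := by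
    filter_upwards [hf.2.1, hk0] with ω a b using mul_nonneg a b
  have hi : Integrable (fun ω => f ω * k ω) P :=
    (lintegral_ofReal_ne_top_iff_integrable (hf.1.mul hkm).aestronglyMeasurable h0).1
      (ne_top_of_le_ne_top ENNReal.ofReal_ne_top h1)
  rw [← ofReal_integral_eq_lintegral_ofReal hi h0, ENNReal.ofReal_le_ofReal_iff ht.le] at h1
  have e : (fun ω => f ω * (s * k ω)) = fun ω => s * (f ω * k ω) := by
    ext ω; ring
  rw [e, integral_const_mul]
  exact ⟨hi.const_mul s, by nlinarith⟩

/-- The multiplier inequality `E[f U'(g)] ≤ y` over `f ∈ C` is exactly membership in `y` times the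
polar of `C`. -/
theorem mem_scaled_right (hCD : BipolarPair P C D) (hU : IsUtility U)
    (hA : RiskAversionBounds U c₁ c₂) (ht : 0 < t) (hy : 0 < y) (hgm : Measurable g)
    (hg : IsOpt P (fun z => -U z) (deriv U) C t y g) :
    (fun ω => deriv U (g ω)) ∈ scaled y D := by
  rw [hCD.2, mem_scaled_polar hy]
  have h0 : ∀ᵐ ω ∂P, 0 ≤ deriv U (g ω) := hg.pos.mono fun ω a => (utility_deriv_pos hU hA a).le
  refine ⟨(measurable_deriv U).comp hgm, h0, fun f hf => ?_⟩
  obtain ⟨h1, h2⟩ := hg.scaled_le ht one_pos (f := f) ⟨f, hf, by simp⟩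
  have hf0 : ∀ᵐ ω ∂P, 0 ≤ f ω := by
    rw [hCD.1] at hf
    exact hf.2.1
  simp only [mul_comm (deriv U _)]
  rw [← ofReal_integral_eq_lintegral_ofReal h1]
  · exact ENNReal.ofReal_le_ofReal (by linarith)
  · filter_upwards [h0, hf0] with ω a b using mul_nonneg b a

theorem OptInvest.BipolarPair.boundedProblem (hCD : BipolarPair P C D) (hU : IsUtility U)
    (hu : ∀ t : ℝ, 0 < t → primalValue P C U t < ⊤) :
    BoundedProblem P (fun z => -U z) C := by
  intro t ht
  refine ⟨(primalValue P C U t).toReal, fun f hf hpos r hr hle => ?_⟩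
  have hUc : ContinuousOn U (Ioi 0) := fun z hz =>
    (hU.differentiable z hz).continuousAt.continuousWithinAt
  have hfm : Measurable f := by
    rw [hCD.1] at hf
    exact measurable_of_mem_scaled hf
  have he : extExp P (fun ω => extU U (f ω)) = extExp P (fun ω => (U (f ω) : EReal)) :=
    extExp_congr (hpos.mono fun ω a => extU_of_pos U a)
  have h1 : extExp P (fun ω => extU U (f ω)) ≤ primalValue P C U t :=
    le_iSup₂ (f := fun g (_ : g ∈ scaled t C) => extExp P (fun ω => extU U (g ω))) f hf
  rw [he] at h1
  have hi : Integrable (fun ω => U (f ω)) P :=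
    integrable_of_extExp_lt_top (aestronglyMeasurable_comp_of_continuousOn hUc hfm hpos)
      hr.neg (hle.mono fun ω a => by simp only [Pi.neg_apply]; linarith) (h1.trans_lt (hu t ht))
  refine ⟨hi.neg, ?_⟩
  rw [extExp_coe hi] at h1
  rw [integral_neg, neg_le_neg_iff]
  have := EReal.toReal_le_toReal h1 (EReal.coe_ne_bot _) (hu t ht).ne
  rwa [EReal.toReal_coe] at this

theorem OptInvest.BipolarPair.exists_isOpt_primal [IsProbabilityMeasure P] (hCD : BipolarPair P C D)
    (hC_bdd : BoundedInL0 P C) (hC_one : (fun _ => (1 : ℝ)) ∈ C) (hU : IsUtility U)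
    (hA : RiskAversionBounds U c₁ c₂) (hu : ∀ t : ℝ, 0 < t → primalValue P C U t < ⊤)
    (ht : 0 < t) : ∃ g y, 0 < y ∧ IsOpt P (fun z => -U z) (deriv U) C t y g := by
  have hB := hCD.boundedProblem hU hu
  have hD := hCD.measurable_right
  rw [hCD.1] at hB hC_bdd hC_one ⊢
  exact exists_isOpt (powerLike_neg_utility hU hA) hB hD hC_bdd hC_one ht

/-- The tangent to `U` at `g` is an integrable majorant of `U(f)` whose mean is at most `E[U(g)]`. A
second solution attains equality almost surely, which the strict tangent inequality excludes off
`g`. -/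
theorem isOpt_primalValue (hCD : BipolarPair P C D) (hU : IsUtility U)
    (hA : RiskAversionBounds U c₁ c₂)
    (hg : IsOpt P (fun z => -U z) (deriv U) C t y g) :
    primalValue P C U t = ((∫ ω, U (g ω) ∂P : ℝ) : EReal) ∧ IsPrimalSol P C U t g ∧
      ∀ g', IsPrimalSol P C U t g' → g =ᵐ[P] g' := by
  have hUi : Integrable (fun ω => U (g ω)) P := hg.integrable.neg.congr
    (Eventually.of_forall fun ω => by simp)
  have hr : ∀ f ∈ scaled t C, Integrable (fun ω => U (g ω) + deriv U (g ω) * (f ω - g ω)) P ∧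
      ∫ ω, (U (g ω) + deriv U (g ω) * (f ω - g ω)) ∂P ≤ ∫ ω, U (g ω) ∂P := by
    intro f hf
    obtain ⟨h1, h2⟩ := hg.le f hf
    have e : (fun ω => U (g ω) + deriv U (g ω) * (f ω - g ω))
        = fun ω => U (g ω) + (f ω * deriv U (g ω) - g ω * deriv U (g ω)) := by
      ext ω; ring
    have i1 : Integrable (fun ω => f ω * deriv U (g ω) - g ω * deriv U (g ω)) P :=
      h1.sub hg.integrable_mul
    rw [e, integral_add hUi i1, integral_sub h1 hg.integrable_mul, hg.integral_mul]
    exact ⟨hUi.add i1, by linarith⟩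
  have hge : extExp P (fun ω => extU U (g ω)) = ((∫ ω, U (g ω) ∂P : ℝ) : EReal) := by
    rw [← extExp_coe hUi]
    exact extExp_congr (hg.pos.mono fun ω a => extU_of_pos U a)
  have hval : primalValue P C U t = ((∫ ω, U (g ω) ∂P : ℝ) : EReal) := by
    refine le_antisymm (iSup₂_le fun f hf => ?_) ?_
    · obtain ⟨h1, h2⟩ := hr f hf
      refine (extExp_le_integral h1 ?_).trans (EReal.coe_le_coe_iff.2 h2)
      exact hg.pos.mono fun ω a => (extU_le_tangent hU hA a).1
    · rw [← hge]
      exact le_iSup₂ (f := fun g (_ : g ∈ scaled t C) => extExp P (fun ω => extU U (g ω))) g hg.mem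
  refine ⟨hval, ⟨hg.mem, hge.trans hval.symm⟩, fun f hf => ?_⟩
  obtain ⟨h1, h2⟩ := hr f hf.1
  have hfm : Measurable f := by
    have := hf.1
    rw [hCD.1] at this
    exact measurable_of_mem_scaled this
  have hle : ∀ᵐ ω ∂P, extU U (f ω) ≤ ((U (g ω) + deriv U (g ω) * (f ω - g ω) : ℝ) : EReal) :=
    hg.pos.mono fun ω a => (extU_le_tangent hU hA a).1
  have he := ae_eq_of_le_of_extExp_eq ((extU_mono hU).measurable.comp hfm).aemeasurable h1 hle
    (le_antisymm (extExp_le_integral h1 hle) (by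
      have := hf.2
      simp only [Function.comp_def]
      rw [this, hval]
      exact EReal.coe_le_coe_iff.2 h2))
  filter_upwards [he, hg.pos] with ω a b
  by_contra hne
  exact absurd a ((extU_le_tangent hU hA b).2 (Ne.symm hne)).ne

/-- Fenchel's inequality `V(h) ≥ U(g) - g h` and `E[g h] ≤ t y` bound the dual value below, with
equality at `h = U'(g)`; strictness gives uniqueness. -/
theorem isOpt_dualValue (hCD : BipolarPair P C D) (hU : IsUtility U)
    (hA : RiskAversionBounds U c₁ c₂) (ht : 0 < t) (hy : 0 < y) (hgm : Measurable g)
    (hg : IsOpt P (fun z => -U z) (deriv U) C t y g) :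
    dualValue P D U y = ((∫ ω, (U (g ω) - g ω * deriv U (g ω)) ∂P : ℝ) : EReal) ∧
      IsDualSol P D U y (fun ω => deriv U (g ω)) ∧
      ∀ h, IsDualSol P D U y h → (fun ω => deriv U (g ω)) =ᵐ[P] h := by
  have hUi : Integrable (fun ω => U (g ω)) P := hg.integrable.neg.congr
    (Eventually.of_forall fun ω => by simp)
  have hVi : Integrable (fun ω => U (g ω) - g ω * deriv U (g ω)) P := hUi.sub hg.integrable_mul
  have hmem := mem_scaled_right hCD hU hA ht hy hgm hg
  have hr : ∀ h ∈ scaled y D, Integrable (fun ω => U (g ω) - g ω * h ω) P ∧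
      ∫ ω, (U (g ω) - g ω * deriv U (g ω)) ∂P ≤ ∫ ω, (U (g ω) - g ω * h ω) ∂P := by
    intro h hh
    obtain ⟨h1, h2⟩ := hCD.integral_mul_le ht hy hg.mem hh
    rw [integral_sub hUi h1, integral_sub hUi hg.integrable_mul, hg.integral_mul]
    exact ⟨hUi.sub h1, by linarith⟩
  have hge : extExp P (fun ω => extV U (deriv U (g ω)))
      = ((∫ ω, (U (g ω) - g ω * deriv U (g ω)) ∂P : ℝ) : EReal) := by
    rw [← extExp_coe hVi]
    exact extExp_congr (hg.pos.mono fun ω a => extV_slope hU hA a)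
  have hval : dualValue P D U y
      = ((∫ ω, (U (g ω) - g ω * deriv U (g ω)) ∂P : ℝ) : EReal) := by
    refine le_antisymm ?_ (le_iInf₂ fun h hh => ?_)
    · rw [← hge]
      exact iInf₂_le (f := fun h (_ : h ∈ scaled y D) => extExp P (fun ω => extV U (h ω))) _ hmem
    · obtain ⟨h1, h2⟩ := hr h hh
      exact (EReal.coe_le_coe_iff.2 h2).trans
        (integral_le_extExp h1 (hg.pos.mono fun ω a => extV_ge U a _))
  refine ⟨hval, ⟨hmem, hge.trans hval.symm⟩, fun h hh => ?_⟩
  obtain ⟨h1, h2⟩ := hr h hh.1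
  have hhm : Measurable h := by
    have := hh.1
    rw [hCD.2] at this
    exact measurable_of_mem_scaled this
  have hle : ∀ᵐ ω ∂P, ((U (g ω) - g ω * h ω : ℝ) : EReal) ≤ extV U (h ω) :=
    hg.pos.mono fun ω a => extV_ge U a _
  have he := ae_eq_of_ge_of_extExp_eq ((extV_antitoneOn U).measurable.comp hhm).aemeasurable h1 hle
    (le_antisymm (by
      have := hh.2
      simp only [Function.comp_def]
      rw [this, hval]
      exact EReal.coe_le_coe_iff.2 h2) (integral_le_extExp h1 hle))
  filter_upwards [he, hg.pos] with ω a b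
  by_contra hne
  exact absurd a (extV_gt hU b (Ne.symm hne)).ne'

/-- The dual optimizer satisfies the first-order characterization for the conjugate function. -/
theorem isOpt_conj (hCD : BipolarPair P C D) (hU : IsUtility U)
    (hA : RiskAversionBounds U c₁ c₂) (hI' : ∀ z, 0 < z → I (deriv U z) = z)
    (ht : 0 < t) (hy : 0 < y) (hgm : Measurable g)
    (hg : IsOpt P (fun z => -U z) (deriv U) C t y g) :
    IsOpt P (conjV U) I D y t (fun ω => deriv U (g ω)) where
  mem := mem_scaled_right hCD hU hA ht hy hgm hg
  pos := hg.pos.mono fun ω a => utility_deriv_pos hU hA a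
  integrable := by
    refine (hg.integrable.neg.sub hg.integrable_mul).congr ?_
    filter_upwards [hg.pos] with ω a
    rw [conjV_slope hU hA a]
    simp
  integrable_mul := by
    refine hg.integrable_mul.congr ?_
    filter_upwards [hg.pos] with ω a
    rw [hI' _ a, mul_comm]
  integral_mul := by
    rw [mul_comm, ← hg.integral_mul]
    refine integral_congr_ae ?_
    filter_upwards [hg.pos] with ω a
    rw [hI' _ a, mul_comm]
  le f hf := by
    obtain ⟨h1, h2⟩ := hCD.integral_mul_le ht hy hg.mem hf
    have e : (fun ω => g ω * f ω) =ᵐ[P] fun ω => f ω * I (deriv U (g ω)) := by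
      filter_upwards [hg.pos] with ω a
      rw [hI' _ a, mul_comm]
    rw [← integral_congr_ae e, mul_comm y]
    exact ⟨h1.congr e, h2⟩

theorem OptInvest.BipolarPair.uFun_isValueFn [IsProbabilityMeasure P] (hCD : BipolarPair P C D)
    (hC_bdd : BoundedInL0 P C) (hC_one : (fun _ => (1 : ℝ)) ∈ C) (hU : IsUtility U)
    (hA : RiskAversionBounds U c₁ c₂) (hu : ∀ t : ℝ, 0 < t → primalValue P C U t < ⊤) :
    IsValueFn P (fun z => -U z) (deriv U) C (fun t => -uFun P C U t) := by
  intro t ht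
  obtain ⟨g, y, hy, hg⟩ := hCD.exists_isOpt_primal hC_bdd hC_one hU hA hu ht
  have hgm : Measurable g := by
    have := hg.mem
    rw [hCD.1] at this
    exact measurable_of_mem_scaled this
  refine ⟨y, g, hy, hgm, hg, ?_⟩
  simp only [uFun]
  rw [(isOpt_primalValue hCD hU hA hg).1, EReal.toReal_coe, integral_neg]

/-- Testing with the constant `1` gives `E[U'(g)] ≤ y`. Boundedness in `L⁰` keeps `g` below `t N`
with probability at least `1/2`, so `y ≥ U'(t N) / 2`, which is large for small `t`. -/
theorem exists_multiplier_gt [IsProbabilityMeasure P]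
    (hC_bdd : BoundedInL0 P C) (hC_one : (fun _ => (1 : ℝ)) ∈ C) (hU : IsUtility U)
    (hA : RiskAversionBounds U c₁ c₂) (B : ℝ) :
    ∃ t, 0 < t ∧ ∀ y g, Measurable g → IsOpt P (fun z => -U z) (deriv U) C t y g → B < y := by
  have hF := powerLike_neg_utility hU hA
  obtain ⟨N, hN, hNf⟩ := exists_tail_le_of_boundedInL0 hC_bdd one_pos
    (show (0 : ℝ≥0∞) < 1 / 2 by simp)
  have hmul : Tendsto (fun t : ℝ => t * N) (𝓝[>] 0) (𝓝[>] 0) := by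
    refine tendsto_nhdsWithin_of_tendsto_nhds_of_eventually_within _ ?_ ?_
    · have : Tendsto (fun t : ℝ => t * N) (𝓝 0) (𝓝 (0 * N)) :=
        (continuous_id.mul (continuous_const (y := N))).tendsto 0
      rw [zero_mul] at this
      exact this.mono_left nhdsWithin_le_nhds
    · filter_upwards [eventually_mem_nhdsWithin] with t ht
      exact mul_pos ht hN
  obtain ⟨t, ht1, ht⟩ := (((hF.tendsto_slope_zero.comp hmul).eventually_gt_atTop (2 * B)).and
    eventually_mem_nhdsWithin).exists
  have ht0 : 0 < t := ht
  refine ⟨t, ht0, fun y g hgm hg => ?_⟩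
  have hφ := hF.pos (t * N) (mul_pos ht0 hN)
  simp only [Function.comp] at ht1
  obtain ⟨h1, h2⟩ := hg.scaled_le ht0 one_pos (f := fun _ => 1) ⟨_, hC_one, by simp⟩
  simp only [one_mul] at h1 h2
  have htail : P {ω | t * N ≤ g ω} ≤ 1 / 2 := by
    refine le_trans (measure_mono fun ω (hω : t * N ≤ g ω) => ?_)
      (hNf (fun ω => 1 / t * g ω) (scaled_rescale (t := 1) ht0 hg.mem))
    have : N ≤ 1 / t * g ω := by
      rw [one_div, inv_mul_eq_div, le_div_iff₀ ht0]
      linarith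
    exact this.trans (le_abs_self _)
  have hset : MeasurableSet {ω | t * N ≤ g ω} := measurableSet_le measurable_const hgm
  have hcompl : 1 / 2 ≤ P.real {ω | t * N ≤ g ω}ᶜ := by
    rw [probReal_compl_eq_one_sub hset]
    have : P.real {ω | t * N ≤ g ω} ≤ 1 / 2 := by
      have := ENNReal.toReal_mono (by simp) htail
      simpa [Measure.real] using this
    linarith
  have h3 : ∫ ω, ({ω | t * N ≤ g ω}ᶜ).indicator (fun _ => deriv U (t * N)) ω ∂P
      ≤ ∫ ω, deriv U (g ω) ∂P := by
    refine integral_mono_ae ((integrable_const _).indicator hset.compl) h1 ?_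
    filter_upwards [hg.pos] with ω a
    by_cases hω : t * N ≤ g ω
    · rw [indicator_of_notMem (by simpa using hω)]
      exact (hF.pos _ a).le
    · rw [indicator_of_mem (by simpa using hω)]
      exact hF.slope_strictAntiOn.antitoneOn a (mul_pos ht0 hN) (not_le.1 hω).le
  rw [integral_indicator_const _ hset.compl, smul_eq_mul] at h3
  have h4 : 1 / 2 * deriv U (t * N) ≤ P.real {ω | t * N ≤ g ω}ᶜ * deriv U (t * N) :=
    mul_le_mul_of_nonneg_right hcompl hφ.le
  linarith

/-- If all multipliers were at least `B`, the value `u` would grow with slope at least `B`.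
Fenchel's inequality with the dual element `h₁ / l` bounds `u` by a line of slope at most `B / 2`.
-/
theorem OptInvest.BipolarPair.exists_multiplier_lt [IsProbabilityMeasure P] (hCD : BipolarPair P C D)
    (hC_bdd : BoundedInL0 P C) (hC_one : (fun _ => (1 : ℝ)) ∈ C) (hU : IsUtility U)
    (hA : RiskAversionBounds U c₁ c₂) (hu : ∀ t : ℝ, 0 < t → primalValue P C U t < ⊤)
    {B : ℝ} (hB : 0 < B) :
    ∃ t y g, 0 < t ∧ y < B ∧ Measurable g ∧ IsOpt P (fun z => -U z) (deriv U) C t y g := by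
  by_contra! hc
  have hF := powerLike_neg_utility hU hA
  obtain ⟨I, hI, hI'⟩ := hF.exists_inverse
  have hV := powerLike_conjV hU hA hI hI'
  have hw := hCD.uFun_isValueFn hC_bdd hC_one hU hA hu
  obtain ⟨y₁, g₁, hy₁, hgm₁, hg₁, e₁⟩ := hw 1 one_pos
  set h₁ : Ω → ℝ := fun ω => deriv U (g₁ ω) with hh₁
  have hopt := isOpt_conj hCD hU hA hI' one_pos hy₁ hgm₁ hg₁
  -- `2 * y₁ / B` makes the slope `y₁ / l` at most `B / 2`; the maximum with `1` is needed for the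
  -- scaling bound on `V`.
  set l : ℝ := max 1 (2 * y₁ / B) with hl
  have hl1 : 1 ≤ l := le_max_left _ _
  have hl0 : 0 < l := by linarith
  have hly : l⁻¹ * y₁ ≤ B / 2 := by
    rw [inv_mul_eq_div, div_le_iff₀ hl0]
    have : 2 * y₁ / B ≤ l := le_max_right _ _
    rw [div_le_iff₀ hB] at this
    linarith
  set A : ℝ := ∫ ω, conjV U (h₁ ω) ∂P + l ^ (1 / c₁) * (y₁ * 1) with hAdef
  have hup : ∀ t, 1 ≤ t → uFun P C U t ≤ A + B / 2 * t := by
    intro t ht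
    have ht0 : 0 < t := by linarith
    obtain ⟨y, g, hy, hgm, hg, e⟩ := hw t ht0
    have hUi : Integrable (fun ω => U (g ω)) P := hg.integrable.neg.congr
      (Eventually.of_forall fun ω => by simp)
    have eu : uFun P C U t = ∫ ω, U (g ω) ∂P := by
      rw [integral_neg] at e
      linarith
    obtain ⟨j1, j2⟩ := hCD.integral_mul_le ht0 hy₁ hg.mem hopt.mem
    have i1 : Integrable (fun ω => conjV U (h₁ ω) + l ^ (1 / c₁) * (h₁ ω * I (h₁ ω))) P :=
      hopt.integrable.add (hopt.integrable_mul.const_mul _)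
    have : ∫ ω, U (g ω) ∂P ≤ ∫ ω, (conjV U (h₁ ω) + l ^ (1 / c₁) * (h₁ ω * I (h₁ ω))
        + l⁻¹ * (g ω * h₁ ω)) ∂P := by
      refine integral_mono_ae hUi (i1.add (j1.const_mul _)) ?_
      filter_upwards [hg.pos, hopt.pos] with ω a b
      have e1 := hV.scale_bound hl1 b
      have hb : 0 < l⁻¹ * h₁ ω := mul_pos (inv_pos.2 hl0) b
      have e2 := extV_ge U a (l⁻¹ * h₁ ω)
      rw [extV_eq_conjV hU hA hb, EReal.coe_le_coe_iff] at e2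
      linarith
    rw [integral_add i1 (j1.const_mul _),
      integral_add hopt.integrable (hopt.integrable_mul.const_mul _), integral_const_mul,
      integral_const_mul, hopt.integral_mul] at this
    have e3 : l⁻¹ * ∫ ω, g ω * h₁ ω ∂P ≤ l⁻¹ * (t * y₁) :=
      mul_le_mul_of_nonneg_left j2 (inv_pos.2 hl0).le
    have e4 : l⁻¹ * y₁ * t ≤ B / 2 * t := mul_le_mul_of_nonneg_right hly ht0.le
    rw [eu]
    linarith
  have hlow : ∀ t, 1 ≤ t → uFun P C U 1 + B * (t - 1) ≤ uFun P C U t := by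
    intro t ht
    have ht0 : 0 < t := by linarith
    obtain ⟨y, g, hy, hgm, hg, e⟩ := hw t ht0
    have hyB : B ≤ y := by
      by_contra hlt
      exact hc t y g ht0 (not_le.1 hlt) hgm hg
    have := hw.tangent_le hF ht0 one_pos hg
    nlinarith
  set t₀ : ℝ := max 1 ((A - uFun P C U 1 + B + 1) / (B / 2)) with ht₀
  have ht1 : 1 ≤ t₀ := le_max_left _ _
  have ht2 : A - uFun P C U 1 + B + 1 ≤ t₀ * (B / 2) := by
    rw [← div_le_iff₀ (by positivity)]
    exact le_max_right _ _
  have := hup t₀ ht1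
  have := hlow t₀ ht1
  linarith

/-- Every `y > 0` is a Lagrange multiplier of the primal problem for some initial capital. -/
theorem OptInvest.BipolarPair.exists_isOpt_of_multiplier [IsProbabilityMeasure P]
    (hCD : BipolarPair P C D) (hC_bdd : BoundedInL0 P C) (hC_one : (fun _ => (1 : ℝ)) ∈ C)
    (hU : IsUtility U) (hA : RiskAversionBounds U c₁ c₂)
    (hu : ∀ t : ℝ, 0 < t → primalValue P C U t < ⊤) (hy : 0 < y) :
    ∃ t g, 0 < t ∧ Measurable g ∧ IsOpt P (fun z => -U z) (deriv U) C t y g := by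
  have hF := powerLike_neg_utility hU hA
  have hw := hCD.uFun_isValueFn hC_bdd hC_one hU hA hu
  choose! Y G hY0 hGm hG hGe using hw
  obtain ⟨t₁, y₁, g₁, ht₁, hy₁, hgm₁, hg₁⟩ :=
    hCD.exists_multiplier_lt hC_bdd hC_one hU hA hu hy
  obtain ⟨t₂, ht₂, h₂⟩ := exists_multiplier_gt hC_bdd hC_one hU hA y
  have hw := hCD.uFun_isValueFn hC_bdd hC_one hU hA hu
  have hd : ∀ t, 0 < t → HasDerivAt (fun t => -uFun P C U t) (-Y t) t := fun t ht =>
    hw.hasDerivAt hF ht (hGm t ht) (hG t ht)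
  have hYt₁ : Y t₁ = y₁ := by
    have := (hd t₁ ht₁).unique (hw.hasDerivAt hF ht₁ hgm₁ hg₁)
    linarith
  -- Darboux's theorem: the multipliers are derivatives, so they take all intermediate values
  -- without a continuity argument.
  have hord := (ordConnected_Ioi (a := (0:ℝ))).image_hasDerivWithinAt
    (fun t ht => (hd t ht).hasDerivWithinAt)
  have hmem : -y ∈ (fun t => -Y t) '' Ioi 0 := by
    refine hord.out ⟨t₂, ht₂, rfl⟩ ⟨t₁, ht₁, rfl⟩ ⟨?_, ?_⟩
    · have := h₂ _ _ (hGm t₂ ht₂) (hG t₂ ht₂)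
      simp only
      linarith
    · simp only [hYt₁]
      linarith
  obtain ⟨t, ht, e⟩ := hmem
  have e' : Y t = y := by simpa using e
  exact ⟨t, G t, ht, hGm t ht, e' ▸ hG t ht⟩

theorem OptInvest.BipolarPair.vFun_isValueFn [IsProbabilityMeasure P] (hCD : BipolarPair P C D)
    (hC_bdd : BoundedInL0 P C) (hC_one : (fun _ => (1 : ℝ)) ∈ C) (hU : IsUtility U)
    (hA : RiskAversionBounds U c₁ c₂) (hu : ∀ t : ℝ, 0 < t → primalValue P C U t < ⊤)
    (hI' : ∀ z, 0 < z → I (deriv U z) = z) :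
    IsValueFn P (conjV U) I D (vFun P D U) := by
  intro y hy
  obtain ⟨t, g, ht, hgm, hg⟩ := hCD.exists_isOpt_of_multiplier hC_bdd hC_one hU hA hu hy
  refine ⟨t, _, ht, (measurable_deriv U).comp hgm, isOpt_conj hCD hU hA hI' ht hy hgm hg, ?_⟩
  rw [vFun, (isOpt_dualValue hCD hU hA ht hy hgm hg).1, EReal.toReal_coe]
  refine integral_congr_ae ?_
  filter_upwards [hg.pos] with ω a
  exact (conjV_slope hU hA a).symm

end Duality

/-! ### Weighted quadratic problems on complementary spaces -/

section Quadratic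

variable {Ω : Type*} [MeasurableSpace Ω] {Q : Measure Ω} {S T : Set (Ω → ℝ)} {ζ ζ' : Ω → ℝ}
  {c₁ c₂ : ℝ} {α α' β β' f : Ω → ℝ}

theorem OptInvest.Complementary.symm (h : Complementary Q S T) : Complementary Q T S := by
  refine ⟨fun β => ?_, fun α => ?_⟩
  · simpa only [mul_comm] using h.2 β
  · simpa only [mul_comm] using h.1 α

theorem OptInvest.Complementary.mem_L20 (h : Complementary Q S T) (hα : α ∈ S) : α ∈ L20 Q :=
  ((h.1 α).1 hα).1

theorem OptInvest.Complementary.integral_mul (h : Complementary Q S T) (hα : α ∈ S) (hβ : β ∈ T) :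
    ∫ ω, α ω * β ω ∂Q = 0 := ((h.1 α).1 hα).2 β hβ

theorem OptInvest.Complementary.zero_mem (h : Complementary Q S T) : (fun _ => (0:ℝ)) ∈ S := by
  rw [h.1]
  exact ⟨⟨measurable_const, MemLp.zero', by simp⟩, fun β _ => by simp⟩

theorem integrable_mul_of_memLp {f g : Ω → ℝ} (hf : MemLp f 2 Q) (hg : MemLp g 2 Q) :
    Integrable (fun ω => f ω * g ω) Q := hf.integrable_mul hg

theorem OptInvest.Complementary.sub_mem [IsProbabilityMeasure Q] (h : Complementary Q S T)
    (hα : α ∈ S) (hα' : α' ∈ S) : (fun ω => α ω - α' ω) ∈ S := by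
  obtain ⟨⟨m1, l1, z1⟩, o1⟩ := (h.1 α).1 hα
  obtain ⟨⟨m2, l2, z2⟩, o2⟩ := (h.1 α').1 hα'
  refine (h.1 _).2 ⟨⟨m1.sub m2, l1.sub l2, ?_⟩, fun β hβ => ?_⟩
  · rw [integral_sub (l1.integrable (by norm_num)) (l2.integrable (by norm_num)), z1, z2, sub_zero]
  · have lβ := (h.symm.mem_L20 hβ).2.1
    simp only [sub_mul]
    rw [integral_sub (integrable_mul_of_memLp l1 lβ) (integrable_mul_of_memLp l2 lβ), o1 β hβ, o2 β hβ, sub_zero]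

theorem memLp_mul_of_bound {σ : Ω → ℝ} {c : ℝ} (hf : MemLp f 2 Q) (hσ : AEStronglyMeasurable σ Q)
    (hb : ∀ᵐ ω ∂Q, |σ ω| ≤ c) : MemLp (fun ω => σ ω * f ω) 2 Q := by
  refine MemLp.of_le_mul (c := c) hf (hσ.mul hf.1) ?_
  filter_upwards [hb] with ω h
  rw [norm_mul]
  exact mul_le_mul_of_nonneg_right h (norm_nonneg _)

theorem inner_toLp_eq {f g : Ω → ℝ} (hf : MemLp f 2 Q) (hg : MemLp g 2 Q) :
    inner ℝ (hf.toLp f) (hg.toLp g) = ∫ ω, f ω * g ω ∂Q := by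
  rw [L2.inner_def]
  refine integral_congr_ae ?_
  filter_upwards [hf.coeFn_toLp, hg.coeFn_toLp] with ω h1 h2
  rw [h1, h2]
  simp [mul_comm]

/-- Existence of a solution of the weighted projection problem, in variational form. -/
theorem OptInvest.Complementary.exists_orthogonal [IsProbabilityMeasure Q]
    (h : Complementary Q S T) (hc₁ : 0 < c₁) (hζm : Measurable ζ)
    (hζ : ∀ᵐ ω ∂Q, c₁ < ζ ω ∧ ζ ω < c₂) :
    ∃ α ∈ S, ∀ α' ∈ S, ∫ ω, ζ ω * (1 + α ω) * α' ω ∂Q = 0 := by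
  -- Multiplication by `√ζ` turns the weighted problem into an unweighted projection. As `S` is the
  -- orthogonal complement of `T` in mean zero, the image of `S` is `Nᗮ`, where `N` is spanned by
  -- the constant and `T` divided by `√ζ`.
  set σ : Ω → ℝ := fun ω => √(ζ ω) with hσ
  have hσm : Measurable σ := hζm.sqrt
  have hσb : ∀ᵐ ω ∂Q, |σ ω| ≤ √c₂ := by
    filter_upwards [hζ] with ω a
    rw [hσ, abs_of_nonneg (Real.sqrt_nonneg _)]
    exact Real.sqrt_le_sqrt a.2.le
  have hσ0 : ∀ᵐ ω ∂Q, 0 < σ ω := hζ.mono fun ω a => Real.sqrt_pos.2 (hc₁.trans a.1)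
  have hσi : ∀ᵐ ω ∂Q, |(σ ω)⁻¹| ≤ (√c₁)⁻¹ := by
    filter_upwards [hζ] with ω a
    rw [abs_of_nonneg (inv_nonneg.2 (Real.sqrt_nonneg _))]
    exact inv_anti₀ (Real.sqrt_pos.2 hc₁) (Real.sqrt_le_sqrt a.1.le)
  have hmul : ∀ f, MemLp f 2 Q → MemLp (fun ω => σ ω * f ω) 2 Q := fun f hf =>
    memLp_mul_of_bound hf hσm.aestronglyMeasurable hσb
  have hdiv : ∀ f, MemLp f 2 Q → MemLp (fun ω => (σ ω)⁻¹ * f ω) 2 Q := fun f hf =>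
    memLp_mul_of_bound hf hσm.inv.aestronglyMeasurable hσi
  have h1 : MemLp (fun _ : Ω => (1:ℝ)) 2 Q := memLp_const 1
  have hT : ∀ β ∈ T, MemLp β 2 Q := fun β hβ => (h.symm.mem_L20 hβ).2.1
  set N : Submodule ℝ (Lp ℝ 2 Q) := Submodule.span ℝ
    (insert ((hdiv _ h1).toLp _) (range fun β : T => (hdiv _ (hT β β.2)).toLp _)) with hN
  have hmemN : ∀ p : Lp ℝ 2 Q, p ∈ Nᗮ ↔ inner ℝ ((hdiv _ h1).toLp _) p = 0 ∧
      ∀ β : T, inner ℝ ((hdiv _ (hT β β.2)).toLp _) p = 0 := by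
    intro p
    rw [Submodule.mem_orthogonal]
    constructor
    · intro hp
      exact ⟨hp _ (Submodule.subset_span (mem_insert _ _)),
        fun β => hp _ (Submodule.subset_span (mem_insert_of_mem _ ⟨β, rfl⟩))⟩
    · rintro ⟨hp1, hp2⟩ u hu
      induction hu using Submodule.span_induction with
      | mem u hu =>
        rcases hu with rfl | ⟨β, rfl⟩
        · exact hp1
        · exact hp2 β
      | zero => exact inner_zero_left _
      | add u v _ _ hu hv => rw [inner_add_left, hu, hv, add_zero]
      | smul r u _ hu => rw [inner_smul_left, hu, mul_zero]
  set e : Lp ℝ 2 Q := (hmul _ h1).toLp _ with he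
  -- With `p = √ζ α` and `e = √ζ`, the objective is `‖e + p‖²`, minimized over `Nᗮ` by the
  -- projection of `-e`.
  set p : Lp ℝ 2 Q := Nᗮ.starProjection (-e) with hp
  have hpN : p ∈ Nᗮ := Submodule.starProjection_apply_mem _ _
  have hpo : ∀ w ∈ Nᗮ, inner ℝ (e + p) w = 0 := by
    intro w hw
    have := Submodule.starProjection_inner_eq_zero (K := Nᗮ) (-e) w hw
    rw [← hp] at this
    rw [show e + p = -(-e - p) by abel, inner_neg_left, this, neg_zero]
  have hpm : MemLp p 2 Q := Lp.memLp p
  have hpL : hpm.toLp p = p := Lp.toLp_coeFn p hpm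
  set α : Ω → ℝ := fun ω => (σ ω)⁻¹ * p ω with hα
  have hαm : Measurable α := hσm.inv.mul (Lp.stronglyMeasurable p).measurable
  rw [hmemN, ← hpL] at hpN
  have hαS : α ∈ S := by
    refine (h.1 α).2 ⟨⟨hαm, hdiv _ hpm, ?_⟩, fun β hβ => ?_⟩
    · have := hpN.1
      rw [inner_toLp_eq] at this
      rw [← this]
      simp [hα]
    · have := hpN.2 ⟨β, hβ⟩
      rw [inner_toLp_eq] at this
      rw [← this]
      refine integral_congr_ae (Eventually.of_forall fun ω => ?_)
      simp only [hα]
      ring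
  refine ⟨α, hαS, fun α' hα' => ?_⟩
  have lα' := (h.mem_L20 hα').2.1
  have hw : (hmul _ lα').toLp _ ∈ Nᗮ := by
    rw [hmemN]
    refine ⟨?_, fun β => ?_⟩
    · rw [inner_toLp_eq, ← (h.mem_L20 hα').2.2]
      refine integral_congr_ae ?_
      filter_upwards [hσ0] with ω a
      field_simp
    · rw [inner_toLp_eq, ← h.integral_mul hα' β.2]
      refine integral_congr_ae ?_
      filter_upwards [hσ0] with ω a
      field_simp
  have key := hpo _ hw
  rw [← hpL, he, ← MemLp.toLp_add, inner_toLp_eq] at key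
  rw [← key]
  refine integral_congr_ae ?_
  filter_upwards [hσ0, hζ] with ω a b
  have hsq : ζ ω = σ ω * σ ω := (Real.mul_self_sqrt (hc₁.trans b.1).le).symm
  simp only [Pi.add_apply, hα]
  rw [hsq]
  field_simp

theorem integrable_weight_mul [IsProbabilityMeasure Q] (hc₁ : 0 < c₁) (hζm : AEMeasurable ζ Q)
    (hζ : ∀ᵐ ω ∂Q, c₁ < ζ ω ∧ ζ ω < c₂) {f g : Ω → ℝ} (hf : MemLp f 2 Q) (hg : MemLp g 2 Q) :
    Integrable (fun ω => ζ ω * f ω * g ω) Q := by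
  have := memLp_mul_of_bound (c := c₂) hf hζm.aestronglyMeasurable (hζ.mono fun ω a => by
    rw [abs_of_pos (hc₁.trans a.1)]; exact a.2.le)
  exact this.integrable_mul hg

/-- The variational characterization of the solutions of the quadratic problem. -/
theorem OptInvest.Complementary.integral_sq_eq [IsProbabilityMeasure Q]
    (h : Complementary Q S T) (hc₁ : 0 < c₁) (hζm : AEMeasurable ζ Q)
    (hζ : ∀ᵐ ω ∂Q, c₁ < ζ ω ∧ ζ ω < c₂) (hα : α ∈ S)
    (ho : ∀ α' ∈ S, ∫ ω, ζ ω * (1 + α ω) * α' ω ∂Q = 0) (hα' : α' ∈ S) :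
    ∫ ω, ζ ω * (1 + α' ω) ^ 2 ∂Q
      = ∫ ω, ζ ω * (1 + α ω) ^ 2 ∂Q + ∫ ω, ζ ω * (α' ω - α ω) ^ 2 ∂Q := by
  have l1 : MemLp (fun ω => 1 + α ω) 2 Q := (memLp_const (1:ℝ)).add (h.mem_L20 hα).2.1
  have hd := h.sub_mem hα' hα
  have l2 : MemLp (fun ω => α' ω - α ω) 2 Q := (h.mem_L20 hd).2.1
  have i1 := integrable_weight_mul hc₁ hζm hζ l1 l1
  have i2 := integrable_weight_mul hc₁ hζm hζ l1 l2
  have i3 := integrable_weight_mul hc₁ hζm hζ l2 l2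
  have e : ∀ ω, ζ ω * (1 + α' ω) ^ 2 = ζ ω * (1 + α ω) * (1 + α ω)
      + 2 * (ζ ω * (1 + α ω) * (α' ω - α ω)) + ζ ω * (α' ω - α ω) * (α' ω - α ω) := fun ω => by
    ring
  have i12 : Integrable (fun ω => ζ ω * (1 + α ω) * (1 + α ω)
      + 2 * (ζ ω * (1 + α ω) * (α' ω - α ω))) Q := i1.add (i2.const_mul 2)
  simp only [e]
  rw [integral_add i12 i3, integral_add i1 (i2.const_mul 2), integral_const_mul, ho _ hd]
  simp only [mul_zero, add_zero, mul_assoc, pow_two]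

/-- By the Pythagorean identity the excess over the value at `α` is the weighted square of the
distance, nonnegative and zero only at `α`. -/
theorem OptInvest.Complementary.isQuadSol_of_orthogonal [IsProbabilityMeasure Q]
    (h : Complementary Q S T) (hc₁ : 0 < c₁) (hζm : AEMeasurable ζ Q)
    (hζ : ∀ᵐ ω ∂Q, c₁ < ζ ω ∧ ζ ω < c₂) (hα : α ∈ S)
    (ho : ∀ α' ∈ S, ∫ ω, ζ ω * (1 + α ω) * α' ω ∂Q = 0) :
    IsQuadSol Q ζ S α ∧ ∀ α', IsQuadSol Q ζ S α' → α' =ᵐ[Q] α := by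
  have hsq := fun α' (hα' : α' ∈ S) => h.integral_sq_eq hc₁ hζm hζ hα ho hα'
  have hnn : ∀ α' : Ω → ℝ, 0 ≤ᵐ[Q] fun ω => ζ ω * (α' ω - α ω) ^ 2 := fun α' => by
    filter_upwards [hζ] with ω a
    have := hc₁.trans a.1
    simp only [Pi.zero_apply]
    positivity
  have hval : ∫ ω, ζ ω * (1 + α ω) ^ 2 ∂Q = quadValue Q ζ S := by
    refine le_antisymm (le_csInf ⟨_, α, hα, rfl⟩ ?_) (csInf_le ⟨0, ?_⟩ ⟨α, hα, rfl⟩)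
    · rintro _ ⟨α', hα', rfl⟩
      simp only
      rw [hsq α' hα']
      linarith [integral_nonneg_of_ae (hnn α')]
    · rintro _ ⟨α', hα', rfl⟩
      refine integral_nonneg_of_ae ?_
      filter_upwards [hζ] with ω a
      have := hc₁.trans a.1
      simp only [Pi.zero_apply]
      positivity
  refine ⟨⟨hα, hval⟩, fun α' hα' => ?_⟩
  have h1 := hsq α' hα'.1
  rw [hα'.2, hval] at h1
  have h2 : ∫ ω, ζ ω * (α' ω - α ω) ^ 2 ∂Q = 0 := by linarith
  have l2 := (h.mem_L20 (h.sub_mem hα'.1 hα)).2.1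
  have i2 : Integrable (fun ω => ζ ω * (α' ω - α ω) ^ 2) Q :=
    (integrable_weight_mul hc₁ hζm hζ l2 l2).congr (Eventually.of_forall fun ω => by
      simp only; ring)
  rw [integral_eq_zero_iff_of_nonneg_ae (hnn α') i2] at h2
  filter_upwards [h2, hζ] with ω a b
  have hb := hc₁.trans b.1
  simp only [Pi.zero_apply, mul_eq_zero, hb.ne', false_or] at a
  exact sub_eq_zero.1 (pow_eq_zero_iff (by norm_num) |>.1 a)

/-- The complete solution of the quadratic problem. -/
theorem OptInvest.Complementary.exists_isQuadSol [IsProbabilityMeasure Q]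
    (h : Complementary Q S T) (hc₁ : 0 < c₁) (hζm : Measurable ζ)
    (hζ : ∀ᵐ ω ∂Q, c₁ < ζ ω ∧ ζ ω < c₂) :
    ∃ α, IsQuadSol Q ζ S α ∧ (∀ α', IsQuadSol Q ζ S α' → α' =ᵐ[Q] α) ∧
      ∀ α' ∈ S, ∫ ω, ζ ω * (1 + α ω) * α' ω ∂Q = 0 := by
  obtain ⟨α, hα, ho⟩ := h.exists_orthogonal hc₁ hζm hζ
  obtain ⟨h1, h2⟩ := h.isQuadSol_of_orthogonal hc₁ hζm.aemeasurable hζ hα ho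
  exact ⟨α, h1, h2, ho⟩

theorem OptInvest.Complementary.orthogonal_of_isQuadSol [IsProbabilityMeasure Q]
    (h : Complementary Q S T) (hc₁ : 0 < c₁) (hζm : Measurable ζ)
    (hζ : ∀ᵐ ω ∂Q, c₁ < ζ ω ∧ ζ ω < c₂) (hα : IsQuadSol Q ζ S α) :
    ∀ α' ∈ S, ∫ ω, ζ ω * (1 + α ω) * α' ω ∂Q = 0 := by
  obtain ⟨α₀, -, h2, h3⟩ := h.exists_isQuadSol hc₁ hζm hζ
  intro α' hα'
  rw [← h3 α' hα']
  refine integral_congr_ae ?_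
  filter_upwards [h2 α hα] with ω a
  rw [a]

/-- Orthogonality tested with `α` itself removes one factor `1 + α`. This identity normalizes the
dual solution. -/
theorem OptInvest.Complementary.integral_weight_eq [IsProbabilityMeasure Q]
    (h : Complementary Q S T) (hc₁ : 0 < c₁) (hζm : Measurable ζ)
    (hζ : ∀ᵐ ω ∂Q, c₁ < ζ ω ∧ ζ ω < c₂) (hα : IsQuadSol Q ζ S α) :
    ∫ ω, ζ ω * (1 + α ω) ∂Q = quadValue Q ζ S := by
  have ho := h.orthogonal_of_isQuadSol hc₁ hζm hζ hα α hα.1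
  have l1 : MemLp (fun ω => 1 + α ω) 2 Q := (memLp_const (1:ℝ)).add (h.mem_L20 hα.1).2.1
  have i1 : Integrable (fun ω => ζ ω * (1 + α ω)) Q := by
    simpa using integrable_weight_mul hc₁ hζm.aemeasurable hζ l1 (memLp_const (1:ℝ))
  have i2 := integrable_weight_mul hc₁ hζm.aemeasurable hζ l1 (h.mem_L20 hα.1).2.1
  rw [← hα.2, ← add_zero (∫ ω, ζ ω * (1 + α ω) ∂Q), ← ho, ← integral_add i1 i2]
  refine integral_congr_ae (Eventually.of_forall fun ω => ?_)
  simp only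
  ring

/-- Below, `E[(1 + α)²] ≥ 1` because `α` has mean zero; above, the competitor `0` is used. Both are
strict because the pointwise bounds on the weight are. -/
theorem OptInvest.Complementary.quadValue_bounds [IsProbabilityMeasure Q]
    (h : Complementary Q S T) (hc₁ : 0 < c₁) (hζm : Measurable ζ)
    (hζ : ∀ᵐ ω ∂Q, c₁ < ζ ω ∧ ζ ω < c₂) :
    c₁ < quadValue Q ζ S ∧ quadValue Q ζ S < c₂ := by
  obtain ⟨α, hα, -, ho⟩ := h.exists_isQuadSol hc₁ hζm hζ
  obtain ⟨mα, lα, zα⟩ := h.mem_L20 hα.1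
  have l1 : MemLp (fun ω => 1 + α ω) 2 Q := (memLp_const (1:ℝ)).add lα
  have strict : ∀ f g : Ω → ℝ, Integrable f Q → Integrable g Q → (∀ᵐ ω ∂Q, f ω ≤ g ω) →
      ¬ (f =ᵐ[Q] g) → ∫ ω, f ω ∂Q < ∫ ω, g ω ∂Q := by
    intro f g hf hg hle hne
    refine lt_of_le_of_ne (integral_mono_ae hf hg hle) fun heq => hne ?_
    exact (integral_eq_iff_of_ae_le hf hg hle).1 heq
  constructor
  · rw [← hα.2]
    have iα := lα.integrable (by norm_num : (1:ℝ≥0∞) ≤ 2)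
    have isq : Integrable (fun ω => (1 + α ω) ^ 2) Q := l1.integrable_sq
    have hge : 1 ≤ ∫ ω, (1 + α ω) ^ 2 ∂Q := by
      have : ∫ ω, (1 + 2 * α ω) ∂Q ≤ ∫ ω, (1 + α ω) ^ 2 ∂Q := by
        refine integral_mono ((integrable_const _).add (iα.const_mul 2)) isq fun ω => ?_
        simp only
        nlinarith [sq_nonneg (α ω)]
      rw [integral_add (integrable_const _) (iα.const_mul 2), integral_const_mul, zα] at this
      simpa using this
    have iζ : Integrable (fun ω => ζ ω * (1 + α ω) ^ 2) Q :=
      (integrable_weight_mul hc₁ hζm.aemeasurable hζ l1 l1).congr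
        (Eventually.of_forall fun ω => by simp only; ring)
    calc c₁ ≤ c₁ * ∫ ω, (1 + α ω) ^ 2 ∂Q := le_mul_of_one_le_right hc₁.le hge
      _ = ∫ ω, c₁ * (1 + α ω) ^ 2 ∂Q := (integral_const_mul _ _).symm
      _ < _ := by
        refine strict _ _ (isq.const_mul _) iζ ?_ fun heq => ?_
        · filter_upwards [hζ] with ω a
          exact mul_le_mul_of_nonneg_right a.1.le (sq_nonneg _)
        · have : ∫ ω, (1 + α ω) ^ 2 ∂Q = 0 := by
            rw [integral_eq_zero_iff_of_nonneg (fun ω => sq_nonneg _) isq]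
            filter_upwards [heq, hζ] with ω a b
            have h1 : (ζ ω - c₁) * (1 + α ω) ^ 2 = 0 := by linarith
            exact (mul_eq_zero.1 h1).resolve_left (by linarith)
          linarith
  · have iζ : Integrable ζ Q := by
      simpa using integrable_weight_mul hc₁ hζm.aemeasurable hζ (memLp_const (1:ℝ))
        (memLp_const (1:ℝ))
    have hle : quadValue Q ζ S ≤ ∫ ω, ζ ω ∂Q := by
      rw [← hα.2]
      have h2 := h.integral_sq_eq hc₁ hζm.aemeasurable hζ hα.1 ho h.zero_mem
      have h3 : 0 ≤ ∫ ω, ζ ω * (0 - α ω) ^ 2 ∂Q := by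
        refine integral_nonneg_of_ae ?_
        filter_upwards [hζ] with ω a
        have := hc₁.trans a.1
        simp only [Pi.zero_apply]
        positivity
      simp only [add_zero, one_pow, mul_one] at h2
      linarith
    refine hle.trans_lt ?_
    have := strict ζ (fun _ => c₂) iζ (integrable_const _) (hζ.mono fun ω a => a.2.le)
      fun heq => by
        obtain ⟨ω, a, b⟩ := (heq.and hζ).exists
        exact b.2.ne a
    simpa using this

/-- Duality between the quadratic problems on complementary spaces. -/
theorem OptInvest.Complementary.quad_duality [IsProbabilityMeasure Q]
    (h : Complementary Q S T) (hc₁ : 0 < c₁) (hζm : Measurable ζ)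
    (hζ : ∀ᵐ ω ∂Q, c₁ < ζ ω ∧ ζ ω < c₂) (hζm' : Measurable ζ')
    (hζ' : ∀ᵐ ω ∂Q, ζ' ω = 1 / ζ ω) (hα : IsQuadSol Q ζ S α) :
    IsQuadSol Q ζ' T (fun ω => ζ ω * (1 + α ω) / quadValue Q ζ S - 1) ∧
      quadValue Q ζ' T = 1 / quadValue Q ζ S := by
  set a := quadValue Q ζ S with ha
  obtain ⟨hac₁, hac₂⟩ := h.quadValue_bounds hc₁ hζm hζ
  rw [← ha] at hac₁ hac₂
  have ha0 : 0 < a := hc₁.trans hac₁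
  have hc₂ : 0 < c₂ := ha0.trans hac₂
  have ho := h.orthogonal_of_isQuadSol hc₁ hζm hζ hα
  have hint := h.integral_weight_eq hc₁ hζm hζ hα
  rw [← ha] at hint
  obtain ⟨mα, lα, zα⟩ := h.mem_L20 hα.1
  have l1 : MemLp (fun ω => 1 + α ω) 2 Q := (memLp_const (1:ℝ)).add lα
  have lζ : MemLp (fun ω => ζ ω * (1 + α ω)) 2 Q :=
    memLp_mul_of_bound (c := c₂) l1 hζm.aestronglyMeasurable (hζ.mono fun ω a => by
      rw [abs_of_pos (hc₁.trans a.1)]; exact a.2.le)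
  -- Dividing by `a` gives mean zero, and optimality of `α` gives orthogonality to `S`, so `β ∈ T`.
  -- Since `ζ' (1 + β) = (1 + α) / a` is orthogonal to `T`, `β` is optimal.
  set β : Ω → ℝ := fun ω => ζ ω * (1 + α ω) / a - 1 with hβ
  have lβ0 : MemLp (fun ω => ζ ω * (1 + α ω) / a) 2 Q := by
    simpa only [div_eq_inv_mul] using lζ.const_mul a⁻¹
  have lβ : MemLp β 2 Q := lβ0.sub (memLp_const (1:ℝ))
  have hβT : β ∈ T := by
    refine (h.2 β).2 ⟨⟨((hζm.mul (mα.const_add 1)).div_const a).sub_const 1, lβ, ?_⟩,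
      fun α' hα' => ?_⟩
    · rw [hβ, integral_sub (lβ0.integrable (by norm_num)) (integrable_const _), integral_div, hint,
        div_self ha0.ne']
      simp
    · obtain ⟨mα', lα', zα'⟩ := h.mem_L20 hα'
      have e : ∀ ω, α' ω * β ω = ζ ω * (1 + α ω) * α' ω / a - α' ω := fun ω => by
        simp only [hβ]; ring
      simp only [e]
      rw [integral_sub ((integrable_mul_of_memLp lζ lα').div_const a) (lα'.integrable (by norm_num)),
        zα', integral_div, ho α' hα', zero_div, sub_zero]
  have hζb' : ∀ᵐ ω ∂Q, 1 / c₂ < ζ' ω ∧ ζ' ω < 1 / c₁ := by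
    filter_upwards [hζ, hζ'] with ω a b
    rw [b]
    exact ⟨one_div_lt_one_div_of_lt (hc₁.trans a.1) a.2, one_div_lt_one_div_of_lt hc₁ a.1⟩
  have hpt : ∀ᵐ ω ∂Q, ζ' ω * (1 + β ω) = (1 + α ω) / a := by
    filter_upwards [hζ, hζ'] with ω b c
    have := (hc₁.trans b.1).ne'
    rw [c]
    simp only [hβ]
    field_simp
    ring
  have hsol := (h.symm.isQuadSol_of_orthogonal (one_div_pos.2 hc₂) hζm'.aemeasurable hζb' hβT
    (fun β' hβ' => by
      obtain ⟨mβ', lβ', zβ'⟩ := h.symm.mem_L20 hβ'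
      have e : ∫ ω, ζ' ω * (1 + β ω) * β' ω ∂Q = ∫ ω, (a⁻¹ * β' ω + a⁻¹ * (α ω * β' ω)) ∂Q := by
        refine integral_congr_ae ?_
        filter_upwards [hpt] with ω b
        rw [b]
        field_simp
      rw [e, integral_add ((lβ'.integrable (by norm_num)).const_mul _)
        ((integrable_mul_of_memLp lα lβ').const_mul _), integral_const_mul, integral_const_mul, zβ',
        h.integral_mul hα.1 hβ']
      simp)).1
  refine ⟨hsol, ?_⟩
  rw [← h.symm.integral_weight_eq (one_div_pos.2 hc₂) hζm' hζb' hsol]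
  have e : ∫ ω, ζ' ω * (1 + β ω) ∂Q = ∫ ω, (1 + α ω) / a ∂Q :=
    integral_congr_ae hpt
  rw [e, integral_div, integral_add (integrable_const _) (lα.integrable (by norm_num)), zα]
  simp

end Quadratic

/-! ### The tilted measure and expansions along bounded directions -/

section Tilt

variable {Ω : Type*} [MeasurableSpace Ω] {P Q : Measure Ω} {K D : Set (Ω → ℝ)}
  {F φ ζ w : ℝ → ℝ} {c₁ c₂ m x y η : ℝ} {f g h α ρ : Ω → ℝ}

/-- `Q` is an equivalent probability measure with density `ρ / m` with respect to `P`. -/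
structure IsTilt (P Q : Measure Ω) (ρ : Ω → ℝ) (m : ℝ) : Prop where
  prob : IsProbabilityMeasure Q
  ac : Q ≪ P
  ac' : P ≪ Q
  integrable_iff : ∀ f : Ω → ℝ, Integrable f Q ↔ Integrable (fun ω => ρ ω * f ω) P
  integral_eq : ∀ f : Ω → ℝ, ∫ ω, ρ ω * f ω ∂P = m * ∫ ω, f ω ∂Q

theorem isTilt_withDensity (hρ : Integrable ρ P) (hpos : ∀ᵐ ω ∂P, 0 < ρ ω)
    (hm : 0 < m) (hint : ∫ ω, ρ ω ∂P = m) :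
    IsTilt P (P.withDensity fun ω => ENNReal.ofReal (ρ ω / m)) ρ m := by
  have hmeas : AEMeasurable (fun ω => ENNReal.ofReal (ρ ω / m)) P :=
    (hρ.aestronglyMeasurable.aemeasurable.div_const m).ennreal_ofReal
  have hfin : ∀ᵐ ω ∂P, ENNReal.ofReal (ρ ω / m) < ∞ :=
    Eventually.of_forall fun ω => ENNReal.ofReal_lt_top
  refine ⟨⟨?_⟩, withDensity_absolutelyContinuous _ _,
    withDensity_absolutelyContinuous' hmeas ?_, fun f => ?_, fun f => ?_⟩
  · rw [withDensity_apply _ MeasurableSet.univ, Measure.restrict_univ,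
      ← ofReal_integral_eq_lintegral_ofReal (hρ.div_const m), integral_div, hint, div_self hm.ne',
      ENNReal.ofReal_one]
    filter_upwards [hpos] with ω h
    exact (div_pos h hm).le
  · filter_upwards [hpos] with ω h
    exact (ENNReal.ofReal_pos.2 (div_pos h hm)).ne'
  · rw [integrable_withDensity_iff_integrable_smul₀' hmeas hfin]
    have hm' : IsUnit (m⁻¹) := isUnit_iff_ne_zero.2 (inv_pos.2 hm).ne'
    rw [← integrable_const_mul_iff hm' (fun ω => ρ ω * f ω)]
    refine integrable_congr ?_
    filter_upwards [hpos] with ω h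
    rw [ENNReal.toReal_ofReal (div_pos h hm).le, smul_eq_mul]
    ring
  · rw [integral_withDensity_eq_integral_toReal_smul₀ hmeas hfin, ← integral_const_mul]
    refine integral_congr_ae ?_
    filter_upwards [hpos] with ω h
    rw [ENNReal.toReal_ofReal (div_pos h hm).le, smul_eq_mul]
    field_simp

theorem measR_comm (x y : ℝ) (g h : Ω → ℝ) : measR P x y g h = measR P y x h g := by
  unfold measR
  simp only [mul_comm]

theorem IsOpt.isTilt (hF : PowerLike F φ ζ c₁ c₂) (hg : IsOpt P F φ K x y g) (hx : 0 < x)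
    (hy : 0 < y) (hh : h =ᵐ[P] fun ω => φ (g ω)) :
    IsTilt P (measR P x y g h) (fun ω => g ω * φ (g ω)) (x * y) := by
  have e : measR P x y g h
      = P.withDensity (fun ω => ENNReal.ofReal (g ω * φ (g ω) / (x * y))) := by
    refine withDensity_congr_ae ?_
    filter_upwards [hh] with ω e
    rw [e]
  rw [e]
  refine isTilt_withDensity hg.integrable_mul ?_ (mul_pos hx hy) hg.integral_mul
  filter_upwards [hg.pos] with ω h
  exact mul_pos h (hF.pos _ h)

/-- The multiplier inequality holds at both `g (1 + c α)` and `g (1 - c α)` and is an equality at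
`g`, so the first-order term vanishes. -/
theorem integral_mul_direction_eq_zero (hg : IsOpt P F φ K x y g)
    (hα : α ∈ bddDirections P K x g) :
    Integrable (fun ω => g ω * φ (g ω) * α ω) P ∧ ∫ ω, g ω * φ (g ω) * α ω ∂P = 0 := by
  obtain ⟨-, -, c, hc, hp, hn⟩ := hα
  obtain ⟨i1, l1⟩ := hg.le _ hp
  obtain ⟨i2, l2⟩ := hg.le _ hn
  have i : Integrable (fun ω => g ω * φ (g ω) * α ω) P := by
    refine ((i1.sub hg.integrable_mul).const_mul c⁻¹).congr (Eventually.of_forall fun ω => ?_)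
    simp only [Pi.sub_apply]
    field_simp
    ring
  have ic := i.const_mul c
  have e1 : ∫ ω, g ω * (1 + c * α ω) * φ (g ω) ∂P
      = x * y + c * ∫ ω, g ω * φ (g ω) * α ω ∂P := by
    rw [← hg.integral_mul, ← integral_const_mul, ← integral_add hg.integrable_mul ic]
    exact integral_congr_ae (Eventually.of_forall fun ω => by simp only; ring)
  have e2 : ∫ ω, g ω * (1 - c * α ω) * φ (g ω) ∂P
      = x * y - c * ∫ ω, g ω * φ (g ω) * α ω ∂P := by
    rw [← hg.integral_mul, ← integral_const_mul, ← integral_sub hg.integrable_mul ic]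
    exact integral_congr_ae (Eventually.of_forall fun ω => by simp only; ring)
  refine ⟨i, ?_⟩
  rw [e1] at l1
  rw [e2] at l2
  have : c * ∫ ω, g ω * φ (g ω) * α ω ∂P = 0 := by linarith
  exact (mul_eq_zero.1 this).resolve_left hc.ne'

theorem eventually_mem_scaled_of_direction (hD : ∀ h ∈ D, Measurable h) (hx : 0 < x)
    (hα : α ∈ bddDirections P (polar P D) x g) :
    ∀ᶠ ε in 𝓝 (0:ℝ), (fun ω => g ω * (1 + ε * ((1 + α ω) / x))) ∈ scaled (x + ε) (polar P D) := by
  obtain ⟨-, -, c, hc, hp, hn⟩ := hα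
  have t1 : ContinuousAt (fun ε : ℝ => ε / x / (1 + ε / x)) 0 := by
    refine ContinuousAt.div (by fun_prop) (by fun_prop) (by simp)
  have e1 : ∀ᶠ ε in 𝓝 (0:ℝ), |ε / x / (1 + ε / x)| < c := by
    have := t1.abs.tendsto
    simp only [zero_div, abs_zero] at this
    exact this.eventually (gt_mem_nhds hc)
  filter_upwards [e1, Metric.ball_mem_nhds (0:ℝ) hx] with ε h1 h2
  rw [Metric.mem_ball, dist_zero_right, Real.norm_eq_abs] at h2
  have hs : 0 < 1 + ε / x := by
    have : 0 < (x + ε) / x := div_pos (by linarith [(abs_lt.1 h2).1]) hx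
    rwa [add_div, div_self hx.ne'] at this
  -- The competitor factors as `g (1 + κ α) (1 + ε / x)`. For `|κ| < c` the first part is a convex
  -- combination of `g (1 ± c α)`, and the last factor changes the capital to `x + ε`.
  set κ := ε / x / (1 + ε / x) with hκ
  obtain ⟨k1, k2⟩ := abs_lt.1 h1
  have hδ0 : 0 < (1 + κ / c) / 2 := by
    have : -1 < κ / c := by rw [lt_div_iff₀ hc]; linarith
    linarith
  have hδ1 : (1 + κ / c) / 2 < 1 := by
    have : κ / c < 1 := by rw [div_lt_one hc]; exact k2
    linarith
  have h3 := mul_one_add_mem_scaled (ε / x) (scaled_polar_convex hD hx hn hp hδ0 hδ1)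
  have e : x * (1 + ε / x) = x + ε := by field_simp
  rw [e] at h3
  convert h3 using 2 with ω
  have : κ * (1 + ε / x) = ε / x := div_mul_cancel₀ _ hs.ne'
  have h4 : (1 - (1 + κ / c) / 2) * (g ω * (1 - c * α ω)) + (1 + κ / c) / 2 * (g ω * (1 + c * α ω))
      = g ω * (1 + κ * α ω) := by field_simp; ring
  rw [h4]
  have h5 : g ω * (1 + κ * α ω) * (1 + ε / x) = g ω * (1 + ε / x + κ * (1 + ε / x) * α ω) := by ring
  rw [h5, this]
  ring

/-- The second-order upper bound for the expected value along a bounded direction. -/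
theorem upper_expansion_of_direction (hD : ∀ h ∈ D, Measurable h) (hF : PowerLike F φ ζ c₁ c₂)
    (hw : IsValueFn P F φ (polar P D) w) (hx : 0 < x)
    (hgm : Measurable g) (hg : IsOpt P F φ (polar P D) x y g)
    (hQ : IsTilt P Q (fun ω => g ω * φ (g ω)) (x * y))
    (hα : α ∈ bddDirections P (polar P D) x g) (hη : 0 < η) :
    ∀ᶠ ε in 𝓝[≠] (0:ℝ),
      (fun ω => g ω * (1 + ε * ((1 + α ω) / x))) ∈ scaled (x + ε) (polar P D) ∧
      (∀ᵐ ω ∂P, |ε * ((1 + α ω) / x)| ≤ 1 / 2) ∧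
      ∫ ω, F (g ω * (1 + ε * ((1 + α ω) / x))) ∂P
        ≤ w x - y * ε + (y / (2 * x) * ∫ ω, ζ (g ω) * (1 + α ω) ^ 2 ∂Q + η) * ε ^ 2 := by
  have hα' := hα
  obtain ⟨hαm, ⟨M, hM⟩, -⟩ := hα
  obtain ⟨iα, zα⟩ := integral_mul_direction_eq_zero hg hα'
  set γ : Ω → ℝ := fun ω => (1 + α ω) / x with hγ
  have hγm : Measurable γ := (hαm.const_add 1).div_const x
  set N := (1 + |M|) / x with hN
  have hN0 : 0 < N := by positivity
  have hγN : ∀ᵐ ω ∂P, |γ ω| ≤ N := by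
    filter_upwards [hM] with ω h
    rw [hγ, hN]
    simp only
    rw [abs_div, abs_of_pos hx]
    gcongr
    refine (abs_add_le _ _).trans ?_
    rw [abs_one]
    linarith [le_abs_self M]
  have hsmall : ∀ᶠ ε in 𝓝[≠] (0:ℝ), ∀ᵐ ω ∂P, |ε * γ ω| ≤ 1 / 2 := by
    have : ∀ᶠ ε in 𝓝[≠] (0:ℝ), |ε| < 1 / (2 * N) := by
      refine nhdsWithin_le_nhds ?_
      filter_upwards [Metric.ball_mem_nhds (0:ℝ) (show 0 < 1 / (2 * N) by positivity)] with ε hε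
      rwa [Metric.mem_ball, dist_zero_right, Real.norm_eq_abs] at hε
    filter_upwards [this] with ε hε
    filter_upwards [hγN] with ω h
    rw [abs_mul]
    calc |ε| * |γ ω| ≤ 1 / (2 * N) * N := by gcongr
      _ = 1 / 2 := by field_simp
  -- Dominated convergence: the pointwise Peano expansion under the integrable majorant from
  -- `second_order_bound`. Boundedness of `α` is essential here.
  have hlim : Tendsto (fun ε : ℝ => ∫ ω, (F (g ω * (1 + ε * γ ω)) - F (g ω)
      + φ (g ω) * (g ω * (ε * γ ω))) / ε ^ 2 ∂P) (𝓝[≠] 0)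
      (𝓝 (∫ ω, ζ (g ω) * (g ω * φ (g ω)) * γ ω ^ 2 / 2 ∂P)) := by
    refine tendsto_integral_filter_of_dominated_convergence
      (fun ω => c₂ * 2 ^ c₂ * 2 * (g ω * φ (g ω)) * N ^ 2) ?_ ?_ ?_ ?_
    · filter_upwards [hsmall] with ε hε
      exact ((hg.integrable_scale hF hgm (hγm.const_mul ε) hε).1.div_const
        (ε ^ 2)).aestronglyMeasurable
    · filter_upwards [hsmall, self_mem_nhdsWithin] with ε hε hne
      filter_upwards [hε, hg.pos, hγN] with ω h1 h2 h3
      have hε2 : 0 < ε ^ 2 := by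
        have : ε ≠ 0 := hne
        positivity
      rw [Real.norm_eq_abs, abs_div, abs_of_pos hε2, div_le_iff₀ hε2]
      refine (hF.second_order_bound h2 h1).trans ?_
      have hC := hF.c₂_pos
      have hφ := hF.pos _ h2
      have : γ ω ^ 2 ≤ N ^ 2 := by rw [← sq_abs]; gcongr
      rw [mul_pow, mul_assoc _ (N ^ 2), mul_comm (N ^ 2)]
      gcongr
    · exact (hg.integrable_mul.const_mul _).mul_const _
    · filter_upwards [hg.pos] with ω h
      exact hF.tendsto_second_order h (γ ω)
  have hval : ∫ ω, ζ (g ω) * (g ω * φ (g ω)) * γ ω ^ 2 / 2 ∂P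
      = y / (2 * x) * ∫ ω, ζ (g ω) * (1 + α ω) ^ 2 ∂Q := by
    have e : ∫ ω, ζ (g ω) * (g ω * φ (g ω)) * γ ω ^ 2 / 2 ∂P
        = ∫ ω, 1 / (2 * x ^ 2) * (g ω * φ (g ω) * (ζ (g ω) * (1 + α ω) ^ 2)) ∂P := by
      refine integral_congr_ae (Eventually.of_forall fun ω => ?_)
      simp only [hγ]
      field_simp
    rw [e, integral_const_mul, hQ.integral_eq]
    field_simp
  rw [hval] at hlim
  have hev := hlim.eventually (gt_mem_nhds (show _ < y / (2 * x) * ∫ ω, ζ (g ω) * (1 + α ω) ^ 2 ∂Q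
    + η by linarith))
  filter_upwards [hev, hsmall, self_mem_nhdsWithin,
    nhdsWithin_le_nhds (eventually_mem_scaled_of_direction hD hx hα')] with ε h1 h2 hne h3
  refine ⟨h3, h2, ?_⟩
  have hε2 : 0 < ε ^ 2 := by
    have : ε ≠ 0 := hne
    positivity
  rw [integral_div, div_lt_iff₀ hε2] at h1
  obtain ⟨i1, i2⟩ := hg.integrable_scale hF hgm (hγm.const_mul ε) h2
  have i3 : Integrable (fun ω => φ (g ω) * (g ω * (ε * γ ω))) P := by
    refine ((hg.integrable_mul.add iα).const_mul (ε / x)).congr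
      (Eventually.of_forall fun ω => ?_)
    simp only [Pi.add_apply, hγ]
    ring
  have e3 : ∫ ω, φ (g ω) * (g ω * (ε * γ ω)) ∂P = y * ε := by
    calc ∫ ω, φ (g ω) * (g ω * (ε * γ ω)) ∂P
        = ∫ ω, ε / x * (g ω * φ (g ω) + g ω * φ (g ω) * α ω) ∂P := by
          refine integral_congr_ae (Eventually.of_forall fun ω => ?_)
          simp only [hγ]
          ring
      _ = y * ε := by
          rw [integral_const_mul, integral_add hg.integrable_mul iα, zα, hg.integral_mul]
          field_simp
          ring
  have i4 : Integrable (fun ω => F (g ω * (1 + ε * γ ω)) - F (g ω)) P := i2.sub hg.integrable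
  rw [integral_add i4 i3, integral_sub i2 hg.integrable, e3, ← hw.eq hF hx hg] at h1
  linarith

end Tilt

/-! ### Second-order expansions of convex functions -/

section Expansion

variable {w w' w₁ w₂ : ℝ → ℝ} {A x y : ℝ}

/-- A second-order upper bound for one of two conjugate functions gives a second-order lower bound
for the other one. -/
theorem lower_expansion_of_conjugate (hx : 0 < x) (hy : 0 < y) (hA : 0 < A)
    (hc : ∀ x' y', 0 < x' → 0 < y' → 0 ≤ w₁ x' + w₂ y' + x' * y')
    (he : w₁ x + w₂ y + x * y = 0)
    (hup : ∀ η > 0, ∀ᶠ δ in 𝓝[≠] (0:ℝ),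
      w₂ (y + δ) ≤ w₂ y - x * δ + (1 / (2 * A) + η) * δ ^ 2) :
    ∀ η > 0, ∀ᶠ ε in 𝓝[≠] (0:ℝ), w₁ x - y * ε + (A / 2 - η) * ε ^ 2 ≤ w₁ (x + ε) := by
  intro η hη
  -- In `w₁(x + ε) ≥ -w₂(y + δ) - (x + ε)(y + δ)` the choice `δ = -A ε` maximizes the quadratic part
  -- `-ε δ - δ² / (2 A)`.
  have ht : Tendsto (fun ε : ℝ => -(A * ε)) (𝓝[≠] 0) (𝓝[≠] 0) := by
    refine tendsto_nhdsWithin_iff.2 ⟨?_, ?_⟩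
    · have : Continuous fun ε : ℝ => -(A * ε) := by fun_prop
      have := this.tendsto 0
      simp only [mul_zero, neg_zero] at this
      exact this.mono_left nhdsWithin_le_nhds
    · filter_upwards [self_mem_nhdsWithin] with ε hε
      exact neg_ne_zero.2 (mul_ne_zero hA.ne' hε)
  have hη' : 0 < η / A ^ 2 := by positivity
  filter_upwards [ht.eventually (hup _ hη'),
    nhdsWithin_le_nhds (Metric.ball_mem_nhds (0:ℝ) hx),
    nhdsWithin_le_nhds (Metric.ball_mem_nhds (0:ℝ) (div_pos hy hA))] with ε h1 h2 h3
  rw [Metric.mem_ball, dist_zero_right, Real.norm_eq_abs] at h2 h3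
  have h4 : ε * A < y := by rw [← lt_div_iff₀ hA]; exact (abs_lt.1 h3).2
  have h5 := hc (x + ε) (y + -(A * ε)) (by linarith [(abs_lt.1 h2).1]) (by linarith)
  have e : (1 / (2 * A) + η / A ^ 2) * (-(A * ε)) ^ 2 = (A / 2 + η) * ε ^ 2 := by
    field_simp
  rw [e] at h1
  nlinarith

/-- An expansion of `w` alone says nothing about the derivative of `w'`; convexity supplies the
missing monotonicity. The subgradient inequality at `x + ε`, tested at distance `τ = ±θ |ε|`, bounds
the increment of `w'` from both sides. -/
theorem hasDerivAt_of_expansion (hx : 0 < x)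
    (hd : ∀ t t', 0 < t → 0 < t' → w t + w' t * (t' - t) ≤ w t')
    (hexp : ∀ η > 0, ∀ᶠ ε in 𝓝[≠] (0:ℝ),
      |w (x + ε) - w x - w' x * ε - A / 2 * ε ^ 2| ≤ η * ε ^ 2) :
    HasDerivAt w' A x := by
  rw [hasDerivAt_iff_isLittleO_nhds_zero, Asymptotics.isLittleO_iff]
  intro e he
  set θ := min (1 / 2) (e / (|A| + 1)) with hθ
  have hθ0 : 0 < θ := lt_min (by norm_num) (by positivity)
  have hθ1 : θ ≤ 1 / 2 := min_le_left _ _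
  have hθ2 : |A| * θ ≤ e := by
    have h1 : θ ≤ e / (|A| + 1) := min_le_right _ _
    rw [le_div_iff₀ (by positivity)] at h1
    nlinarith
  -- After division by `θ |ε|`, the curvature term and the expansion error each contribute at most
  -- `e / 2 * |ε|`.
  set η := θ * e / 8 with hη
  have hη0 : 0 < η := by positivity
  have h1 := hexp η hη0
  rw [eventually_nhdsWithin_iff, Metric.eventually_nhds_iff] at h1
  obtain ⟨r, hr, h1⟩ := h1
  have h1' : ∀ ε, |ε| < r → |w (x + ε) - w x - w' x * ε - A / 2 * ε ^ 2| ≤ η * ε ^ 2 := by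
    intro ε hε
    by_cases h0 : ε = 0
    · subst h0; simp
    · exact h1 (by rwa [dist_zero_right, Real.norm_eq_abs]) h0
  have hR : 0 < min r x / 2 := by positivity
  filter_upwards [Metric.ball_mem_nhds (0:ℝ) hR] with ε hε
  rw [Metric.mem_ball, dist_zero_right, Real.norm_eq_abs] at hε
  rw [Real.norm_eq_abs, Real.norm_eq_abs, smul_eq_mul]
  by_cases h0 : ε = 0
  · subst h0; simp
  have hεp : 0 < |ε| := abs_pos.2 h0
  have hr1 : 2 * |ε| < r := by linarith [min_le_left r x]
  have hx1 : 2 * |ε| < x := by linarith [min_le_right r x]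
  have key : ∀ τ, |τ| = θ * |ε| →
      (w' (x + ε) - w' x - ε * A) * τ ≤ |A| * θ ^ 2 / 2 * ε ^ 2 + 4 * η * ε ^ 2 := by
    intro τ hτ
    have hτ1 : |τ| ≤ |ε| / 2 := by rw [hτ]; nlinarith
    have hs : |ε + τ| ≤ 3 / 2 * |ε| := (abs_add_le _ _).trans (by linarith)
    have p1 : 0 < x + ε := by linarith [neg_abs_le ε]
    have p2 : 0 < x + (ε + τ) := by linarith [neg_abs_le (ε + τ)]
    have a1 := (abs_le.1 (h1' ε (by linarith))).1
    have a2 := (abs_le.1 (h1' (ε + τ) (by linarith))).2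
    have a3 := hd _ _ p1 p2
    have a4 : (ε + τ) ^ 2 ≤ 9 / 4 * ε ^ 2 := by
      rw [← sq_abs, ← sq_abs ε]; nlinarith [abs_nonneg (ε + τ)]
    have a5 : A * τ ^ 2 ≤ |A| * θ ^ 2 * ε ^ 2 := by
      rw [← sq_abs τ, hτ, mul_pow, sq_abs, ← mul_assoc]
      gcongr
      exact le_abs_self A
    have a6 : η * (ε + τ) ^ 2 ≤ η * (9 / 4 * ε ^ 2) := by gcongr
    have a7 : 0 ≤ η * ε ^ 2 := by positivity
    have e1 : x + (ε + τ) - (x + ε) = τ := by ring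
    rw [e1] at a3
    nlinarith
  have k1 := key (θ * |ε|) (by rw [abs_mul, abs_abs, abs_of_pos hθ0])
  have k2 := key (-(θ * |ε|)) (by rw [abs_neg, abs_mul, abs_abs, abs_of_pos hθ0])
  have k3 : |w' (x + ε) - w' x - ε * A| * (θ * |ε|) ≤ e * |ε| * (θ * |ε|) := by
    have b1 : |w' (x + ε) - w' x - ε * A| * (θ * |ε|)
        ≤ |A| * θ ^ 2 / 2 * ε ^ 2 + 4 * η * ε ^ 2 := by
      rcases abs_cases (w' (x + ε) - w' x - ε * A) with ⟨h, -⟩ | ⟨h, -⟩ <;> rw [h] <;> linarith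
    refine b1.trans ?_
    have b2 : e * |ε| * (θ * |ε|) = e * θ * ε ^ 2 := by rw [← sq_abs ε]; ring
    rw [b2, hη, ← add_mul]
    gcongr
    nlinarith
  exact le_of_mul_le_mul_right k3 (by positivity)

end Expansion

/-! ### Approximation by bounded directions -/

section Approximation

variable {Ω : Type*} [MeasurableSpace Ω] {Q : Measure Ω} {S : Set (Ω → ℝ)} {σ α f : Ω → ℝ}
  {c₁ c₂ η d : ℝ}

theorem integral_sq_le_of_eLpNorm_le (hf : MemLp f 2 Q) (hd : 0 ≤ d)
    (h : eLpNorm f 2 Q ≤ ENNReal.ofReal d) : ∫ ω, f ω ^ 2 ∂Q ≤ d ^ 2 := by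
  have h2 : 2 ≠ (0 : ℝ≥0∞) := two_ne_zero
  have e := hf.eLpNorm_eq_integral_rpow_norm h2 ENNReal.ofNat_ne_top
  rw [e] at h
  have h3 := (ENNReal.ofReal_le_ofReal_iff hd).1 h
  have e2 : ∫ ω, ‖f ω‖ ^ (2 : ℝ≥0∞).toReal ∂Q = ∫ ω, f ω ^ 2 ∂Q := by
    refine integral_congr_ae (Eventually.of_forall fun ω => ?_)
    simp only [ENNReal.toReal_ofNat, Real.rpow_ofNat, Real.norm_eq_abs, sq_abs]
  rw [e2] at h3
  have h0 : 0 ≤ ∫ ω, f ω ^ 2 ∂Q := integral_nonneg fun ω => sq_nonneg _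
  have e3 : (∫ ω, f ω ^ 2 ∂Q) = ((∫ ω, f ω ^ 2 ∂Q) ^ ((2 : ℝ≥0∞).toReal)⁻¹) ^ 2 := by
    rw [ENNReal.toReal_ofNat, ← Real.rpow_natCast, ← Real.rpow_mul h0]
    norm_num
  rw [e3]
  exact pow_le_pow_left₀ (by positivity) h3 2

/-- The expansions are available for bounded directions only, while the quadratic optimizer lies in
their closure. A weight bounded by `c₂` makes the quadratic functional continuous in `L²`. -/
theorem exists_direction_approx [IsProbabilityMeasure Q] (hc₁ : 0 < c₁)
    (hσm : AEMeasurable σ Q) (hσ : ∀ᵐ ω ∂Q, c₁ < σ ω ∧ σ ω < c₂)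
    (hS : ∀ f ∈ S, Measurable f) (hα : α ∈ closureL20 Q S) (hη : 0 < η) :
    ∃ f ∈ S, MemLp f 2 Q ∧ ∫ ω, (f ω - α ω) ^ 2 ∂Q ≤ η ∧
      ∫ ω, σ ω * (1 + f ω) ^ 2 ∂Q ≤ ∫ ω, σ ω * (1 + α ω) ^ 2 ∂Q + η := by
  obtain ⟨⟨hαm, hα2, -⟩, happ⟩ := hα
  have hint : ∀ f : Ω → ℝ, MemLp f 2 Q → Integrable (fun ω => σ ω * f ω ^ 2) Q := by
    intro f hf
    refine (hf.integrable_sq.const_mul c₂).mono'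
      (hσm.aestronglyMeasurable.mul hf.integrable_sq.aestronglyMeasurable) ?_
    filter_upwards [hσ] with ω h
    rw [Real.norm_eq_abs, abs_of_nonneg (mul_nonneg (by linarith) (sq_nonneg _))]
    exact mul_le_mul_of_nonneg_right h.2.le (sq_nonneg _)
  have h1α : MemLp (fun ω => 1 + α ω) 2 Q := (memLp_const (1:ℝ)).add hα2
  set I := ∫ ω, σ ω * (1 + α ω) ^ 2 ∂Q with hI
  have hI0 : 0 ≤ I := by
    refine integral_nonneg_of_ae ?_
    filter_upwards [hσ] with ω h
    exact mul_nonneg (by linarith) (sq_nonneg _)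
  -- Parameter in Young's inequality `(1 + f)² ≤ (1 + θ)(1 + α)² + (1 + 1/θ)(α - f)²`; `θ` and the
  -- distance `r` each account for `η / 2`.
  set θ := η / (2 * (I + 1)) with hθ
  have hθ0 : 0 < θ := by positivity
  have hc₂ : 0 < c₂ := by
    obtain ⟨ω, h⟩ := hσ.exists
    linarith
  set r := min η (η / (2 * (c₂ * (1 + 1 / θ)))) with hr
  have hr0 : 0 < r := lt_min hη (by positivity)
  obtain ⟨f, hfS, hf⟩ := happ (ENNReal.ofReal (Real.sqrt r)) (ENNReal.ofReal_pos.2 (Real.sqrt_pos.2 hr0))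
  have hd2 : MemLp (fun ω => α ω - f ω) 2 Q :=
    ⟨(hαm.sub (hS f hfS)).aestronglyMeasurable, hf.trans ENNReal.ofReal_lt_top⟩
  have hf2 : MemLp f 2 Q := by
    refine (hα2.sub hd2).ae_eq (Eventually.of_forall fun ω => ?_)
    simp only [Pi.sub_apply]
    ring
  have hle := integral_sq_le_of_eLpNorm_le hd2 (Real.sqrt_nonneg r) hf.le
  rw [Real.sq_sqrt hr0.le] at hle
  refine ⟨f, hfS, hf2, ?_, ?_⟩
  · have e : ∫ ω, (f ω - α ω) ^ 2 ∂Q = ∫ ω, (α ω - f ω) ^ 2 ∂Q :=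
      integral_congr_ae (Eventually.of_forall fun ω => by simp only; ring)
    rw [e]
    exact hle.trans (min_le_left _ _)
  · have h1f : MemLp (fun ω => 1 + f ω) 2 Q := (memLp_const (1:ℝ)).add hf2
    have i1 := (hint _ h1α).const_mul (1 + θ)
    have i2 := hd2.integrable_sq.const_mul (c₂ * (1 + 1 / θ))
    calc ∫ ω, σ ω * (1 + f ω) ^ 2 ∂Q
        ≤ ∫ ω, ((1 + θ) * (σ ω * (1 + α ω) ^ 2) + c₂ * (1 + 1 / θ) * (α ω - f ω) ^ 2) ∂Q := by
          refine integral_mono_ae (hint _ h1f) (i1.add i2) ?_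
          filter_upwards [hσ] with ω h
          have hq : (1 + f ω) ^ 2 ≤ (1 + θ) * (1 + α ω) ^ 2 + (1 + 1 / θ) * (α ω - f ω) ^ 2 := by
            have e : (1 + θ) * (1 + α ω) ^ 2 + (1 + 1 / θ) * (α ω - f ω) ^ 2 - (1 + f ω) ^ 2
                = (θ * (1 + α ω) + (α ω - f ω)) ^ 2 / θ := by field_simp; ring
            have : 0 ≤ (θ * (1 + α ω) + (α ω - f ω)) ^ 2 / θ := by positivity
            linarith
          have hs0 : 0 < σ ω := by linarith
          calc σ ω * (1 + f ω) ^ 2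
              ≤ σ ω * ((1 + θ) * (1 + α ω) ^ 2 + (1 + 1 / θ) * (α ω - f ω) ^ 2) := by gcongr
            _ = (1 + θ) * (σ ω * (1 + α ω) ^ 2) + σ ω * ((1 + 1 / θ) * (α ω - f ω) ^ 2) := by ring
            _ ≤ (1 + θ) * (σ ω * (1 + α ω) ^ 2) + c₂ * ((1 + 1 / θ) * (α ω - f ω) ^ 2) := by
                gcongr; exact h.2.le
            _ = _ := by ring
      _ = (1 + θ) * I + c₂ * (1 + 1 / θ) * ∫ ω, (α ω - f ω) ^ 2 ∂Q := by
          rw [integral_add i1 i2, integral_const_mul, integral_const_mul]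
      _ ≤ (1 + θ) * I + c₂ * (1 + 1 / θ) * (η / (2 * (c₂ * (1 + 1 / θ)))) := by
          gcongr
          exact hle.trans (min_le_right _ _)
      _ ≤ I + η := by
          have e1 : c₂ * (1 + 1 / θ) * (η / (2 * (c₂ * (1 + 1 / θ)))) = η / 2 := by
            have : 0 < c₂ * (1 + 1 / θ) := by positivity
            field_simp
          have e2 : θ * I ≤ η / 2 := by
            rw [hθ, div_mul_eq_mul_div, div_le_div_iff₀ (by positivity) two_pos]
            nlinarith
          linarith

end Approximation

/-! ### Upper expansion and convergence of the optimizers -/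

section SecondOrder

variable {Ω : Type*} [MeasurableSpace Ω] {P Q : Measure Ω} {K D : Set (Ω → ℝ)}
  {F φ ζ w : ℝ → ℝ} {c₁ c₂ x y η : ℝ} {g α : Ω → ℝ}

/-- The finite measure with density `r` dominates `P`, and absolute continuity is uniform over sets.
It converts smallness in a positive weight into smallness in probability. -/
theorem tendsto_measure_zero_of_lintegral [IsFiniteMeasure P] {ι : Type*} {l : Filter ι}
    {s : ι → Set Ω} {r : Ω → ℝ≥0∞} (hs : ∀ i, MeasurableSet (s i)) (hr : AEMeasurable r P)
    (hpos : ∀ᵐ ω ∂P, r ω ≠ 0) (hfin : ∫⁻ ω, r ω ∂P ≠ ∞)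
    (h : Tendsto (fun i => ∫⁻ ω in s i, r ω ∂P) l (𝓝 0)) : Tendsto (fun i => P (s i)) l (𝓝 0) := by
  have : IsFiniteMeasure (P.withDensity r) := isFiniteMeasure_withDensity hfin
  have hac : P ≪ P.withDensity r := withDensity_absolutelyContinuous' hr hpos
  have h1 := tendsto_setLIntegral_zero (μ := P.withDensity r) (f := P.rnDeriv (P.withDensity r))
    (Measure.lintegral_rnDeriv_lt_top P (P.withDensity r)).ne (l := l) (s := s)
    (by
      refine h.congr fun i => ?_
      rw [Function.comp_apply, withDensity_apply _ (hs i)])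
  refine h1.congr fun i => ?_
  exact Measure.setLIntegral_rnDeriv hac (s i)

theorem measurable_of_bddDirections {f : Ω → ℝ} (hf : f ∈ bddDirections P K x g) :
    Measurable f := hf.1

theorem IsTilt.ae_elasticity (hQ : IsTilt P Q (fun ω => g ω * φ (g ω)) (x * y))
    (hF : PowerLike F φ ζ c₁ c₂) (hg : IsOpt P F φ K x y g) :
    ∀ᵐ ω ∂Q, c₁ < ζ (g ω) ∧ ζ (g ω) < c₂ := by
  refine hQ.ac.ae_le ?_
  filter_upwards [hg.pos] with ω h
  exact ⟨hF.lower _ h, hF.upper _ h⟩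

/-- The value function is bounded above to the second order by the quadratic problem. -/
theorem IsValueFn.upper_expansion (hD : ∀ h ∈ D, Measurable h) (hF : PowerLike F φ ζ c₁ c₂)
    (hw : IsValueFn P F φ (polar P D) w) (hx : 0 < x) (hy : 0 < y)
    (hgm : Measurable g) (hg : IsOpt P F φ (polar P D) x y g)
    (hQ : IsTilt P Q (fun ω => g ω * φ (g ω)) (x * y)) (hc₁ : 0 < c₁)
    (hζm : AEMeasurable (fun ω => ζ (g ω)) Q)
    (hα : α ∈ closureL20 Q (bddDirections P (polar P D) x g)) (hη : 0 < η) :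
    ∀ᶠ ε in 𝓝[≠] (0:ℝ), w (x + ε)
      ≤ w x - y * ε + (y / (2 * x) * ∫ ω, ζ (g ω) * (1 + α ω) ^ 2 ∂Q + η) * ε ^ 2 := by
  have := hQ.prob
  set η' := η / 2 / (y / (2 * x)) with hη'
  have hη0 : 0 < η' := by positivity
  obtain ⟨f, hf, -, -, hle⟩ := exists_direction_approx hc₁ hζm (hQ.ae_elasticity hF hg)
    (fun f hf => measurable_of_bddDirections hf) hα hη0
  filter_upwards [upper_expansion_of_direction hD hF hw hx hgm hg hQ hf (half_pos hη),
    nhdsWithin_le_nhds (Metric.ball_mem_nhds (0:ℝ) hx)] with ε h1 h2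
  rw [Metric.mem_ball, dist_zero_right, Real.norm_eq_abs] at h2
  obtain ⟨hmem, hsmall, hup⟩ := h1
  have hfm : Measurable fun ω => ε * ((1 + f ω) / x) :=
    ((hf.1.const_add 1).div_const x).const_mul ε
  have hpos : ∀ᵐ ω ∂P, 0 < g ω * (1 + ε * ((1 + f ω) / x)) := by
    filter_upwards [hg.pos, hsmall] with ω a b
    exact mul_pos a (by linarith [(abs_le.1 b).1])
  have h3 := hw.le hF (by linarith [(abs_lt.1 h2).1] : 0 < x + ε) hmem hpos
    (hg.integrable_scale hF hgm hfm hsmall).2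
  refine h3.trans (hup.trans ?_)
  have h4 : y / (2 * x) * ∫ ω, ζ (g ω) * (1 + f ω) ^ 2 ∂Q
      ≤ y / (2 * x) * (∫ ω, ζ (g ω) * (1 + α ω) ^ 2 ∂Q + η') := by gcongr
  have h5 : y / (2 * x) * η' = η / 2 := by
    rw [hη']; field_simp
  rw [mul_add, h5] at h4
  have h6 := mul_le_mul_of_nonneg_right
    (show y / (2 * x) * ∫ ω, ζ (g ω) * (1 + f ω) ^ 2 ∂Q + η / 2
      ≤ y / (2 * x) * ∫ ω, ζ (g ω) * (1 + α ω) ^ 2 ∂Q + η by linarith) (sq_nonneg ε)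
  linarith

/-- If the difference quotient is off by `2 k`, either the optimizer is far from the competitor,
which costs Bregman gap `E`, or the approximating direction is far from `α`, which is measured by
`δ`. -/
theorem weight_le_of_gap {k z p κ₀ ε d δ E : ℝ} (hk : 0 < k) (hz : 0 < z) (hp : 0 ≤ p)
    (hκ₀ : 0 < κ₀) (hε : ε ≠ 0) (hε1 : |ε| ≤ 1) (h : 2 * k ≤ |d| / |ε| + z * |δ|)
    (hE : κ₀ * p * min (|d| / z) 1 ^ 2 ≤ E) :
    p * min (k / z) 1 ^ 2 ≤ 1 / (κ₀ * ε ^ 2) * E + p * δ ^ 2 := by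
  have hm0 : 0 < min (k / z) 1 := lt_min (by positivity) one_pos
  have hE0 : 0 ≤ E := le_trans (by positivity) hE
  have habs : 0 < |ε| := abs_pos.2 hε
  rcases le_or_gt k (|d| / |ε|) with hc | hc
  · rw [le_div_iff₀ habs] at hc
    have hmin : |ε| * min (k / z) 1 ≤ min (|d| / z) 1 := by
      refine le_min ?_ (mul_le_one₀ hε1 hm0.le (min_le_right _ _))
      rw [le_div_iff₀ hz]
      have h1 : min (k / z) 1 * z ≤ k := by
        rw [← le_div_iff₀ hz]; exact min_le_left _ _
      have h2 : |ε| * (min (k / z) 1 * z) ≤ |ε| * k := by gcongr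
      linarith
    have hsq : ε ^ 2 * min (k / z) 1 ^ 2 ≤ min (|d| / z) 1 ^ 2 := by
      rw [← sq_abs ε, ← mul_pow]
      gcongr
    have h6 : κ₀ * p * (ε ^ 2 * min (k / z) 1 ^ 2) ≤ E := le_trans (by gcongr) hE
    have h7 : p * min (k / z) 1 ^ 2 ≤ 1 / (κ₀ * ε ^ 2) * E := by
      rw [div_mul_eq_mul_div, one_mul, le_div_iff₀ (by positivity)]
      linarith
    exact h7.trans (le_add_of_nonneg_right (by positivity))
  · have h9 : min (k / z) 1 ≤ |δ| := by
      refine (min_le_left _ _).trans ?_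
      rw [div_le_iff₀ hz]
      linarith
    have h10 : p * min (k / z) 1 ^ 2 ≤ p * δ ^ 2 := by
      rw [← sq_abs δ]
      gcongr
    exact h10.trans (le_add_of_nonneg_left (by positivity))

/-- The optimizers are differentiable in probability as soon as the second-order upper bound for
the value function is attained. -/
theorem tendstoInMeasure_of_lower_expansion [IsProbabilityMeasure P]
    (hD : ∀ h ∈ D, Measurable h) (hF : PowerLike F φ ζ c₁ c₂)
    (hw : IsValueFn P F φ (polar P D) w) (hx : 0 < x) (hy : 0 < y)
    (hgm : Measurable g) (hg : IsOpt P F φ (polar P D) x y g)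
    (hQ : IsTilt P Q (fun ω => g ω * φ (g ω)) (x * y)) (hc₁ : 0 < c₁)
    (hζm : AEMeasurable (fun ω => ζ (g ω)) Q)
    (hα : α ∈ closureL20 Q (bddDirections P (polar P D) x g))
    {G : ℝ → Ω → ℝ} {Y : ℝ → ℝ} (hG : ∀ t, 0 < t → IsOpt P F φ (polar P D) t (Y t) (G t))
    (hlow : ∀ η > 0, ∀ᶠ ε in 𝓝[≠] (0:ℝ),
      w x - y * ε + (y / (2 * x) * ∫ ω, ζ (g ω) * (1 + α ω) ^ 2 ∂Q - η) * ε ^ 2 ≤ w (x + ε)) :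
    TendstoInMeasure P (fun (ε : ℝ) ω => (G (x + ε) ω - g ω) / ε) (𝓝[≠] 0) (derivRV x g α) := by
  have := hQ.prob
  have hαm : Measurable α := hα.1.1
  have hα2 : MemLp α 2 Q := hα.1.2.1
  obtain ⟨κ₀, hκ₀, hgap⟩ := hF.exists_gap_bound
  have hdm : Measurable (derivRV x g α) := (hgm.div_const x).mul (hαm.const_add 1)
  have hφm := aestronglyMeasurable_comp_of_continuousOn hF.continuousOn_slope hgm hg.pos
  rw [tendstoInMeasure_iff_norm]
  intro κ hκ
  set k := κ / 2 with hk
  have hk0 : 0 < k := half_pos hκ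
  set r : Ω → ℝ := fun ω => g ω * φ (g ω) * min (k / g ω) 1 ^ 2 with hr
  have hrm : AEMeasurable r P := hg.integrable_mul.aestronglyMeasurable.aemeasurable.mul
    ((((hgm.const_div k).min measurable_const).pow_const 2).aemeasurable)
  have hrpos : ∀ᵐ ω ∂P, 0 < r ω := by
    filter_upwards [hg.pos] with ω a
    have := hF.pos _ a
    have : 0 < min (k / g ω) 1 := lt_min (by positivity) one_pos
    positivity
  have hrle : ∀ᵐ ω ∂P, r ω ≤ g ω * φ (g ω) := by
    filter_upwards [hg.pos] with ω a
    have := hF.pos _ a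
    have h0 : 0 ≤ min (k / g ω) 1 := le_min (by positivity) zero_le_one
    exact mul_le_of_le_one_right (by positivity) (pow_le_one₀ h0 (min_le_right _ _))
  have hrfin : ∫⁻ ω, ENNReal.ofReal (r ω) ∂P ≠ ∞ :=
    ne_top_of_le_ne_top (lintegral_ofReal_ne_top hg.integrable_mul)
      (lintegral_mono_ae (hrle.mono fun ω h => ENNReal.ofReal_le_ofReal h))
  -- For `x + ε ≤ 0` nothing is known about `G (x + ε)`, not even measurability; the empty set is
  -- substituted there, which is harmless near `ε = 0`.
  set s : ℝ → Set Ω := fun ε =>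
    if -x < ε then {ω | κ ≤ ‖(G (x + ε) ω - g ω) / ε - derivRV x g α ω‖} else ∅ with hs
  have hsm : ∀ ε, MeasurableSet (s ε) := by
    intro ε
    simp only [hs]
    split_ifs with h
    · have hGm := measurable_of_mem_scaled (hG (x + ε) (by linarith)).mem
      exact measurableSet_le measurable_const (((hGm.sub hgm).div_const ε).sub hdm).norm
    · exact MeasurableSet.empty
  have hsev : ∀ᶠ ε in 𝓝[≠] (0:ℝ), -x < ε :=
    nhdsWithin_le_nhds (Ioi_mem_nhds (by linarith))
  suffices h : Tendsto (fun ε => P (s ε)) (𝓝[≠] 0) (𝓝 0) by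
    refine h.congr' ?_
    filter_upwards [hsev] with ε hε
    simp only [hs, if_pos hε]
  refine tendsto_measure_zero_of_lintegral hsm hrm.ennreal_ofReal
    (hrpos.mono fun ω h => (ENNReal.ofReal_pos.2 h).ne') hrfin ?_
  rw [ENNReal.tendsto_nhds_zero]
  intro e he
  obtain ⟨e', he', hee⟩ : ∃ e' : ℝ, 0 < e' ∧ ENNReal.ofReal e' ≤ e := by
    rcases eq_or_ne e ∞ with rfl | hne
    · exact ⟨1, one_pos, le_top⟩
    · exact ⟨e.toReal, ENNReal.toReal_pos he.ne' hne, ENNReal.ofReal_toReal_le⟩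
  -- Total constant in front of `η`: the first term bounds the Bregman gap divided by `κ₀ ε²`, the
  -- second the error of approximating `α` by `f`.
  set M := (y / (2 * x) + 2) / κ₀ + y / x with hM
  have hM0 : 0 < M := by positivity
  set η := e' / M with hη
  have hη0 : 0 < η := by positivity
  obtain ⟨f, hf, hf2, hfd, hle⟩ := exists_direction_approx hc₁ hζm (hQ.ae_elasticity hF hg)
    (fun f hf => measurable_of_bddDirections hf) hα hη0
  filter_upwards [upper_expansion_of_direction hD hF hw hx hgm hg hQ hf hη0, hlow η hη0, hsev,
    self_mem_nhdsWithin, nhdsWithin_le_nhds (Metric.ball_mem_nhds (0:ℝ) one_pos)]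
    with ε h1 h2 hεx hne hε1
  rw [Metric.mem_ball, dist_zero_right, Real.norm_eq_abs] at hε1
  obtain ⟨hmem, hsmall, hup⟩ := h1
  have hxε : 0 < x + ε := by linarith
  have hne' : ε ≠ 0 := hne
  have hε2 : 0 < ε ^ 2 := by positivity
  have hfm : Measurable fun ω => ε * ((1 + f ω) / x) :=
    ((hf.1.const_add 1).div_const x).const_mul ε
  set gt : Ω → ℝ := fun ω => g ω * (1 + ε * ((1 + f ω) / x)) with hgt
  have hopt := hG (x + ε) hxε
  have hi := (hg.integrable_scale hF hgm hfm hsmall).2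
  obtain ⟨j1, j2⟩ := hopt.le _ hmem
  set Γ : Ω → ℝ := fun ω => F (gt ω) - F (G (x + ε) ω) + φ (G (x + ε) ω) * (gt ω - G (x + ε) ω)
    with hΓ
  have j0 : Integrable (fun ω => F (gt ω) - F (G (x + ε) ω)) P := hi.sub hopt.integrable
  have j3 : Integrable (fun ω => gt ω * φ (G (x + ε) ω) - G (x + ε) ω * φ (G (x + ε) ω)) P :=
    j1.sub hopt.integrable_mul
  have hΓe : Γ = fun ω => F (gt ω) - F (G (x + ε) ω)
      + (gt ω * φ (G (x + ε) ω) - G (x + ε) ω * φ (G (x + ε) ω)) := by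
    funext ω
    simp only [hΓ]
    ring
  have hΓi : Integrable Γ P := by rw [hΓe]; exact j0.add j3
  -- By the multiplier inequality at `x + ε`, the expected gap is at most the excess of the
  -- competitor over the optimal value; upper and lower expansions bound this excess by a multiple
  -- of `η ε²`.
  have hΓle : ∫ ω, Γ ω ∂P ≤ (y / (2 * x) + 2) * η * ε ^ 2 := by
    have : ∫ ω, Γ ω ∂P ≤ ∫ ω, F (gt ω) ∂P - w (x + ε) := by
      rw [hΓe, integral_add j0 j3, integral_sub hi hopt.integrable,
        integral_sub j1 hopt.integrable_mul, hopt.integral_mul, ← hw.eq hF hxε hopt]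
      linarith
    refine this.trans ?_
    have h4 : y / (2 * x) * ∫ ω, ζ (g ω) * (1 + f ω) ^ 2 ∂Q
        ≤ y / (2 * x) * (∫ ω, ζ (g ω) * (1 + α ω) ^ 2 ∂Q + η) := by gcongr
    have h5 : (y / (2 * x) * ∫ ω, ζ (g ω) * (1 + f ω) ^ 2 ∂Q) * ε ^ 2
        ≤ (y / (2 * x) * (∫ ω, ζ (g ω) * (1 + α ω) ^ 2 ∂Q + η)) * ε ^ 2 := by gcongr
    nlinarith
  have hdi : Integrable (fun ω => g ω * φ (g ω) * (f ω - α ω) ^ 2) P :=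
    (hQ.integrable_iff _).1 (hf2.sub hα2).integrable_sq
  have hdle : ∫ ω, g ω * φ (g ω) * (f ω - α ω) ^ 2 ∂P ≤ x * y * η := by
    rw [hQ.integral_eq]
    gcongr
  set T : Ω → ℝ := fun ω => 1 / (κ₀ * ε ^ 2) * Γ ω
    + 1 / x ^ 2 * (g ω * φ (g ω) * (f ω - α ω) ^ 2) with hT
  have hT1 : Integrable (fun ω => 1 / (κ₀ * ε ^ 2) * Γ ω) P := hΓi.const_mul _
  have hT2 : Integrable (fun ω => 1 / x ^ 2 * (g ω * φ (g ω) * (f ω - α ω) ^ 2)) P :=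
    hdi.const_mul _
  have hTi : Integrable T P := hT1.add hT2
  have hTle : ∫ ω, T ω ∂P ≤ e' := by
    rw [hT, integral_add hT1 hT2, integral_const_mul, integral_const_mul]
    calc _ ≤ 1 / (κ₀ * ε ^ 2) * ((y / (2 * x) + 2) * η * ε ^ 2) + 1 / x ^ 2 * (x * y * η) := by
          gcongr
      _ = M * η := by rw [hM]; field_simp
      _ = e' := by rw [hη]; field_simp
  have hgapω : ∀ᵐ ω ∂P, κ₀ * (g ω * φ (g ω)) * min (|G (x + ε) ω - gt ω| / g ω) 1 ^ 2 ≤ Γ ω := by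
    filter_upwards [hg.pos, hsmall, hopt.pos] with ω a b c
    obtain ⟨b1, b2⟩ := abs_le.1 b
    refine hgap (g ω) (gt ω) (G (x + ε) ω) a ?_ ?_ c
    · simp only [hgt]; nlinarith
    · simp only [hgt]; nlinarith
  have hTpos : ∀ᵐ ω ∂P, 0 ≤ T ω := by
    filter_upwards [hgapω, hg.pos] with ω a b
    have hφ := hF.pos _ b
    have : 0 ≤ Γ ω := le_trans (by positivity) a
    simp only [hT]
    positivity
  have hpt : ∀ᵐ ω ∂P, ω ∈ s ε → ENNReal.ofReal (r ω) ≤ ENNReal.ofReal (T ω) := by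
    filter_upwards [hgapω, hg.pos] with ω a b hω
    refine ENNReal.ofReal_le_ofReal ?_
    have hφ := hF.pos _ b
    simp only [hs, if_pos hεx, mem_ofPred_eq, Real.norm_eq_abs] at hω
    have hsplit : (G (x + ε) ω - g ω) / ε - derivRV x g α ω
        = (G (x + ε) ω - gt ω) / ε + g ω * ((f ω - α ω) / x) := by
      simp only [hgt, derivRV]
      field_simp
      ring
    rw [hsplit] at hω
    have hω' := hω.trans (abs_add_le _ _)
    rw [abs_div, abs_mul, abs_of_pos b] at hω'
    have h2k : 2 * k = κ := by rw [hk]; ring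
    refine (weight_le_of_gap (δ := (f ω - α ω) / x) hk0 b (mul_pos b hφ).le hκ₀ hne' hε1.le
      (h2k.le.trans hω') a).trans (le_of_eq ?_)
    simp only [hT]
    ring
  calc ∫⁻ ω in s ε, ENNReal.ofReal (r ω) ∂P
      ≤ ∫⁻ ω in s ε, ENNReal.ofReal (T ω) ∂P := by
        refine lintegral_mono_ae ?_
        rwa [ae_restrict_iff' (hsm ε)]
    _ ≤ ∫⁻ ω, ENNReal.ofReal (T ω) ∂P := setLIntegral_le_lintegral _ _
    _ = ENNReal.ofReal (∫ ω, T ω ∂P) := (ofReal_integral_eq_lintegral_ofReal hTi hTpos).symm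
    _ ≤ ENNReal.ofReal e' := ENNReal.ofReal_le_ofReal hTle
    _ ≤ e := hee

end SecondOrder

/-! ### Assembling the primal and dual expansions -/

section Duality

variable {Ω : Type*} [MeasurableSpace Ω] {P Q : Measure Ω} {C D : Set (Ω → ℝ)}
  {K₁ K₂ D₁ D₂ : Set (Ω → ℝ)} {F φ ζ F₁ φ₁ ζ₁ F₂ φ₂ ζ₂ w₁ w₂ I U : ℝ → ℝ}
  {c₁ c₂ d₁ d₂ a s t x y : ℝ} {g h α β : Ω → ℝ}

/-- For a pair of dual problems whose quadratic approximations have no duality gap, the multiplier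
is differentiable and so is, in probability, the optimizer. -/
theorem second_order_expansion [IsProbabilityMeasure P]
    (hK₁ : K₁ = polar P D₁) (hK₂ : K₂ = polar P D₂)
    (hD₁ : ∀ h ∈ D₁, Measurable h) (hD₂ : ∀ h ∈ D₂, Measurable h)
    (hF₁ : PowerLike F₁ φ₁ ζ₁ c₁ c₂) (hF₂ : PowerLike F₂ φ₂ ζ₂ d₁ d₂)
    (hw₁ : IsValueFn P F₁ φ₁ K₁ w₁) (hw₂ : IsValueFn P F₂ φ₂ K₂ w₂) (hx : 0 < x) (hy : 0 < y)
    (hgm : Measurable g) (hhm : Measurable h)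
    (hg : IsOpt P F₁ φ₁ K₁ x y g) (hh : IsOpt P F₂ φ₂ K₂ y x h)
    (hQ₁ : IsTilt P Q (fun ω => g ω * φ₁ (g ω)) (x * y))
    (hQ₂ : IsTilt P Q (fun ω => h ω * φ₂ (h ω)) (y * x))
    (hζ₁ : AEMeasurable (fun ω => ζ₁ (g ω)) Q) (hζ₂ : AEMeasurable (fun ω => ζ₂ (h ω)) Q)
    (hα : α ∈ closureL20 Q (bddDirections P K₁ x g))
    (hβ : β ∈ closureL20 Q (bddDirections P K₂ y h)) (ha0 : 0 < a)
    (ha : ∫ ω, ζ₁ (g ω) * (1 + α ω) ^ 2 ∂Q = a) (hb : ∫ ω, ζ₂ (h ω) * (1 + β ω) ^ 2 ∂Q = 1 / a)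
    (hconj : ∀ x' y', 0 < x' → 0 < y' → 0 ≤ w₁ x' + w₂ y' + x' * y')
    (he : w₁ x + w₂ y + x * y = 0) {G : ℝ → Ω → ℝ} {Y : ℝ → ℝ}
    (hG : ∀ t, 0 < t → IsOpt P F₁ φ₁ K₁ t (Y t) (G t)) (hYx : Y x = y) :
    HasDerivAt (fun t => -Y t) (y / x * a) x ∧
      TendstoInMeasure P (fun (ε : ℝ) ω => (G (x + ε) ω - g ω) / ε) (𝓝[≠] 0) (derivRV x g α) := by
  subst hK₁ hK₂
  have hup₁ := fun η (hη : 0 < η) =>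
    hw₁.upper_expansion hD₁ hF₁ hx hy hgm hg hQ₁ hF₁.c₁_pos hζ₁ hα hη
  have hup₂ := fun η (hη : 0 < η) =>
    hw₂.upper_expansion hD₂ hF₂ hy hx hhm hh hQ₂ hF₂.c₁_pos hζ₂ hβ hη
  simp only [hb] at hup₂
  have hA : 0 < y / x * a := by positivity
  -- With dual quadratic value `1 / a`, the conjugate of the upper expansion of `w₂` has exactly the
  -- coefficient in the upper expansion of `w₁`. This is where the absence of a quadratic duality
  -- gap enters.
  have hlow : ∀ η > 0, ∀ᶠ ε in 𝓝[≠] (0:ℝ),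
      w₁ x - y * ε + (y / x * a / 2 - η) * ε ^ 2 ≤ w₁ (x + ε) := by
    refine lower_expansion_of_conjugate hx hy hA hconj he fun η hη => ?_
    have e : 1 / (2 * (y / x * a)) = x / (2 * y) * (1 / a) := by field_simp
    rw [e]
    exact hup₂ η hη
  have e₁ : y / x * a / 2 = y / (2 * x) * a := by field_simp
  constructor
  · refine hasDerivAt_of_expansion (w := w₁) hx (fun t t' ht ht' => ?_) fun η hη => ?_
    · have := hw₁.tangent_le hF₁ ht ht' (hG t ht)
      linarith
    · filter_upwards [hup₁ η hη, hlow η hη] with ε h1 h2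
      rw [ha, ← e₁] at h1
      rw [hYx, abs_le]
      constructor <;> linarith
  · refine tendstoInMeasure_of_lower_expansion hD₁ hF₁ hw₁ hx hy hgm hg hQ₁ hF₁.c₁_pos hζ₁ hα hG
      fun η hη => ?_
    rw [ha, ← e₁]
    exact hlow η hη

/-- The elasticity of the conjugate was expressed through `I`, whose values off `(0, ∞)` are
arbitrary. The coefficient `relCoeff F` agrees with it on `(0, ∞)` and is measurable on the whole
line. -/
theorem PowerLike.with_relCoeff (hF : PowerLike F φ ζ c₁ c₂) :
    PowerLike F φ (relCoeff F) c₁ c₂ where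
  c₁_pos := hF.c₁_pos
  pos := hF.pos
  hasDerivAt := hF.hasDerivAt
  hasDerivAt_slope z hz := by rw [hF.relCoeff_eq hz]; exact hF.hasDerivAt_slope z hz
  lower z hz := by rw [hF.relCoeff_eq hz]; exact hF.lower z hz
  upper z hz := by rw [hF.relCoeff_eq hz]; exact hF.upper z hz

theorem measurable_relCoeff (F : ℝ → ℝ) : Measurable (relCoeff F) :=
  ((measurable_id.mul (measurable_deriv _)).div (measurable_deriv F)).neg

theorem integral_curvature_mul_sq (hQ : IsTilt P Q (fun ω => g ω * φ (g ω)) (x * y)) (hx : 0 < x)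
    (hpos : ∀ᵐ ω ∂P, 0 < g ω) (hi : Integrable (fun ω => ζ (g ω) * (1 + α ω) ^ 2) Q) :
    Integrable (fun ω => ζ (g ω) * φ (g ω) / g ω * derivRV x g α ω ^ 2) P ∧
      ∫ ω, ζ (g ω) * φ (g ω) / g ω * derivRV x g α ω ^ 2 ∂P
        = y / x * ∫ ω, ζ (g ω) * (1 + α ω) ^ 2 ∂Q := by
  have e : (fun ω => 1 / x ^ 2 * (g ω * φ (g ω) * (ζ (g ω) * (1 + α ω) ^ 2)))
      =ᵐ[P] fun ω => ζ (g ω) * φ (g ω) / g ω * derivRV x g α ω ^ 2 := by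
    filter_upwards [hpos] with ω a
    simp only [derivRV]
    field_simp
  refine ⟨(((hQ.integrable_iff _).1 hi).const_mul _).congr e, ?_⟩
  rw [← integral_congr_ae e, integral_const_mul, hQ.integral_eq]
  field_simp

/-- If `s` is the multiplier at capital `r`, then `v(s) = u(r) - r s`, and the claim is the tangent
inequality for the concave function `u` at `r`. -/
theorem uFun_le_vFun_add [IsProbabilityMeasure P] (hCD : BipolarPair P C D)
    (hC_bdd : BoundedInL0 P C) (hC_one : (fun _ => (1 : ℝ)) ∈ C) (hU : IsUtility U)
    (hA : RiskAversionBounds U c₁ c₂) (hu : ∀ t : ℝ, 0 < t → primalValue P C U t < ⊤)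
    (ht : 0 < t) (hs : 0 < s) : 0 ≤ -uFun P C U t + vFun P D U s + t * s := by
  obtain ⟨r, g, hr, hgm, hg⟩ := hCD.exists_isOpt_of_multiplier hC_bdd hC_one hU hA hu hs
  have hUi : Integrable (fun ω => U (g ω)) P := hg.integrable.neg.congr
    (Eventually.of_forall fun ω => by simp)
  have h1 := (hCD.uFun_isValueFn hC_bdd hC_one hU hA hu).tangent_le
    (powerLike_neg_utility hU hA) hr ht hg
  have h2 : vFun P D U s = uFun P C U r - r * s := by
    rw [vFun, uFun, (isOpt_dualValue hCD hU hA hr hs hgm hg).1, (isOpt_primalValue hCD hU hA hg).1,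
      EReal.toReal_coe, EReal.toReal_coe, integral_sub hUi hg.integrable_mul, hg.integral_mul]
  rw [h2]
  linarith

theorem uFun_eq_vFun_add (hCD : BipolarPair P C D)
    (hU : IsUtility U) (hA : RiskAversionBounds U c₁ c₂) (ht : 0 < t) (hs : 0 < s)
    (hgm : Measurable g) (hg : IsOpt P (fun z => -U z) (deriv U) C t s g) :
    -uFun P C U t + vFun P D U s + t * s = 0 := by
  have hUi : Integrable (fun ω => U (g ω)) P := hg.integrable.neg.congr
    (Eventually.of_forall fun ω => by simp)
  rw [vFun, uFun, (isOpt_dualValue hCD hU hA ht hs hgm hg).1, (isOpt_primalValue hCD hU hA hg).1,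
    EReal.toReal_coe, EReal.toReal_coe, integral_sub hUi hg.integrable_mul, hg.integral_mul]
  ring

theorem uFun_hasDerivAt [IsProbabilityMeasure P] (hCD : BipolarPair P C D)
    (hC_bdd : BoundedInL0 P C) (hC_one : (fun _ => (1 : ℝ)) ∈ C) (hU : IsUtility U)
    (hA : RiskAversionBounds U c₁ c₂) (hu : ∀ t : ℝ, 0 < t → primalValue P C U t < ⊤)
    (ht : 0 < t) (hgm : Measurable g) (hg : IsOpt P (fun z => -U z) (deriv U) C t y g) :
    HasDerivAt (uFun P C U) y t := by
  have := ((hCD.uFun_isValueFn hC_bdd hC_one hU hA hu).hasDerivAt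
    (powerLike_neg_utility hU hA) ht hgm hg).neg
  rw [neg_neg] at this
  exact this.congr_of_eventuallyEq (Eventually.of_forall fun t => (neg_neg _).symm)

/-- Uniqueness transfers the first-order conditions from the constructed optimizer to any solution,
and differentiability identifies the multiplier as `u'(t)`. -/
theorem isOpt_of_isPrimalSol [IsProbabilityMeasure P] (hCD : BipolarPair P C D)
    (hC_bdd : BoundedInL0 P C) (hC_one : (fun _ => (1 : ℝ)) ∈ C) (hU : IsUtility U)
    (hA : RiskAversionBounds U c₁ c₂) (hu : ∀ t : ℝ, 0 < t → primalValue P C U t < ⊤)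
    (ht : 0 < t) (hg : IsPrimalSol P C U t g) :
    IsOpt P (fun z => -U z) (deriv U) C t (deriv (uFun P C U) t) g ∧ 0 < deriv (uFun P C U) t := by
  obtain ⟨y, g', hy, hgm', hg', -⟩ := hCD.uFun_isValueFn hC_bdd hC_one hU hA hu t ht
  rw [(uFun_hasDerivAt hCD hC_bdd hC_one hU hA hu ht hgm' hg').deriv]
  exact ⟨hg'.congr hg.1 ((isOpt_primalValue hCD hU hA hg').2.2 g hg), hy⟩

theorem isOpt_of_isDualSol [IsProbabilityMeasure P] (hCD : BipolarPair P C D)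
    (hC_bdd : BoundedInL0 P C) (hC_one : (fun _ => (1 : ℝ)) ∈ C) (hU : IsUtility U)
    (hA : RiskAversionBounds U c₁ c₂) (hu : ∀ t : ℝ, 0 < t → primalValue P C U t < ⊤)
    (hI : ∀ s, 0 < s → 0 < I s ∧ deriv U (I s) = s) (hI' : ∀ z, 0 < z → I (deriv U z) = z)
    (hs : 0 < s) (hh : IsDualSol P D U s h) :
    IsOpt P (conjV U) I D s (-deriv (vFun P D U) s) h := by
  obtain ⟨t, g, ht, hgm, hg⟩ := hCD.exists_isOpt_of_multiplier hC_bdd hC_one hU hA hu hs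
  have hc := isOpt_conj hCD hU hA hI' ht hs hgm hg
  have hd := (hCD.vFun_isValueFn hC_bdd hC_one hU hA hu hI').hasDerivAt
    (powerLike_conjV hU hA hI hI') hs ((measurable_deriv U).comp hgm) hc
  rw [hd.deriv, neg_neg]
  exact hc.congr hh.1 ((isOpt_dualValue hCD hU hA ht hs hgm hg).2.2 h hh)

theorem value_functions_regular [IsProbabilityMeasure P] (hCD : BipolarPair P C D)
    (hC_bdd : BoundedInL0 P C) (hC_one : (fun _ => (1 : ℝ)) ∈ C) (hU : IsUtility U)
    (hA : RiskAversionBounds U c₁ c₂) (hu : ∀ t : ℝ, 0 < t → primalValue P C U t < ⊤)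
    (ht : 0 < t) :
    primalValue P C U t = (uFun P C U t : EReal) ∧
    dualValue P D U t = (vFun P D U t : EReal) ∧
    DifferentiableAt ℝ (uFun P C U) t ∧
    DifferentiableAt ℝ (vFun P D U) t ∧
    (∃ g, IsPrimalSol P C U t g) ∧
    (∀ g₁ g₂, IsPrimalSol P C U t g₁ → IsPrimalSol P C U t g₂ → g₁ =ᵐ[P] g₂) ∧
    (∃ h, IsDualSol P D U t h) ∧
    (∀ h₁ h₂, IsDualSol P D U t h₁ → IsDualSol P D U t h₂ → h₁ =ᵐ[P] h₂) := by
  obtain ⟨I, hI, hI'⟩ := (powerLike_neg_utility hU hA).exists_inverse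
  obtain ⟨y, g, hy, hgm, hg, -⟩ := hCD.uFun_isValueFn hC_bdd hC_one hU hA hu t ht
  obtain ⟨r, f, hr, hfm, hf⟩ := hCD.exists_isOpt_of_multiplier hC_bdd hC_one hU hA hu ht
  obtain ⟨p1, p2, p3⟩ := isOpt_primalValue hCD hU hA hg
  obtain ⟨q1, q2, q3⟩ := isOpt_dualValue hCD hU hA hr ht hfm hf
  have hd := (hCD.vFun_isValueFn hC_bdd hC_one hU hA hu hI').hasDerivAt
    (powerLike_conjV hU hA hI hI') ht ((measurable_deriv U).comp hfm)
    (isOpt_conj hCD hU hA hI' hr ht hfm hf)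
  exact ⟨by rw [uFun, p1, EReal.toReal_coe], by rw [vFun, q1, EReal.toReal_coe],
    (uFun_hasDerivAt hCD hC_bdd hC_one hU hA hu ht hgm hg).differentiableAt, hd.differentiableAt,
    ⟨g, p2⟩, fun g₁ g₂ h₁ h₂ => (p3 g₁ h₁).symm.trans (p3 g₂ h₂), ⟨_, q2⟩,
    fun h₁ h₂ k₁ k₂ => (q3 h₁ k₁).symm.trans (q3 h₂ k₂)⟩

end Duality

/-! ### The main theorem -/

theorem theorem2 {Ω : Type*} [MeasurableSpace Ω] (P : Measure Ω) [IsProbabilityMeasure P]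
    (C D : Set (Ω → ℝ)) (U : ℝ → ℝ) (c₁ c₂ : ℝ) (x : ℝ)
    (hC_bdd : BoundedInL0 P C)
    (hC_one : (fun _ => (1 : ℝ)) ∈ C)
    (hCD : BipolarPair P C D)
    (hU : IsUtility U)
    (hA : RiskAversionBounds U c₁ c₂)
    (hu : ∀ t : ℝ, 0 < t → primalValue P C U t < ⊤)
    (hx : 0 < x) :
    -- The objects in the statement are well defined: `u`, `v` are finite and differentiable on
    -- `(0, ∞)`, `u'(x) > 0`, and the optimizers exist and are unique.
    ((∀ t : ℝ, 0 < t →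
        primalValue P C U t = (uFun P C U t : EReal) ∧
        dualValue P D U t = (vFun P D U t : EReal) ∧
        DifferentiableAt ℝ (uFun P C U) t ∧
        DifferentiableAt ℝ (vFun P D U) t ∧
        (∃ g, IsPrimalSol P C U t g) ∧
        (∀ g₁ g₂, IsPrimalSol P C U t g₁ → IsPrimalSol P C U t g₂ → g₁ =ᵐ[P] g₂) ∧
        (∃ h, IsDualSol P D U t h) ∧
        (∀ h₁ h₂, IsDualSol P D U t h₁ → IsDualSol P D U t h₂ → h₁ =ᵐ[P] h₂)) ∧
      0 < deriv (uFun P C U) x) ∧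
    -- Now `y = u'(x)`, and `g t`, `h t` are (versions of) the optimizers `g(t)`, `h(t)`.
    ∀ (y : ℝ) (g h : ℝ → Ω → ℝ),
      y = deriv (uFun P C U) x →
      (∀ t : ℝ, 0 < t → IsPrimalSol P C U t (g t)) →
      (∀ t : ℝ, 0 < t → IsDualSol P D U t (h t)) →
      Complementary (measR P x y (g x) (h y))
        (A2 P C x y (g x) (h y)) (B2 P D x y (g x) (h y)) →
      -- The solutions of the auxiliary problems exist and are unique.
      ((∃ α, IsAlpha P C U x y (g x) (h y) α) ∧
        (∀ α₁ α₂, IsAlpha P C U x y (g x) (h y) α₁ → IsAlpha P C U x y (g x) (h y) α₂ →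
          α₁ =ᵐ[P] α₂) ∧
        (∃ β, IsBeta P D U x y (g x) (h y) β) ∧
        (∀ β₁ β₂, IsBeta P D U x y (g x) (h y) β₁ → IsBeta P D U x y (g x) (h y) β₂ →
          β₁ =ᵐ[P] β₂)) ∧
      -- Second derivatives of the value functions.
      (DifferentiableAt ℝ (deriv (uFun P C U)) x ∧
        DifferentiableAt ℝ (deriv (vFun P D U)) y ∧
        -(x * deriv (deriv (uFun P C U)) x / deriv (uFun P C U) x)
          = aVal P C U x y (g x) (h y) ∧
        c₁ < aVal P C U x y (g x) (h y) ∧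
        aVal P C U x y (g x) (h y) < c₂ ∧
        -(y * deriv (deriv (vFun P D U)) y / deriv (vFun P D U) y)
          = bVal P D U x y (g x) (h y) ∧
        1 / c₂ < bVal P D U x y (g x) (h y) ∧
        bVal P D U x y (g x) (h y) < 1 / c₁) ∧
      ∀ α β : Ω → ℝ,
        IsAlpha P C U x y (g x) (h y) α →
        IsBeta P D U x y (g x) (h y) β →
        -- Derivatives of the optimizers in probability.
        (TendstoInMeasure P (fun (ε : ℝ) ω => (g (x + ε) ω - g x ω) / ε) (𝓝[≠] 0)
            (derivRV x (g x) α) ∧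
          TendstoInMeasure P (fun (ε : ℝ) ω => (h (y + ε) ω - h y ω) / ε) (𝓝[≠] 0)
            (derivRV y (h y) β)) ∧
        -- Relations between the second derivatives and the derivatives of the optimizers.
        (Integrable (fun ω => deriv (deriv U) (g x ω) * derivRV x (g x) α ω ^ 2) P ∧
          deriv (deriv (uFun P C U)) x
            = ∫ ω, deriv (deriv U) (g x ω) * derivRV x (g x) α ω ^ 2 ∂P ∧
          Integrable (fun ω => deriv (deriv (conjV U)) (h y ω) * derivRV y (h y) β ω ^ 2) P ∧
          deriv (deriv (vFun P D U)) y
            = ∫ ω, deriv (deriv (conjV U)) (h y ω) * derivRV y (h y) β ω ^ 2 ∂P ∧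
          (∀ᵐ ω ∂P, deriv (deriv U) (g x ω) * derivRV x (g x) α ω
            = deriv (deriv (uFun P C U)) x * derivRV y (h y) β ω)) := by
  have hF := powerLike_neg_utility hU hA
  obtain ⟨I, hI, hI'⟩ := hF.exists_inverse
  have hV := (powerLike_conjV hU hA hI hI').with_relCoeff
  refine ⟨⟨fun t ht => value_functions_regular hCD hC_bdd hC_one hU hA hu ht, ?_⟩, ?_⟩
  · obtain ⟨g, hg⟩ := (value_functions_regular hCD hC_bdd hC_one hU hA hu hx).2.2.2.2.1
    exact (isOpt_of_isPrimalSol hCD hC_bdd hC_one hU hA hu hx hg).2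
  intro y g h hyx hg hh hcomp
  have hG := fun t (ht : 0 < t) =>
    (isOpt_of_isPrimalSol hCD hC_bdd hC_one hU hA hu ht (hg t ht)).1
  have hH := fun s (hs : 0 < s) =>
    isOpt_of_isDualSol hCD hC_bdd hC_one hU hA hu hI hI' hs (hh s hs)
  have hy : 0 < y := by
    rw [hyx]
    exact (isOpt_of_isPrimalSol hCD hC_bdd hC_one hU hA hu hx (hg x hx)).2
  have hgx := hG x hx
  rw [← hyx] at hgx
  have hgm : Measurable (g x) := by
    have := hgx.mem
    rw [hCD.1] at this
    exact measurable_of_mem_scaled this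
  have hhm : Measurable (h y) := by
    have := (hH y hy).mem
    rw [hCD.2] at this
    exact measurable_of_mem_scaled this
  have hhg : h y =ᵐ[P] fun ω => deriv U (g x ω) :=
    ((isOpt_dualValue hCD hU hA hx hy hgm hgx).2.2 _ (hh y hy)).symm
  have hc := isOpt_conj hCD hU hA hI' hx hy hgm hgx
  have hhy : IsOpt P (conjV U) I D y x (h y) := hc.congr (hH y hy).mem hhg.symm
  have hwu := hCD.uFun_isValueFn hC_bdd hC_one hU hA hu
  have hwv := hCD.vFun_isValueFn hC_bdd hC_one hU hA hu hI'
  have hdv : deriv (vFun P D U) y = -x := (hwv.hasDerivAt hV hy hhm hhy).deriv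
  have hQ₁ := hgx.isTilt hF hx hy hhg
  have hgh : g x =ᵐ[P] fun ω => I (h y ω) := by
    filter_upwards [hhg, hgx.pos] with ω e a
    rw [e, hI' _ a]
  have hQ₂ := hhy.isTilt hV hy hx hgh
  rw [← measR_comm] at hQ₂
  simp only [IsAlpha, IsBeta, aVal, bVal]
  rw [← hyx, hdv]
  have hcomp' := hcomp.symm
  set Q := measR P x y (g x) (h y) with hQ
  have hprob := hQ₁.prob
  set σ : Ω → ℝ := fun ω => relCoeff U (g x ω) with hσ
  set τ : Ω → ℝ := fun ω => relCoeff (conjV U) (h y ω) with hτ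
  have hσm : Measurable σ := (measurable_relCoeff U).comp hgm
  have hτm : Measurable τ := (measurable_relCoeff (conjV U)).comp hhm
  have hσb : ∀ᵐ ω ∂Q, c₁ < σ ω ∧ σ ω < c₂ :=
    IsTilt.ae_elasticity (g := g x) (φ := deriv U) (ζ := relCoeff U) hQ₁ hF hgx
  have hτb : ∀ᵐ ω ∂Q, 1 / c₂ < τ ω ∧ τ ω < 1 / c₁ :=
    IsTilt.ae_elasticity (g := h y) (φ := I) (ζ := relCoeff (conjV U)) hQ₂ hV hhy
  -- Since `h(y) = U'(g(x))`, the relative risk tolerance at `h(y)` is the reciprocal of the risk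
  -- aversion at `g(x)`: the hypothesis of quadratic duality.
  have hτσ : ∀ᵐ ω ∂Q, τ ω = 1 / σ ω := by
    refine hQ₁.ac.ae_le ?_
    filter_upwards [hhg, hgx.pos] with ω e a
    simp only [hτ, hσ]
    rw [e, (powerLike_conjV hU hA hI hI').relCoeff_eq (hF.pos _ a), hI' _ a]
  obtain ⟨α₀, hα₀, uα, -⟩ := hcomp.exists_isQuadSol hF.c₁_pos hσm hσb
  obtain ⟨β₀, hβ₀, uβ, -⟩ := hcomp'.exists_isQuadSol hV.c₁_pos hτm hτb
  obtain ⟨hβ₁, hab⟩ := hcomp.quad_duality hF.c₁_pos hσm hσb hτm hτσ hα₀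
  obtain ⟨ha₁, ha₂⟩ := hcomp.quadValue_bounds hF.c₁_pos hσm hσb
  obtain ⟨hb₁, hb₂⟩ := hcomp'.quadValue_bounds hV.c₁_pos hτm hτb
  set a := quadValue Q σ (A2 P C x y (g x) (h y)) with ha
  set b := quadValue Q τ (B2 P D x y (g x) (h y)) with hb
  have ha0 : 0 < a := hF.c₁_pos.trans ha₁
  have hb0 : 0 < b := hV.c₁_pos.trans hb₁
  have hYH : -deriv (vFun P D U) y = x := by rw [hdv, neg_neg]
  have hconj := fun x' y' (h₁ : 0 < x') (h₂ : 0 < y') =>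
    uFun_le_vFun_add hCD hC_bdd hC_one hU hA hu h₁ h₂
  have hconj' : ∀ x' y', 0 < x' → 0 < y' → 0 ≤ vFun P D U x' + -uFun P C U y' + x' * y' := by
    intro x' y' h₁ h₂
    linarith [hconj y' x' h₂ h₁]
  have he := uFun_eq_vFun_add hCD hU hA hx hy hgm hgx
  have he' : vFun P D U y + -uFun P C U x + y * x = 0 := by linarith
  have primal : ∀ α β, IsQuadSol Q σ (A2 P C x y (g x) (h y)) α →
      IsQuadSol Q τ (B2 P D x y (g x) (h y)) β →
      HasDerivAt (fun t => -deriv (uFun P C U) t) (y / x * a) x ∧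
        TendstoInMeasure P (fun (ε : ℝ) ω => (g (x + ε) ω - g x ω) / ε) (𝓝[≠] 0)
          (derivRV x (g x) α) := fun α β hα hβ =>
    second_order_expansion hCD.1 hCD.2 hCD.measurable_right hCD.measurable_left hF hV hwu hwv
      hx hy hgm hhm hgx hhy hQ₁ hQ₂ hσm.aemeasurable hτm.aemeasurable hα.1 hβ.1 ha0 hα.2
      (hβ.2.trans hab) hconj he hG hyx.symm
  have dual : ∀ α β, IsQuadSol Q σ (A2 P C x y (g x) (h y)) α →
      IsQuadSol Q τ (B2 P D x y (g x) (h y)) β →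
      HasDerivAt (fun s => - -deriv (vFun P D U) s) (x / y * b) y ∧
        TendstoInMeasure P (fun (ε : ℝ) ω => (h (y + ε) ω - h y ω) / ε) (𝓝[≠] 0)
          (derivRV y (h y) β) := fun α β hα hβ =>
    second_order_expansion hCD.2 hCD.1 hCD.measurable_left hCD.measurable_right hV hF hwv hwu
      hy hx hhm hgm hhy hgx hQ₂ hQ₁ hτm.aemeasurable hσm.aemeasurable hβ.1 hα.1 hb0 hβ.2
      (hα.2.trans (by rw [← ha, hab, one_div_one_div])) hconj' he' hH hYH
  have hu2 : HasDerivAt (deriv (uFun P C U)) (-(y / x * a)) x := by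
    have := (primal α₀ β₀ hα₀ hβ₀).1.neg
    exact this.congr_of_eventuallyEq (Eventually.of_forall fun t => (neg_neg _).symm)
  have hv2 : HasDerivAt (deriv (vFun P D U)) (x / y * b) y := by
    exact (dual α₀ β₀ hα₀ hβ₀).1.congr_of_eventuallyEq
      (Eventually.of_forall fun t => (neg_neg _).symm)
  rw [hu2.deriv, hv2.deriv]
  have hUpp : ∀ z, 0 < z → deriv (deriv U) z = -(relCoeff U z * deriv U z / z) :=
    fun z hz => (hF.hasDerivAt_slope z hz).deriv
  refine ⟨⟨⟨α₀, hα₀⟩, fun α₁ α₂ h₁ h₂ => hQ₁.ac'.ae_eq ((uα α₁ h₁).trans (uα α₂ h₂).symm),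
    ⟨β₀, hβ₀⟩, fun β₁ β₂ h₁ h₂ => hQ₁.ac'.ae_eq ((uβ β₁ h₁).trans (uβ β₂ h₂).symm)⟩,
    ⟨hu2.differentiableAt, hv2.differentiableAt, ?_, ha₁, ha₂, ?_, hb₁, ?_⟩, ?_⟩
  · field_simp
  · field_simp
  · exact hb₂
  intro α β hα hβ
  have lα : MemLp (fun ω => 1 + α ω) 2 Q := (memLp_const (1:ℝ)).add (hcomp.mem_L20 hα.1).2.1
  have lβ : MemLp (fun ω => 1 + β ω) 2 Q := (memLp_const (1:ℝ)).add (hcomp'.mem_L20 hβ.1).2.1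
  have iα : Integrable (fun ω => σ ω * (1 + α ω) ^ 2) Q :=
    (integrable_weight_mul hF.c₁_pos hσm.aemeasurable hσb lα lα).congr
      (Eventually.of_forall fun ω => by simp only; ring)
  have iβ : Integrable (fun ω => τ ω * (1 + β ω) ^ 2) Q :=
    (integrable_weight_mul hV.c₁_pos hτm.aemeasurable hτb lβ lβ).congr
      (Eventually.of_forall fun ω => by simp only; ring)
  obtain ⟨j1, j2⟩ := integral_curvature_mul_sq (g := g x) (φ := deriv U) (ζ := relCoeff U) hQ₁ hx hgx.pos iα
  obtain ⟨k1, k2⟩ := integral_curvature_mul_sq (g := h y) (φ := I) (ζ := relCoeff (conjV U))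
    hQ₂ hy hhy.pos iβ
  have eU : (fun ω => -(relCoeff U (g x ω) * deriv U (g x ω) / g x ω * derivRV x (g x) α ω ^ 2))
      =ᵐ[P] fun ω => deriv (deriv U) (g x ω) * derivRV x (g x) α ω ^ 2 := by
    filter_upwards [hgx.pos] with ω p
    rw [hUpp _ p, neg_mul]
  have eV : (fun ω => relCoeff (conjV U) (h y ω) * I (h y ω) / h y ω * derivRV y (h y) β ω ^ 2)
      =ᵐ[P] fun ω => deriv (deriv (conjV U)) (h y ω) * derivRV y (h y) β ω ^ 2 := by
    filter_upwards [hhy.pos] with ω p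
    rw [hV.deriv_deriv p]
  refine ⟨⟨(primal α β hα hβ).2, (dual α β hα hβ).2⟩, j1.neg.congr eU, ?_, k1.congr eV, ?_, ?_⟩
  · rw [← integral_congr_ae eU, integral_neg, j2, hα.2]
  · rw [← integral_congr_ae eV, k2, hβ.2]
  -- Uniqueness identifies `β` with `σ (1 + α) / a - 1`; the identity is then algebra with `U'' = -A
  -- U' / g`, `u'' = -(y / x) a` and `h(y) = U'(g(x))`.
  · have hβe := (uβ β hβ).trans (uβ _ hβ₁).symm
    filter_upwards [hQ₁.ac'.ae_eq (uα α hα), hQ₁.ac'.ae_eq hβe, hgx.pos, hhg] with ω e₁ e₂ p e₃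
    rw [hUpp _ p, derivRV, derivRV, e₁, e₂, e₃]
    simp only [hσ]
    field_simp
    ring
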